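/- A cell is a unit square with integer vertices; a polyomino is a nonempty finite union of cells with connected interior, taken up to translation; its area is its number of cells. The columns of a polyomino are the blocks of the partition of its cells by horizontal projection. A column is simplex (resp. duplex) if it has exactly one (resp. two) connected components. A simplex-duplex polyomino is a polyomino all of whose columns are simplex or duplex and which has no two consecutive duplex columns. Columns are ordered from left to right. If a simplex-duplex polyomino $P$ has at least two simplex columns, its lower (resp. upper) pivot cell is the right neighbour of the bottom (resp. top) cell of the second-last among its simplex columns. If $P$ has a duplex column, its lower (resp. upper) inner pivot cell is the right neighbour of the top cell of the lower component (resp. of the bottom cell of the upper component) of the last among its duplex columns. These cells need not belong to $P$. Let $S$ be the set of simplex-duplex polyominoes whose last column is simplex. Let $S_\alpha$ be the set of $P\in S$ with no simplex column other than the last one. For $P\in S\setminus S_\alpha$ put: * $P\in S_\beta$ (resp. $P\in S_\gamma$) if the second-last column is simplex and the last column contains (resp. does not contain) the lower pivot cell. * $P\in S_\delta$ (resp. $P\in S_\epsilon$) if the second-last column is duplex, the third-last column is simplex, the lower component of the second-last column has no edge in common with the third-last column, and the lower pivot cell lies in the upper component (resp. in the hole) of the second-last column. * $S_\zeta$ (resp.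 $S_\eta$) is defined like $S_\delta$ (resp. $S_\epsilon$) with "lower" and "upper" interchanged. * $P\in S_\theta$ if the second-last column is duplex, the third-last column is simplex, and each of the two components of the second-last column has an edge in common with the third-last column and an edge in common with the last column. * $P\in S_\iota$ (resp. $P\in S_\kappa$) if the second-last column is duplex, the third-last column is simplex, each of the two components of the second-last column has an edge in common with the third-last column, the last column has an edge in common with the lower but not with the upper component of the second-last column, and the last column does not contain (resp. contains) the lower inner pivot cell. * $S_\lambda$ (resp. $S_\mu$) is defined like $S_\iota$ (resp. $S_\kappa$) with "lower" and "upper" interchanged. For a set $X$ of polyominoes whose last column is simplex consider the formal power series in $q$ with coefficients in $\mathbb Q[t,w]$ $$\sum_{P\in X} q^{\text{area of }P}\,t^{\text{height of the last column of }P}\,w^{\text{number of duplex columns of }P}.$$ Let $A(t)=A(q,t,w)$ be this series for $X=S$ and $A_x(t)$ the one for $X=S_x$. Let $A(qt)$ be obtained from $A(t)$ by substituting $qt$ for $t$, and let $$A_1=A(q,1,w),\qquad B_1=\left.\frac{\partial}{\partial t}\frac{A(q,t,w)}{t}\right|_{t=1},\qquad C_1=\frac12\left.\frac{\partial^2}{\partial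 t^2}\frac{A(q,t,w)}{t}\right|_{t=1}.$$ **Theorem 1.** The twelve sets $S_\alpha,S_\beta,\ldots,S_\mu$ form a partition of $S$, and $$\begin{aligned} A_\alpha(t)&=\frac{qt}{1-qt}+\frac{q^5t^3w}{(1-q)^2(1-qt)^3},\\ A_\beta(t)&=\frac{qt}{(1-qt)^2}A_1,\qquad A_\gamma(t)=\frac{qt}{1-qt}B_1,\\ A_\delta(t)=A_\zeta(t)&=\frac{q^5t^3w}{(1-q)^3(1-qt)^3}A_1,\\ A_\epsilon(t)=A_\eta(t)&=\frac{q^5t^3w}{(1-q)^2(1-qt)^4}A_1-\frac{q^4t^2w}{(1-q)^2(1-qt)^4}A(qt),\\ A_\theta(t)&=\frac{q^5t^3w}{(1-q)^2(1-qt)^3}B_1-\frac{q^5t^3w}{(1-q)^2(1-qt)^4}A_1+\frac{q^4t^2w}{(1-q)^2(1-qt)^4}A(qt),\\ A_\iota(t)=A_\lambda(t)&=\frac{q^4tw}{(1-q)^3(1-qt)}C_1,\\ A_\kappa(t)=A_\mu(t)&=\frac{q^3tw}{(1-q)^2(1-qt)^2}C_1-\frac{q^5t^3w}{(1-q)^2(1-qt)^3}B_1\\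 &\quad+\frac{q^5t^3w}{(1-q)^2(1-qt)^4}A_1-\frac{q^4t^2w}{(1-q)^2(1-qt)^4}A(qt). \end{aligned}$$ Consequently $A(t)=A_\alpha(t)+A_\beta(t)+\cdots+A_\mu(t)$, and $$\begin{aligned} A(t)&=\frac{qt}{1-qt}\left[1+B_1+\frac{2q^3w}{(1-q)^3}C_1\right]+\frac{qt}{(1-qt)^2}\left[A_1+\frac{2q^2w}{(1-q)^2}C_1\right]\\ &\quad+\frac{q^5t^3w}{(1-q)^2(1-qt)^3}\left(1+\frac{2}{1-q}A_1-B_1\right)+\frac{3q^5t^3w}{(1-q)^2(1-qt)^4}A_1-\frac{3q^4t^2w}{(1-q)^2(1-qt)^4}A(qt). \end{aligned}$$ -/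

import Mathlib

noncomputable section

namespace SimplexDuplex

/-! ### Cells, columns, polyominoes -/

/-- A cell `[x, x+1] × [y, y+1]` is represented by `(x, y)`. -/
abbrev Cell : Type := ℤ × ℤ

/-- Two cells are adjacent when they have exactly one edge in common. -/
def cellGraph : SimpleGraph Cell where
  Adj u v := (u.1 = v.1 ∧ |u.2 - v.2| = 1) ∨ (u.2 = v.2 ∧ |u.1 - v.1| = 1)
  symm := ⟨by
    rintro u v (⟨h, k⟩ | ⟨h, k⟩)
    · exact Or.inl ⟨h.symm, by rw [abs_sub_comm]; exact k⟩
    · exact Or.inr ⟨h.symm, by rw [abs_sub_comm]; exact k⟩⟩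
  loopless := ⟨by
    rintro u (⟨_, k⟩ | ⟨_, k⟩) <;> simp at k⟩

/-- A finite set of cells is connected if it is nonempty and any two of its cells are joined by a
chain of its cells in which consecutive cells have a common edge (so that the union of the cells
has connected interior). -/
def Conn (P : Finset Cell) : Prop :=
  (cellGraph.induce (P : Set Cell)).Connected

/-- The sets of cells `A` and `B` have an edge in common. -/
def ShareEdge (A B : Finset Cell) : Prop :=
  ∃ u ∈ A, ∃ v ∈ B, cellGraph.Adj u v

/-- The cells of `P` with horizontal projection `[x, x+1]`. -/
def column (P : Finset Cell) (x : ℤ) : Finset Cell := P.filter fun u => u.1 = x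

/-- A column is simplex if it has exactly one connected component. -/
def IsSimplex (c : Finset Cell) : Prop := Conn c

/-- The column `c` has exactly two connected components, the lower one being `L` and the upper
one being `U`. -/
def IsDuplexWith (c L U : Finset Cell) : Prop :=
  c = L ∪ U ∧ Conn L ∧ Conn U ∧ ¬ ShareEdge L U ∧ ∀ u ∈ L, ∀ v ∈ U, u.2 < v.2

/-- A column is duplex if it has exactly two connected components. -/
def IsDuplex (c : Finset Cell) : Prop := ∃ L U, IsDuplexWith c L U

/-- Column-duplex polyominoes: every column has one or two connected components. -/
def IsColumnDuplex (P : Finset Cell) : Prop :=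
  Conn P ∧ ∀ x ∈ P.image Prod.fst, IsSimplex (column P x) ∨ IsDuplex (column P x)

/-- Simplex-duplex polyominoes: column-duplex, and no two consecutive columns are duplex. -/
def IsSimplexDuplex (P : Finset Cell) : Prop :=
  IsColumnDuplex P ∧ ∀ x, ¬ (IsDuplex (column P x) ∧ IsDuplex (column P (x + 1)))

/-- The last (rightmost) column. -/
def lastCol (P : Finset Cell) : Finset Cell := P.filter fun u => ∀ v ∈ P, v.1 ≤ u.1

/-- All columns except the last one. -/
def dropLast (P : Finset Cell) : Finset Cell := P \ lastCol P

/-- The second-last column (empty if there is none). -/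
def secondLastCol (P : Finset Cell) : Finset Cell := lastCol (dropLast P)

/-- The third-last column (empty if there is none). -/
def thirdLastCol (P : Finset Cell) : Finset Cell := lastCol (dropLast (dropLast P))

open scoped Classical in
/-- The union of the simplex columns of `P`. -/
def simplexPart (P : Finset Cell) : Finset Cell := P.filter fun u => IsSimplex (column P u.1)

open scoped Classical in
/-- The union of the duplex columns of `P`. -/
def duplexPart (P : Finset Cell) : Finset Cell := P.filter fun u => IsDuplex (column P u.1)

/-- The second-last among the simplex columns of `P` (empty if there is none). -/
def secondLastSimplex (P : Finset Cell) : Finset Cell := secondLastCol (simplexPart P)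

/-- The last among the duplex columns of `P` (empty if there is none). -/
def lastDuplex (P : Finset Cell) : Finset Cell := lastCol (duplexPart P)

/-- `u` is the bottom cell of `c`, where `c` is (a component of) a column. -/
def IsBottom (c : Finset Cell) (u : Cell) : Prop := u ∈ c ∧ ∀ v ∈ c, u.2 ≤ v.2

/-- `u` is the top cell of `c`, where `c` is (a component of) a column. -/
def IsTop (c : Finset Cell) (u : Cell) : Prop := u ∈ c ∧ ∀ v ∈ c, v.2 ≤ u.2

/-- The right neighbour of a cell. -/
def rightNbr (u : Cell) : Cell := (u.1 + 1, u.2)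

/-- `z` is the lower pivot cell of `P`. -/
def IsLowerPivot (P : Finset Cell) (z : Cell) : Prop :=
  ∃ u, IsBottom (secondLastSimplex P) u ∧ z = rightNbr u

/-- `z` is the upper pivot cell of `P`. -/
def IsUpperPivot (P : Finset Cell) (z : Cell) : Prop :=
  ∃ u, IsTop (secondLastSimplex P) u ∧ z = rightNbr u

/-- `z` is the lower inner pivot cell of `P`. -/
def IsLowerInnerPivot (P : Finset Cell) (z : Cell) : Prop :=
  ∃ L U u, IsDuplexWith (lastDuplex P) L U ∧ IsTop L u ∧ z = rightNbr u

/-- `z` is the upper inner pivot cell of `P`. -/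
def IsUpperInnerPivot (P : Finset Cell) (z : Cell) : Prop :=
  ∃ L U u, IsDuplexWith (lastDuplex P) L U ∧ IsBottom U u ∧ z = rightNbr u

/-- `z` lies in the hole of the duplex column with lower component `L` and upper component `U`. -/
def InHole (L U : Finset Cell) (z : Cell) : Prop :=
  (∀ u ∈ L, u.1 = z.1 ∧ u.2 < z.2) ∧ ∀ v ∈ U, v.1 = z.1 ∧ z.2 < v.2

/-! ### The set `S` and its classes, on the level of sets of cells -/

/-- Simplex-duplex polyominoes whose last column is simplex. -/
def InS (P : Finset Cell) : Prop := IsSimplexDuplex P ∧ IsSimplex (lastCol P)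

/-- No simplex column other than the last column. -/
def InAlpha (P : Finset Cell) : Prop :=
  InS P ∧ ∀ x, IsSimplex (column P x) → column P x = lastCol P

/-- Elements of `S \ S_α`. -/
def InRest (P : Finset Cell) : Prop := InS P ∧ ¬ InAlpha P

def InBeta (P : Finset Cell) : Prop :=
  InRest P ∧ IsSimplex (secondLastCol P) ∧ ∃ z, IsLowerPivot P z ∧ z ∈ lastCol P

def InGamma (P : Finset Cell) : Prop :=
  InRest P ∧ IsSimplex (secondLastCol P) ∧ ∃ z, IsLowerPivot P z ∧ z ∉ lastCol P

/-- The second-last column is duplex, with lower component `L` and upper component `U`, and the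
third-last column is simplex. -/
def EndsWith (P L U : Finset Cell) : Prop :=
  IsDuplexWith (secondLastCol P) L U ∧ IsSimplex (thirdLastCol P)

def InDelta (P : Finset Cell) : Prop :=
  InRest P ∧ ∃ L U, EndsWith P L U ∧ ¬ ShareEdge L (thirdLastCol P) ∧
    ∃ z, IsLowerPivot P z ∧ z ∈ U

def InEpsilon (P : Finset Cell) : Prop :=
  InRest P ∧ ∃ L U, EndsWith P L U ∧ ¬ ShareEdge L (thirdLastCol P) ∧
    ∃ z, IsLowerPivot P z ∧ InHole L U z

def InZeta (P : Finset Cell) : Prop :=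
  InRest P ∧ ∃ L U, EndsWith P L U ∧ ¬ ShareEdge U (thirdLastCol P) ∧
    ∃ z, IsUpperPivot P z ∧ z ∈ L

def InEta (P : Finset Cell) : Prop :=
  InRest P ∧ ∃ L U, EndsWith P L U ∧ ¬ ShareEdge U (thirdLastCol P) ∧
    ∃ z, IsUpperPivot P z ∧ InHole L U z

def InTheta (P : Finset Cell) : Prop :=
  InRest P ∧ ∃ L U, EndsWith P L U ∧
    (ShareEdge L (thirdLastCol P) ∧ ShareEdge U (thirdLastCol P)) ∧
    (ShareEdge (lastCol P) L ∧ ShareEdge (lastCol P) U)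

def InIota (P : Finset Cell) : Prop :=
  InRest P ∧ ∃ L U, EndsWith P L U ∧
    (ShareEdge L (thirdLastCol P) ∧ ShareEdge U (thirdLastCol P)) ∧
    (ShareEdge (lastCol P) L ∧ ¬ ShareEdge (lastCol P) U) ∧
    ∃ z, IsLowerInnerPivot P z ∧ z ∉ lastCol P

def InKappa (P : Finset Cell) : Prop :=
  InRest P ∧ ∃ L U, EndsWith P L U ∧
    (ShareEdge L (thirdLastCol P) ∧ ShareEdge U (thirdLastCol P)) ∧
    (ShareEdge (lastCol P) L ∧ ¬ ShareEdge (lastCol P) U) ∧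
    ∃ z, IsLowerInnerPivot P z ∧ z ∈ lastCol P

def InLambda (P : Finset Cell) : Prop :=
  InRest P ∧ ∃ L U, EndsWith P L U ∧
    (ShareEdge L (thirdLastCol P) ∧ ShareEdge U (thirdLastCol P)) ∧
    (ShareEdge (lastCol P) U ∧ ¬ ShareEdge (lastCol P) L) ∧
    ∃ z, IsUpperInnerPivot P z ∧ z ∉ lastCol P

def InMu (P : Finset Cell) : Prop :=
  InRest P ∧ ∃ L U, EndsWith P L U ∧
    (ShareEdge L (thirdLastCol P) ∧ ShareEdge U (thirdLastCol P)) ∧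
    (ShareEdge (lastCol P) U ∧ ¬ ShareEdge (lastCol P) L) ∧
    ∃ z, IsUpperInnerPivot P z ∧ z ∈ lastCol P

/-! ### Statistics and their invariance under translation -/

/-- The number of cells of the last column. For a simplex last column this is its height. -/
def lastHeight (P : Finset Cell) : ℕ := (lastCol P).card

open scoped Classical in
/-- The number of duplex columns. -/
def numDuplex (P : Finset Cell) : ℕ :=
  ((P.image Prod.fst).filter fun x => IsDuplex (column P x)).card

/-- The translate of `P` by the vector `v`. -/
def translate (v : Cell) (P : Finset Cell) : Finset Cell := P.map (addRightEmbedding v)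

theorem mem_translate {v u : Cell} {P : Finset Cell} : u ∈ translate v P ↔ u - v ∈ P := by
  simp only [translate, Finset.mem_map, addRightEmbedding_apply]
  constructor
  · rintro ⟨a, ha, rfl⟩; simpa using ha
  · intro h; exact ⟨u - v, h, by simp⟩

theorem translate_zero (P : Finset Cell) : translate 0 P = P := by
  ext u; simp [mem_translate]

theorem translate_translate (v v' : Cell) (P : Finset Cell) :
    translate v' (translate v P) = translate (v + v') P := by
  ext u
  simp only [mem_translate]
  rw [sub_sub, add_comm v' v]

theorem adj_sub (u u' v : Cell) : cellGraph.Adj (u - v) (u' - v) ↔ cellGraph.Adj u u' := by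
  simp [cellGraph]

theorem conn_translate {P : Finset Cell} (v : Cell) (h : Conn P) : Conn (translate v P) := by
  let e : (cellGraph.induce ((translate v P : Finset Cell) : Set Cell)) ≃g
      (cellGraph.induce (P : Set Cell)) :=
    { toFun := fun u => ⟨u.1 - v, by simpa using mem_translate.1 (Finset.mem_coe.1 u.2)⟩
      invFun := fun u => ⟨u.1 + v, by simp [mem_translate]⟩
      left_inv := fun u => by simp
      right_inv := fun u => by simp
      map_rel_iff' := by intro a b; exact adj_sub a.1 b.1 v }
  exact e.connected_iff.2 h

theorem translate_union (v : Cell) (A B : Finset Cell) :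
    translate v (A ∪ B) = translate v A ∪ translate v B := Finset.map_union _ _

theorem isDuplex_translate {c : Finset Cell} (v : Cell) (h : IsDuplex c) :
    IsDuplex (translate v c) := by
  obtain ⟨L, U, rfl, hL, hU, hs, hlt⟩ := h
  refine ⟨translate v L, translate v U, translate_union v L U, conn_translate v hL,
    conn_translate v hU, ?_, ?_⟩
  · rintro ⟨a, ha, b, hb, hab⟩
    exact hs ⟨a - v, mem_translate.1 ha, b - v, mem_translate.1 hb, (adj_sub a b v).2 hab⟩
  · intro a ha b hb
    simpa using hlt _ (mem_translate.1 ha) _ (mem_translate.1 hb)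

theorem column_translate (v : Cell) (P : Finset Cell) (x : ℤ) :
    column (translate v P) (x + v.1) = translate v (column P x) := by
  ext u
  simp only [column, Finset.mem_filter, mem_translate, Prod.fst_sub, sub_eq_iff_eq_add]

theorem lastCol_translate (v : Cell) (P : Finset Cell) :
    lastCol (translate v P) = translate v (lastCol P) := by
  ext u
  simp only [lastCol, Finset.mem_filter, mem_translate]
  refine and_congr_right fun _ => ⟨fun h a ha => ?_, fun h a ha => ?_⟩
  · have := h (a + v) (by simpa using ha)
    simp only [Prod.fst_add, Prod.fst_sub] at this ⊢
    omega
  · have := h _ ha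
    simp only [Prod.fst_sub] at this
    omega

theorem card_translate (v : Cell) (P : Finset Cell) : (translate v P).card = P.card :=
  Finset.card_map _

theorem lastHeight_translate (v : Cell) (P : Finset Cell) :
    lastHeight (translate v P) = lastHeight P := by
  rw [lastHeight, lastCol_translate, card_translate, lastHeight]

theorem numDuplex_translate_le (v : Cell) (P : Finset Cell) :
    numDuplex P ≤ numDuplex (translate v P) := by
  classical
  unfold numDuplex
  refine Finset.card_le_card_of_injOn (fun x => x + v.1) ?_
    (fun _ _ _ _ h => add_right_cancel h)
  intro x hx
  simp only [Finset.coe_filter, Finset.mem_image, Set.mem_ofPred_eq] at hx ⊢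
  obtain ⟨⟨u, hu, rfl⟩, hd⟩ := hx
  refine ⟨⟨u + v, by simpa [mem_translate] using hu, rfl⟩, ?_⟩
  rw [column_translate]
  exact isDuplex_translate v hd

theorem numDuplex_translate (v : Cell) (P : Finset Cell) :
    numDuplex (translate v P) = numDuplex P := by
  refine le_antisymm ?_ (numDuplex_translate_le v P)
  have := numDuplex_translate_le (-v) (translate v P)
  rwa [translate_translate, add_neg_cancel, translate_zero] at this

/-! ### Polyominoes up to translation -/

/-- Connected finite sets of cells, identified when one is a translate of the other. -/
instance figSetoid : Setoid {P : Finset Cell // Conn P} where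
  r P Q := ∃ v, Q.1 = translate v P.1
  iseqv :=
    { refl := fun P => ⟨0, (translate_zero P.1).symm⟩
      symm := by
        rintro P Q ⟨v, h⟩
        exact ⟨-v, by rw [h, translate_translate, add_neg_cancel, translate_zero]⟩
      trans := by
        rintro P Q R ⟨v, h⟩ ⟨v', h'⟩
        exact ⟨v + v', by rw [h', h, translate_translate]⟩ }

/-- Polyominoes. -/
def Polyomino : Type := Quotient figSetoid

/-- The polyomino represented by a connected set of cells. -/
def Polyomino.mk (P : Finset Cell) (h : Conn P) : Polyomino := Quotient.mk figSetoid ⟨P, h⟩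

def Polyomino.area : Polyomino → ℕ :=
  Quotient.lift (fun P => P.1.card) (by
    rintro P Q ⟨v, h⟩; simp only [h, card_translate])

def Polyomino.lastHeight : Polyomino → ℕ :=
  Quotient.lift (fun P => SimplexDuplex.lastHeight P.1) (by
    rintro P Q ⟨v, h⟩; simp only [h, lastHeight_translate])

def Polyomino.numDuplex : Polyomino → ℕ :=
  Quotient.lift (fun P => SimplexDuplex.numDuplex P.1) (by
    rintro P Q ⟨v, h⟩; simp only [h, numDuplex_translate])

/-- The set of polyominoes having the (translation invariant) property `C`. -/
def polySet (C : Finset Cell → Prop) : Set Polyomino :=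
  {p | ∃ (P : Finset Cell) (h : Conn P), p = Polyomino.mk P h ∧ C P}

/-- The set `S`. -/
def S : Set Polyomino := polySet InS

/-- The labels of the twelve classes. -/
inductive Label : Type
  | alpha | beta | gamma | delta | epsilon | zeta | eta | theta | iota | kappa | lambda | mu

/-- The twelve classes `S_α, …, S_μ`. -/
def Scls : Label → Set Polyomino
  | .alpha => polySet InAlpha
  | .beta => polySet InBeta
  | .gamma => polySet InGamma
  | .delta => polySet InDelta
  | .epsilon => polySet InEpsilon
  | .zeta => polySet InZeta
  | .eta => polySet InEta
  | .theta => polySet InTheta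
  | .iota => polySet InIota
  | .kappa => polySet InKappa
  | .lambda => polySet InLambda
  | .mu => polySet InMu

theorem walk_bound {P : Finset Cell} {u v : (P : Set Cell)}
    (p : (cellGraph.induce (P : Set Cell)).Walk u v) :
    |v.1.1 - u.1.1| ≤ (p.length : ℤ) ∧ |v.1.2 - u.1.2| ≤ (p.length : ℤ) := by
  induction p with
  | nil => simp
  | @cons a b c h p ih =>
    have h' : (a.1.1 = b.1.1 ∧ |a.1.2 - b.1.2| = 1) ∨ (a.1.2 = b.1.2 ∧ |a.1.1 - b.1.1| = 1) := h
    rw [SimpleGraph.Walk.length_cons]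
    push_cast
    rw [abs_eq (zero_le_one' ℤ), abs_eq (zero_le_one' ℤ)] at h'
    rw [abs_le, abs_le] at ih ⊢
    omega

/-- There are finitely many polyominoes of each area. -/
theorem finite_area (n : ℕ) : {p : Polyomino | p.area = n}.Finite := by
  classical
  let B : Finset (Finset Cell) :=
    (Finset.Icc (-(n : ℤ)) n ×ˢ Finset.Icc (-(n : ℤ)) n).powerset
  refine (Set.finite_range fun P : {P : B // Conn P.1} => Polyomino.mk P.1.1 P.2).subset ?_
  rintro ⟨⟨P, hP⟩⟩ hp
  have hcard : P.card = n := hp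
  obtain ⟨u⟩ := hP.nonempty
  have hQ : Conn (translate (-u.1) P) := conn_translate _ hP
  refine ⟨⟨⟨translate (-u.1) P, ?_⟩, hQ⟩, ?_⟩
  · rw [Finset.mem_powerset]
    intro v hv
    rw [mem_translate, sub_neg_eq_add] at hv
    obtain ⟨p⟩ := hP.preconnected u ⟨v + u.1, hv⟩
    have h1 := walk_bound p.toPath.1
    have h2 := p.toPath.2.length_lt
    have h3 : Fintype.card (P : Set Cell) = n := by simpa using hcard
    rw [h3] at h2
    simp only [Prod.fst_add, Prod.snd_add, add_sub_cancel_right, abs_le] at h1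
    simp only [Finset.mem_product, Finset.mem_Icc]
    omega
  · exact (Quotient.sound (s := figSetoid)
      (a := ⟨P, hP⟩) (b := ⟨translate (-u.1) P, hQ⟩) ⟨-u.1, rfl⟩).symm

/-- The last column is nonempty. -/
theorem lastHeight_pos (p : Polyomino) : 0 < p.lastHeight := by
  obtain ⟨⟨P, hP⟩⟩ := p
  change 0 < (lastCol P).card
  obtain ⟨u⟩ := hP.nonempty
  obtain ⟨m, hm, h⟩ := P.exists_max_image Prod.fst ⟨u.1, u.2⟩
  exact Finset.card_pos.2 ⟨m, by simpa [lastCol] using ⟨hm, fun a b hab => h (a, b) hab⟩⟩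

/-! ### Generating functions

Series are elements of `ℚ[w][t]⟦q⟧`, respectively `ℚ[w]⟦q⟧`. -/

/-- The ring `ℚ[w][t]⟦q⟧`. -/
abbrev Ser : Type := PowerSeries (Polynomial (Polynomial ℚ))

/-- The ring `ℚ[w]⟦q⟧`. -/
abbrev Ser₀ : Type := PowerSeries (Polynomial ℚ)

def q : Ser := PowerSeries.X
def t : Ser := PowerSeries.C Polynomial.X
def w : Ser := PowerSeries.C (Polynomial.C Polynomial.X)

/-- `∑_{p ∈ C} q ^ area · t ^ (height of the last column) · w ^ (number of duplex columns)`; the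
coefficient of `q ^ n` is a sum over the finitely many polyominoes of area `n` in `C`. -/
def genFun (C : Set Polyomino) : Ser :=
  PowerSeries.mk fun n => ∑ᶠ p ∈ {p : Polyomino | p ∈ C ∧ p.area = n},
    (Polynomial.X : Polynomial (Polynomial ℚ)) ^ p.lastHeight *
      Polynomial.C (Polynomial.X ^ p.numDuplex)

/-- Division of series by `t` (used for series divisible by `t`). -/
def divT (F : Ser) : Ser := PowerSeries.mk fun n => (PowerSeries.coeff n F).divX

theorem t_mul_divT_genFun (C : Set Polyomino) : t * divT (genFun C) = genFun C := by
  ext1 n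
  rw [t, PowerSeries.coeff_C_mul, divT, PowerSeries.coeff_mk]
  suffices h : (PowerSeries.coeff n (genFun C)).coeff 0 = 0 by
    have := Polynomial.X_mul_divX_add (PowerSeries.coeff n (genFun C))
    rwa [h, map_zero, add_zero] at this
  rw [genFun, PowerSeries.coeff_mk]
  refine finsum_mem_induction (fun f : Polynomial (Polynomial ℚ) => f.coeff 0 = 0) (by simp)
    (fun a b ha hb => by simp [ha, hb]) fun p _ => ?_
  have h : (0 : ℕ) ≠ p.lastHeight := (lastHeight_pos p).ne
  rw [Polynomial.coeff_mul_C, Polynomial.coeff_X_pow, if_neg h, zero_mul]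

/-- The partial derivative with respect to `t`. -/
def derivT (F : Ser) : Ser :=
  PowerSeries.mk fun n => Polynomial.derivative (PowerSeries.coeff n F)

/-- The specialization `t = 1`. -/
def atOne (F : Ser) : Ser₀ := PowerSeries.map (Polynomial.evalRingHom 1) F

/-- The substitution `t ↦ q t`: a term `f(w) q ^ n t ^ k` becomes `f(w) q ^ (n + k) t ^ k`. -/
def substQT (F : Ser) : Ser :=
  PowerSeries.mk fun N => ∑ k ∈ Finset.range (N + 1),
    Polynomial.monomial k ((PowerSeries.coeff (N - k) F).coeff k)

theorem substQT_monomial (n k : ℕ) (f : Polynomial ℚ) :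
    substQT (PowerSeries.monomial n (Polynomial.monomial k f)) =
      PowerSeries.monomial (n + k) (Polynomial.monomial k f) := by
  classical
  ext1 N
  simp only [substQT, PowerSeries.coeff_mk, PowerSeries.coeff_monomial]
  split_ifs with h
  · subst h
    rw [Finset.sum_eq_single k]
    · simp
    · intro j _ hj
      split_ifs <;> simp [Polynomial.coeff_monomial, hj.symm]
    · intro hk; simp at hk
  · refine Finset.sum_eq_zero fun j hj => ?_
    rw [Finset.mem_range] at hj
    split_ifs with h'
    · have : k ≠ j := by omega
      simp [Polynomial.coeff_monomial, this]
    · simp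

/-- A series in `q` and `w`, regarded as a series in `q`, `t` and `w`. -/
def lift (F : Ser₀) : Ser := PowerSeries.map Polynomial.C F

/-- The series `A(t) = A(q, t, w)`. -/
def A : Ser := genFun S

/-- The part of `A(t)` that comes from the class with label `i`. -/
def Acls (i : Label) : Ser := genFun (Scls i)

/-- `A₁ = A(q, 1, w)`. -/
def A₁ : Ser₀ := atOne A

/-- `B₁ = ∂(A / t)/∂t` at `t = 1`. -/
def B₁ : Ser₀ := atOne (derivT (divT A))

/-- `C₁ = (1/2) ∂²(A / t)/∂t²` at `t = 1`. -/
def C₁ : Ser₀ := (1 / 2 : ℚ) • atOne (derivT (derivT (divT A)))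

/-- The quotient `a / b` in `ℚ[w][t]⟦q⟧`, for invertible `b`. -/
def frac (a b : Ser) : Ser := a * Ring.inverse b

infixl:70 " ⊘ " => frac

theorem isUnit_one_sub_q : IsUnit (1 - q) := by
  rw [PowerSeries.isUnit_iff_constantCoeff]; simp [q]

theorem isUnit_one_sub_qt : IsUnit (1 - q * t) := by
  rw [PowerSeries.isUnit_iff_constantCoeff]; simp [q]

theorem frac_mul_cancel (a : Ser) {b : Ser} (hb : IsUnit b) : a ⊘ b * b = a := by
  rw [frac, mul_assoc, Ring.inverse_mul_cancel _ hb, mul_one]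

end SimplexDuplex

end

open SimplexDuplex

/-!
The proof builds an element of `S` from the left, one simplex column at a time. Deleting the last
simplex column of `P ∈ S`, together with the duplex column before it if there is one, leaves a
smaller element `Q` of `S`, unless `P ∈ S_α` (`InS.shape`): a path that leaves `Q` does so through
its last column, which is connected, so what remains is connected (`conn_of_conn_union`).
Conversely, attaching a simplex column, or a duplex and a simplex column, to `Q` gives an element
of `S` exactly when enough of the attached segments touch each other (`inS_ext2_iff`,
`inS_ext3_iff`), which is a condition on the endpoints of these segments relative to the last
column `[k0, k1]` of `Q`. The classes are conditions of the same kind (`cls_ext2_iff`,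
`cls_ext3_iff`), so that the partition is a case distinction on integers.

For the generating functions, translation is eliminated by putting the last column of `Q` at
`[0, n - 1]` in column `0` (`Core`). Each class other than `S_α` is then in bijection with the pairs
of such a `Q` and an admissible choice of attached columns (`poly2_injective`, `range_poly2`,
`poly3_injective`, `range_poly3`), where the admissible choices depend on the height `n` of the last
column of `Q` only. With the topology on power series that comes from discrete coefficients,
generating functions are convergent sums over polyominoes, and the sum over a class may be taken
first over the attached columns (`HasSum.sigma`). The inner sum is a product of geometric series and
of a finite sum over positions inside `[0, n - 1]` (`hasSum_delta` to `hasSum_kappa`); it turns out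
to be a combination of `1`, `n - 1`, `(n - 1).choose 2` and `(q t) ^ n` with coefficients that do not
depend on `n`. Summing these four functions of the height over all `Q` gives `A₁`, `B₁`, `C₁` and
`A(qt)` respectively (`Core.hasSum_combination`). The classes `S_ζ`, `S_η`, `S_λ`, `S_μ` are the
images of `S_δ`, `S_ε`, `S_ι`, `S_κ` under turning the attached columns upside down
(`hasSum_tail3_flip`).
-/

noncomputable section

namespace SimplexDuplex

/-! ### Connectedness and vertical segments -/

theorem adj_iff {u v : Cell} : cellGraph.Adj u v ↔
    (u.1 = v.1 ∧ (u.2 = v.2 + 1 ∨ v.2 = u.2 + 1)) ∨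
      (u.2 = v.2 ∧ (u.1 = v.1 + 1 ∨ v.1 = u.1 + 1)) := by
  have h : cellGraph.Adj u v ↔ (u.1 = v.1 ∧ |u.2 - v.2| = 1) ∨ (u.2 = v.2 ∧ |u.1 - v.1| = 1) :=
    Iff.rfl
  rw [h, abs_eq zero_le_one, abs_eq zero_le_one]
  omega

/-- Connectedness in terms of cuts: a property of cells that spreads along the edges inside `P`
holds on all of `P` or nowhere on `P`. -/
theorem conn_iff {P : Finset Cell} : Conn P ↔ P.Nonempty ∧ ∀ T : Cell → Prop,
    (∀ u ∈ P, ∀ v ∈ P, cellGraph.Adj u v → T u → T v) → ∀ u ∈ P, ∀ v ∈ P, T u → T v := by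
  constructor
  · intro h
    obtain ⟨u⟩ := h.nonempty
    refine ⟨⟨u.1, u.2⟩, fun T hT u hu v hv hTu => ?_⟩
    obtain ⟨p⟩ := h.preconnected ⟨u, hu⟩ ⟨v, hv⟩
    have key : ∀ a b : (P : Set Cell), (cellGraph.induce (P : Set Cell)).Walk a b →
        T a.1 → T b.1 := by
      intro a b p
      induction p with
      | nil => exact id
      | @cons a b c h p ih => exact fun ha => ih (hT a.1 a.2 b.1 b.2 h ha)
    exact key _ _ p hTu
  · rintro ⟨⟨u, hu⟩, h⟩
    have : Nonempty (P : Set Cell) := ⟨⟨u, hu⟩⟩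
    refine SimpleGraph.Connected.mk fun a b => ?_
    obtain ⟨hb, hr⟩ := h (fun z => ∃ hz : z ∈ (P : Set Cell),
      (cellGraph.induce (P : Set Cell)).Reachable a ⟨z, hz⟩) (by
        rintro c hc d hd hcd ⟨_, hr⟩
        refine ⟨hd, hr.trans ?_⟩
        have : (cellGraph.induce (P : Set Cell)).Adj ⟨c, hc⟩ ⟨d, hd⟩ := hcd
        exact this.reachable) a.1 a.2 b.1 b.2 ⟨a.2, SimpleGraph.Reachable.refl _⟩
    exact hr

theorem Conn.nonempty' {P : Finset Cell} (h : Conn P) : P.Nonempty := (conn_iff.1 h).1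

theorem Conn.cut {P : Finset Cell} (h : Conn P) (T : Cell → Prop)
    (hT : ∀ u ∈ P, ∀ v ∈ P, cellGraph.Adj u v → T u → T v) {u v : Cell} (hu : u ∈ P)
    (hv : v ∈ P) : T u → T v := (conn_iff.1 h).2 T hT u hu v hv

theorem ShareEdge.mono {A B A' B' : Finset Cell} (h : ShareEdge A B) (hA : A ⊆ A')
    (hB : B ⊆ B') : ShareEdge A' B' := by
  obtain ⟨u, hu, v, hv, huv⟩ := h
  exact ⟨u, hA hu, v, hB hv, huv⟩

theorem ShareEdge.symm {A B : Finset Cell} (h : ShareEdge A B) : ShareEdge B A := by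
  obtain ⟨u, hu, v, hv, huv⟩ := h
  exact ⟨v, hv, u, hu, huv.symm⟩

theorem Conn.union {A B : Finset Cell} (hA : Conn A) (hB : Conn B) (h : ShareEdge A B) :
    Conn (A ∪ B) := by
  obtain ⟨a, ha, b, hb, hab⟩ := h
  refine conn_iff.2 ⟨⟨a, Finset.mem_union_left _ ha⟩, fun T hT u hu v hv hTu => ?_⟩
  have hTA : ∀ u ∈ A, ∀ v ∈ A, cellGraph.Adj u v → T u → T v := fun u hu v hv =>
    hT u (Finset.mem_union_left _ hu) v (Finset.mem_union_left _ hv)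
  have hTB : ∀ u ∈ B, ∀ v ∈ B, cellGraph.Adj u v → T u → T v := fun u hu v hv =>
    hT u (Finset.mem_union_right _ hu) v (Finset.mem_union_right _ hv)
  have hTab := hT a (Finset.mem_union_left _ ha) b (Finset.mem_union_right _ hb) hab
  have hTba := hT b (Finset.mem_union_right _ hb) a (Finset.mem_union_left _ ha) hab.symm
  have h1 : T a := by
    rcases Finset.mem_union.1 hu with hu | hu
    · exact hA.cut T hTA hu ha hTu
    · exact hTba (hB.cut T hTB hu hb hTu)
  rcases Finset.mem_union.1 hv with hv | hv
  · exact hA.cut T hTA ha hv h1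
  · exact hB.cut T hTB hb hv (hTab h1)

/-- The vertical segment of the cells `(x, y)` with `a ≤ y ≤ b`. -/
def seg (x a b : ℤ) : Finset Cell := {x} ×ˢ Finset.Icc a b

theorem mem_seg {x a b : ℤ} {u : Cell} : u ∈ seg x a b ↔ u.1 = x ∧ a ≤ u.2 ∧ u.2 ≤ b := by
  rw [seg, Finset.mem_product, Finset.mem_singleton, Finset.mem_Icc]

theorem card_seg (x a b : ℤ) : (seg x a b).card = (b + 1 - a).toNat := by
  simp [seg]

theorem adj_mk {x y x' y' : ℤ} : cellGraph.Adj (x, y) (x', y') ↔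
    (x = x' ∧ (y = y' + 1 ∨ y' = y + 1)) ∨ (y = y' ∧ (x = x' + 1 ∨ x' = x + 1)) :=
  adj_iff

theorem mk_mem_seg {x a b y z : ℤ} : (y, z) ∈ seg x a b ↔ y = x ∧ a ≤ z ∧ z ≤ b := mem_seg

theorem translate_seg (v : Cell) (x a b : ℤ) :
    translate v (seg x a b) = seg (x + v.1) (a + v.2) (b + v.2) := by
  ext u
  simp only [mem_translate, mem_seg, Prod.fst_sub, Prod.snd_sub]
  omega

theorem seg_inj {x a b x' a' b' : ℤ} (h : a ≤ b) (e : seg x a b = seg x' a' b') :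
    x = x' ∧ a = a' ∧ b = b' := by
  have h1 : (x, a) ∈ seg x' a' b' := e ▸ mem_seg.2 ⟨rfl, le_rfl, h⟩
  have h2 : (x, b) ∈ seg x' a' b' := e ▸ mem_seg.2 ⟨rfl, h, le_rfl⟩
  rw [mem_seg] at h1 h2
  have h3 : (x', a') ∈ seg x a b := e ▸ mem_seg.2 ⟨rfl, le_rfl, by omega⟩
  have h4 : (x', b') ∈ seg x a b := e ▸ mem_seg.2 ⟨rfl, by omega, le_rfl⟩
  rw [mem_seg] at h3 h4
  simp only at h1 h2 h3 h4
  omega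

theorem conn_seg {x a b : ℤ} (h : a ≤ b) : Conn (seg x a b) := by
  refine conn_iff.2 ⟨⟨(x, a), mem_seg.2 ⟨rfl, le_rfl, h⟩⟩, fun T hT u hu v hv => ?_⟩
  have up : ∀ n : ℕ, a + n ≤ b → (T (x, a + n) ↔ T (x, a)) := by
    intro n
    induction n with
    | zero => simp
    | succ n ih =>
      intro hn
      push_cast at hn ⊢
      rw [← ih (by omega)]
      constructor
      · exact hT _ (mk_mem_seg.2 ⟨rfl, by omega, by omega⟩) _
          (mk_mem_seg.2 ⟨rfl, by omega, by omega⟩) (adj_mk.2 (by omega))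
      · exact hT _ (mk_mem_seg.2 ⟨rfl, by omega, by omega⟩) _
          (mk_mem_seg.2 ⟨rfl, by omega, by omega⟩) (adj_mk.2 (by omega))
  have all : ∀ u ∈ seg x a b, (T u ↔ T (x, a)) := by
    rintro ⟨y, z⟩ hu
    obtain ⟨h1, h2, h3⟩ := mem_seg.1 hu
    simp only at h1 h2 h3
    subst h1
    have := up (z - a).toNat (by omega)
    rwa [Int.toNat_of_nonneg (by omega), add_sub_cancel] at this
  rw [all u hu, all v hv]
  exact id

/-- A connected set of cells inside one column is a vertical segment. -/
theorem Conn.exists_seg {c : Finset Cell} (h : Conn c) {x : ℤ} (hx : ∀ u ∈ c, u.1 = x) :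
    ∃ a b, a ≤ b ∧ c = seg x a b := by
  obtain ⟨l, hl, hl'⟩ := c.exists_min_image Prod.snd h.nonempty'
  obtain ⟨m, hm, hm'⟩ := c.exists_max_image Prod.snd h.nonempty'
  refine ⟨l.2, m.2, hl' m hm, ?_⟩
  ext ⟨y, z⟩
  rw [mem_seg]
  refine ⟨fun hz => ⟨hx _ hz, hl' _ hz, hm' _ hz⟩, ?_⟩
  rintro ⟨rfl, h1, h2⟩
  simp only at h1 h2
  by_contra hz
  have hne : ∀ u ∈ c, u.2 ≠ z := by
    rintro ⟨y', z'⟩ hu rfl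
    obtain rfl : y' = y := hx _ hu
    exact hz hu
  have := h.cut (fun u => u.2 < z) (by
    intro u hu v hv huv h3
    have := hne v hv
    rw [adj_iff] at huv
    omega) hl hm (lt_of_le_of_ne h1 (hne l hl))
  omega

theorem shareEdge_seg {x x' a b a' b' : ℤ} (hx : x' = x + 1 ∨ x = x' + 1) :
    ShareEdge (seg x a b) (seg x' a' b') ↔ max a a' ≤ min b b' := by
  constructor
  · rintro ⟨u, hu, v, hv, huv⟩
    rw [mem_seg] at hu hv
    rw [adj_iff] at huv
    omega
  · intro h
    refine ⟨(x, max a a'), mk_mem_seg.2 ⟨rfl, ?_, ?_⟩, (x', max a a'), mk_mem_seg.2 ⟨rfl, ?_, ?_⟩,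
      adj_mk.2 ?_⟩ <;> omega

theorem isSimplex_seg {x a b : ℤ} (h : a ≤ b) : IsSimplex (seg x a b) := conn_seg h

theorem isDuplexWith_seg {x a b a' b' : ℤ} (h : a ≤ b) (h' : a' ≤ b') (hh : b + 1 < a') :
    IsDuplexWith (seg x a b ∪ seg x a' b') (seg x a b) (seg x a' b') := by
  refine ⟨rfl, conn_seg h, conn_seg h', ?_, ?_⟩
  · rintro ⟨u, hu, v, hv, huv⟩
    rw [mem_seg] at hu hv
    rw [adj_iff] at huv
    omega
  · intro u hu v hv
    rw [mem_seg] at hu hv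
    omega

theorem IsDuplexWith.exists_seg {c L U : Finset Cell} (h : IsDuplexWith c L U) {x : ℤ}
    (hx : ∀ u ∈ c, u.1 = x) : ∃ a b a' b', a ≤ b ∧ a' ≤ b' ∧ b + 1 < a' ∧
      L = seg x a b ∧ U = seg x a' b' := by
  obtain ⟨rfl, hL, hU, hs, hlt⟩ := h
  obtain ⟨a, b, hab, rfl⟩ := hL.exists_seg fun u hu => hx u (Finset.mem_union_left _ hu)
  obtain ⟨a', b', hab', rfl⟩ := hU.exists_seg fun u hu => hx u (Finset.mem_union_right _ hu)
  refine ⟨a, b, a', b', hab, hab', ?_, rfl, rfl⟩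
  have h1 := hlt (x, b) (mem_seg.2 ⟨rfl, hab, le_rfl⟩) (x, a') (mem_seg.2 ⟨rfl, le_rfl, hab'⟩)
  simp only at h1
  by_contra h2
  exact hs ⟨(x, b), mem_seg.2 ⟨rfl, hab, le_rfl⟩, (x, a'), mem_seg.2 ⟨rfl, le_rfl, hab'⟩,
    adj_mk.2 (by omega)⟩

theorem seg_union_inj {x x' a b a' b' c d c' d' : ℤ} (h : a ≤ b) (h' : a' ≤ b')
    (hh : b + 1 < a') (k : c ≤ d) (k' : c' ≤ d') (kk : d + 1 < c')
    (e : seg x a b ∪ seg x a' b' = seg x' c d ∪ seg x' c' d') :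
    x = x' ∧ a = c ∧ b = d ∧ a' = c' ∧ b' = d' := by
  have key : ∀ y z : ℤ, (y = x ∧ (a ≤ z ∧ z ≤ b ∨ a' ≤ z ∧ z ≤ b')) ↔
      (y = x' ∧ (c ≤ z ∧ z ≤ d ∨ c' ≤ z ∧ z ≤ d')) := by
    intro y z
    have := Finset.ext_iff.1 e (y, z)
    rwa [Finset.mem_union, Finset.mem_union, mk_mem_seg, mk_mem_seg, mk_mem_seg, mk_mem_seg,
      ← and_or_left, ← and_or_left] at this
  obtain ⟨hx, -⟩ := (key x a).1 ⟨rfl, Or.inl ⟨le_rfl, h⟩⟩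
  subst hx
  have h1 : a = c := by have := key x a; have := key x c; omega
  have h2 : b' = d' := by have := key x b'; have := key x d'; omega
  subst h1 h2
  have h3 : b = d := by have := key x (b + 1); have := key x (d + 1); omega
  have h4 : a' = c' := by have := key x (a' - 1); have := key x (c' - 1); omega
  exact ⟨rfl, rfl, h3, h4, rfl⟩

/-- The components of a duplex column are determined by the column. -/
theorem isDuplexWith_seg_iff {x a b a' b' : ℤ} (h : a ≤ b) (h' : a' ≤ b') (hh : b + 1 < a')
    {L U : Finset Cell} : IsDuplexWith (seg x a b ∪ seg x a' b') L U ↔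
      L = seg x a b ∧ U = seg x a' b' := by
  constructor
  · intro k
    obtain ⟨c, d, c', d', h1, h2, h3, rfl, rfl⟩ := k.exists_seg (x := x) (by
      intro u hu
      simp only [Finset.mem_union, mem_seg] at hu
      omega)
    obtain ⟨-, rfl, rfl, rfl, rfl⟩ := seg_union_inj h h' hh h1 h2 h3 k.1
    exact ⟨rfl, rfl⟩
  · rintro ⟨rfl, rfl⟩
    exact isDuplexWith_seg h h' hh

theorem IsSimplex.not_isDuplex {c : Finset Cell} (h : IsSimplex c) : ¬ IsDuplex c := by
  rintro ⟨L, U, rfl, hL, hU, hs, hlt⟩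
  obtain ⟨u, hu⟩ := hL.nonempty'
  obtain ⟨v, hv⟩ := hU.nonempty'
  have := Conn.cut h (fun z => z ∈ L) (by
    intro a ha b hb hab haL
    rcases Finset.mem_union.1 hb with hb | hb
    · exact hb
    · exact absurd ⟨a, haL, b, hb, hab⟩ hs) (Finset.mem_union_left _ hu)
      (Finset.mem_union_right _ hv) hu
  exact absurd (hlt v this v hv) (lt_irrefl _)

theorem IsSimplex.nonempty {c : Finset Cell} (h : IsSimplex c) : c.Nonempty := Conn.nonempty' h

theorem IsDuplex.nonempty {c : Finset Cell} (h : IsDuplex c) : c.Nonempty := by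
  obtain ⟨L, U, rfl, hL, -⟩ := h
  exact hL.nonempty'.mono Finset.subset_union_left

/-! ### Appending a column on the right -/

theorem mem_column {P : Finset Cell} {x : ℤ} {u : Cell} : u ∈ column P x ↔ u ∈ P ∧ u.1 = x :=
  Finset.mem_filter

theorem mem_lastCol {P : Finset Cell} {u : Cell} : u ∈ lastCol P ↔ u ∈ P ∧ ∀ v ∈ P, v.1 ≤ u.1 :=
  Finset.mem_filter

theorem mem_simplexPart {P : Finset Cell} {u : Cell} :
    u ∈ simplexPart P ↔ u ∈ P ∧ IsSimplex (column P u.1) := by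
  classical
  exact Finset.mem_filter

theorem mem_duplexPart {P : Finset Cell} {u : Cell} :
    u ∈ duplexPart P ↔ u ∈ P ∧ IsDuplex (column P u.1) := by
  classical
  exact Finset.mem_filter

/-- `C` is a nonempty set of cells in column `c`, and all cells of `Q` lie to the left of it. -/
structure RightCol (Q C : Finset Cell) (c : ℤ) : Prop where
  lt : ∀ u ∈ Q, u.1 < c
  eq : ∀ u ∈ C, u.1 = c
  ne : C.Nonempty

namespace RightCol

variable {Q C : Finset Cell} {c : ℤ}

theorem lastCol (h : RightCol Q C c) : lastCol (Q ∪ C) = C := by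
  ext u
  rw [mem_lastCol]
  constructor
  · rintro ⟨hu, h'⟩
    obtain ⟨v, hv⟩ := h.ne
    have h1 := h' v (Finset.mem_union_right _ hv)
    have h2 := h.eq v hv
    rcases Finset.mem_union.1 hu with hu | hu
    · have := h.lt u hu
      omega
    · exact hu
  · intro hu
    refine ⟨Finset.mem_union_right _ hu, fun v hv => ?_⟩
    have h2 := h.eq u hu
    rcases Finset.mem_union.1 hv with hv | hv
    · have := h.lt v hv
      omega
    · have := h.eq v hv
      omega

theorem disjoint (h : RightCol Q C c) : Disjoint Q C :=
  Finset.disjoint_left.2 fun u hu hu' => (h.lt u hu).ne (h.eq u hu')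

theorem dropLast (h : RightCol Q C c) : dropLast (Q ∪ C) = Q := by
  rw [SimplexDuplex.dropLast, h.lastCol, Finset.union_sdiff_right,
    Finset.sdiff_eq_self_of_disjoint h.disjoint]

theorem column_self (h : RightCol Q C c) : column (Q ∪ C) c = C := by
  ext u
  rw [mem_column, Finset.mem_union]
  constructor
  · rintro ⟨h1 | h1, h2⟩
    · exact absurd h2 (h.lt u h1).ne
    · exact h1
  · exact fun hu => ⟨Or.inr hu, h.eq u hu⟩

theorem column_of_ne (h : RightCol Q C c) {x : ℤ} (hx : x ≠ c) :
    column (Q ∪ C) x = column Q x := by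
  ext u
  rw [mem_column, Finset.mem_union, mem_column]
  constructor
  · rintro ⟨h1 | h1, h2⟩
    · exact ⟨h1, h2⟩
    · exact absurd (h2.symm.trans (h.eq u h1)) hx
  · exact fun hu => ⟨Or.inl hu.1, hu.2⟩

theorem column_left_self (h : RightCol Q C c) : column Q c = ∅ :=
  Finset.eq_empty_of_forall_notMem fun u hu =>
    (h.lt u (mem_column.1 hu).1).ne (mem_column.1 hu).2

theorem card (h : RightCol Q C c) : (Q ∪ C).card = Q.card + C.card :=
  Finset.card_union_of_disjoint h.disjoint

theorem simplexPart_of_isSimplex (h : RightCol Q C c) (hC : IsSimplex C) :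
    simplexPart (Q ∪ C) = simplexPart Q ∪ C := by
  ext u
  simp only [mem_simplexPart, Finset.mem_union]
  constructor
  · rintro ⟨hu | hu, h'⟩
    · rw [h.column_of_ne (h.lt u hu).ne] at h'
      exact Or.inl ⟨hu, h'⟩
    · exact Or.inr hu
  · rintro (⟨hu, h'⟩ | hu)
    · rw [h.column_of_ne (h.lt u hu).ne]
      exact ⟨Or.inl hu, h'⟩
    · rw [h.eq u hu, h.column_self]
      exact ⟨Or.inr hu, hC⟩

theorem simplexPart_of_not_isSimplex (h : RightCol Q C c) (hC : ¬ IsSimplex C) :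
    simplexPart (Q ∪ C) = simplexPart Q := by
  ext u
  simp only [mem_simplexPart, Finset.mem_union]
  constructor
  · rintro ⟨hu | hu, h'⟩
    · rw [h.column_of_ne (h.lt u hu).ne] at h'
      exact ⟨hu, h'⟩
    · rw [h.eq u hu, h.column_self] at h'
      exact absurd h' hC
  · rintro ⟨hu, h'⟩
    rw [h.column_of_ne (h.lt u hu).ne]
    exact ⟨Or.inl hu, h'⟩

theorem duplexPart_of_isDuplex (h : RightCol Q C c) (hC : IsDuplex C) :
    duplexPart (Q ∪ C) = duplexPart Q ∪ C := by
  ext u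
  simp only [mem_duplexPart, Finset.mem_union]
  constructor
  · rintro ⟨hu | hu, h'⟩
    · rw [h.column_of_ne (h.lt u hu).ne] at h'
      exact Or.inl ⟨hu, h'⟩
    · exact Or.inr hu
  · rintro (⟨hu, h'⟩ | hu)
    · rw [h.column_of_ne (h.lt u hu).ne]
      exact ⟨Or.inl hu, h'⟩
    · rw [h.eq u hu, h.column_self]
      exact ⟨Or.inr hu, hC⟩

theorem duplexPart_of_not_isDuplex (h : RightCol Q C c) (hC : ¬ IsDuplex C) :
    duplexPart (Q ∪ C) = duplexPart Q := by
  ext u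
  simp only [mem_duplexPart, Finset.mem_union]
  constructor
  · rintro ⟨hu | hu, h'⟩
    · rw [h.column_of_ne (h.lt u hu).ne] at h'
      exact ⟨hu, h'⟩
    · rw [h.eq u hu, h.column_self] at h'
      exact absurd h' hC
  · rintro ⟨hu, h'⟩
    rw [h.column_of_ne (h.lt u hu).ne]
    exact ⟨Or.inl hu, h'⟩

/-- The columns of `Q` stay to the left of `C` when cells of `Q` are discarded. -/
theorem mono (h : RightCol Q C c) {Q' : Finset Cell} (hQ : Q' ⊆ Q) : RightCol Q' C c :=
  ⟨fun u hu => h.lt u (hQ hu), h.eq, h.ne⟩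

theorem image_fst (h : RightCol Q C c) :
    (Q ∪ C).image Prod.fst = insert c (Q.image Prod.fst) := by
  ext x
  simp only [Finset.mem_image, Finset.mem_union, Finset.mem_insert]
  constructor
  · rintro ⟨u, hu | hu, rfl⟩
    · exact Or.inr ⟨u, hu, rfl⟩
    · exact Or.inl (h.eq u hu)
  · rintro (rfl | ⟨u, hu, rfl⟩)
    · obtain ⟨u, hu⟩ := h.ne
      exact ⟨u, Or.inr hu, h.eq u hu⟩
    · exact ⟨u, Or.inl hu, rfl⟩

theorem notMem_image_fst (h : RightCol Q C c) : c ∉ Q.image Prod.fst := by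
  rw [Finset.mem_image]
  rintro ⟨u, hu, huc⟩
  exact (h.lt u hu).ne huc

theorem numDuplex_left (h : RightCol Q C c) [DecidablePred fun x => IsDuplex (column (Q ∪ C) x)] :
    numDuplex Q = ((Q.image Prod.fst).filter fun x => IsDuplex (column (Q ∪ C) x)).card := by
  classical
  unfold numDuplex
  refine congrArg Finset.card (Finset.filter_congr fun x hx => ?_)
  rw [h.column_of_ne]
  rintro rfl
  exact h.notMem_image_fst hx

theorem numDuplex_of_isDuplex (h : RightCol Q C c) (hC : IsDuplex C) :
    numDuplex (Q ∪ C) = numDuplex Q + 1 := by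
  classical
  rw [h.numDuplex_left, numDuplex, h.image_fst, Finset.filter_insert,
    if_pos (by rwa [h.column_self]), Finset.card_insert_of_notMem]
  exact fun hx => h.notMem_image_fst (Finset.mem_filter.1 hx).1

theorem numDuplex_of_not_isDuplex (h : RightCol Q C c) (hC : ¬ IsDuplex C) :
    numDuplex (Q ∪ C) = numDuplex Q := by
  classical
  rw [h.numDuplex_left, numDuplex, h.image_fst, Finset.filter_insert,
    if_neg (by rwa [h.column_self])]

end RightCol

/-- Every nonempty set of cells has a last column. -/
theorem exists_rightCol {P : Finset Cell} (h : P.Nonempty) :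
    ∃ Q C c, RightCol Q C c ∧ P = Q ∪ C := by
  obtain ⟨m, hm, hm'⟩ := P.exists_max_image Prod.fst h
  refine ⟨P.filter fun u => u.1 ≠ m.1, P.filter fun u => u.1 = m.1, m.1, ⟨?_, ?_, ?_⟩, ?_⟩
  · intro u hu
    rw [Finset.mem_filter] at hu
    exact lt_of_le_of_ne (hm' u hu.1) hu.2
  · exact fun u hu => (Finset.mem_filter.1 hu).2
  · exact ⟨m, Finset.mem_filter.2 ⟨hm, rfl⟩⟩
  · rw [Finset.union_comm]
    exact (Finset.filter_union_filter_not_eq _ _).symm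

theorem rightCol_seg {x a b : ℤ} (h : a ≤ b) {Q : Finset Cell} (hQ : ∀ u ∈ Q, u.1 < x) :
    RightCol Q (seg x a b) x :=
  ⟨hQ, fun _ hu => (mem_seg.1 hu).1, (conn_seg h).nonempty'⟩

/-- The condition on the columns in the definition of simplex-duplex polyominoes. -/
def GoodCols (P : Finset Cell) : Prop :=
  (∀ x, (column P x).Nonempty → IsSimplex (column P x) ∨ IsDuplex (column P x)) ∧
    ∀ x, ¬ (IsDuplex (column P x) ∧ IsDuplex (column P (x + 1)))

theorem isSimplexDuplex_iff {P : Finset Cell} : IsSimplexDuplex P ↔ Conn P ∧ GoodCols P := by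
  have : ∀ x, x ∈ P.image Prod.fst ↔ (column P x).Nonempty := by
    intro x
    rw [Finset.mem_image]
    exact ⟨fun ⟨u, hu, hx⟩ => ⟨u, mem_column.2 ⟨hu, hx⟩⟩, fun ⟨u, hu⟩ => ⟨u, mem_column.1 hu⟩⟩
  simp only [IsSimplexDuplex, IsColumnDuplex, GoodCols, this, and_assoc]

theorem goodCols_empty : GoodCols ∅ := by
  have : ∀ x, column ∅ x = ∅ := fun x => Finset.filter_empty _
  refine ⟨fun x hx => ?_, fun x hx => ?_⟩
  · rw [this] at hx
    exact absurd hx Finset.not_nonempty_empty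
  · rw [this] at hx
    exact absurd hx.1.nonempty Finset.not_nonempty_empty

theorem RightCol.goodCols_iff {Q C : Finset Cell} {c : ℤ} (h : RightCol Q C c) :
    GoodCols (Q ∪ C) ↔ GoodCols Q ∧ (IsSimplex C ∨ IsDuplex C) ∧
      ¬ (IsDuplex (column Q (c - 1)) ∧ IsDuplex C) := by
  have hc := h.column_self
  have hx : ∀ x, x ≠ c → column (Q ∪ C) x = column Q x := fun x => h.column_of_ne
  have hc' : ∀ x > c, ¬ IsDuplex (column (Q ∪ C) x) := by
    intro x hx hd
    obtain ⟨u, hu⟩ := hd.nonempty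
    rw [mem_column, Finset.mem_union] at hu
    obtain ⟨hu | hu, rfl⟩ := hu
    · exact absurd (h.lt u hu) (by omega)
    · exact absurd (h.eq u hu) (by omega)
  have he : ¬ IsDuplex (column Q c) := by
    rw [h.column_left_self]
    exact fun hd => absurd hd.nonempty Finset.not_nonempty_empty
  constructor
  · rintro ⟨h1, h2⟩
    refine ⟨⟨fun x hxn => ?_, fun x => ?_⟩, ?_, ?_⟩
    · by_cases hxc : x = c
      · rw [hxc, h.column_left_self] at hxn
        exact absurd hxn Finset.not_nonempty_empty
      · rw [← hx x hxc] at hxn ⊢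
        exact h1 x hxn
    · by_cases hxc : x = c
      · rw [hxc]
        exact fun hd => he hd.1
      · by_cases hxc' : x + 1 = c
        · rw [hxc']
          exact fun hd => he hd.2
        · rw [← hx x hxc, ← hx _ hxc']
          exact h2 x
    · have := h1 c (by rw [hc]; exact h.ne)
      rwa [hc] at this
    · have := h2 (c - 1)
      rwa [sub_add_cancel, hc, hx _ (by omega)] at this
  · rintro ⟨⟨h1, h2⟩, h3, h4⟩
    refine ⟨fun x hxn => ?_, fun x => ?_⟩
    · by_cases hxc : x = c
      · rwa [hxc, hc]
      · rw [hx x hxc] at hxn ⊢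
        exact h1 x hxn
    · by_cases hxc : x = c
      · rw [hxc]
        exact fun hd => hc' (c + 1) (by omega) hd.2
      · by_cases hxc' : x + 1 = c
        · obtain rfl : x = c - 1 := by omega
          rwa [sub_add_cancel, hc, hx _ hxc]
        · rw [hx x hxc, hx _ hxc']
          exact h2 x

/-! ### Attaching and removing the last columns -/

/-- The endpoints of the last two columns when these are a duplex column, with components
`[l0, l1]` and `[u0, u1]`, followed by a simplex column `[m0, m1]`. -/
@[ext]
structure Tail where
  l0 : ℤ
  l1 : ℤ
  u0 : ℤ
  u1 : ℤ
  m0 : ℤ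
  m1 : ℤ

namespace Tail

/-- The three segments are nonempty and there is a hole between the first two. -/
def Wf (d : Tail) : Prop := d.l0 ≤ d.l1 ∧ d.l1 + 1 < d.u0 ∧ d.u0 ≤ d.u1 ∧ d.m0 ≤ d.m1

/-- The lower component shares an edge with the preceding column `[k0, k1]`. -/
def KL (d : Tail) (k0 k1 : ℤ) : Prop := max d.l0 k0 ≤ min d.l1 k1

/-- The upper component shares an edge with the preceding column `[k0, k1]`. -/
def KU (d : Tail) (k0 k1 : ℤ) : Prop := max d.u0 k0 ≤ min d.u1 k1

/-- The last column shares an edge with the lower component. -/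
def ML (d : Tail) : Prop := max d.m0 d.l0 ≤ min d.m1 d.l1

/-- The last column shares an edge with the upper component. -/
def MU (d : Tail) : Prop := max d.m0 d.u0 ≤ min d.m1 d.u1

/-- At least three of the four possible contacts between the preceding column, the two components
and the last column are present, which is what connectedness amounts to. -/
def Linked (d : Tail) (k0 k1 : ℤ) : Prop :=
  d.KL k0 k1 ∧ d.KU k0 k1 ∧ (d.ML ∨ d.MU) ∨ d.ML ∧ d.MU ∧ (d.KL k0 k1 ∨ d.KU k0 k1)

/-- The duplex column, placed in column `c`. -/
def duplex (d : Tail) (c : ℤ) : Finset Cell := seg c d.l0 d.l1 ∪ seg c d.u0 d.u1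

theorem mem_duplex {d : Tail} {c : ℤ} {u : Cell} : u ∈ d.duplex c ↔
    u.1 = c ∧ (d.l0 ≤ u.2 ∧ u.2 ≤ d.l1 ∨ d.u0 ≤ u.2 ∧ u.2 ≤ d.u1) := by
  rw [duplex, Finset.mem_union, mem_seg, mem_seg, ← and_or_left]

theorem Wf.isDuplexWith {d : Tail} (h : d.Wf) (c : ℤ) :
    IsDuplexWith (d.duplex c) (seg c d.l0 d.l1) (seg c d.u0 d.u1) :=
  isDuplexWith_seg h.1 h.2.2.1 h.2.1

theorem Wf.isDuplex {d : Tail} (h : d.Wf) (c : ℤ) : IsDuplex (d.duplex c) :=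
  ⟨_, _, h.isDuplexWith c⟩

end Tail

/-- `Q` with the simplex column `[m0, m1]` attached in column `c + 1`. -/
def ext2 (Q : Finset Cell) (c m0 m1 : ℤ) : Finset Cell := Q ∪ seg (c + 1) m0 m1

/-- `Q` with a duplex column attached in column `c + 1` and a simplex one in column `c + 2`. -/
def ext3 (Q : Finset Cell) (c : ℤ) (d : Tail) : Finset Cell :=
  Q ∪ d.duplex (c + 1) ∪ seg (c + 2) d.m0 d.m1

/-- `Q` belongs to `S` and its last column is the segment `[k0, k1]` in column `c`. -/
structure EndsAt (Q : Finset Cell) (c k0 k1 : ℤ) : Prop where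
  inS : InS Q
  lastCol_eq : lastCol Q = seg c k0 k1
  le : k0 ≤ k1

namespace EndsAt

variable {Q : Finset Cell} {c k0 k1 : ℤ}

theorem seg_subset (h : EndsAt Q c k0 k1) : seg c k0 k1 ⊆ Q := by
  rw [← h.lastCol_eq]
  exact Finset.filter_subset _ _

theorem le_of_mem (h : EndsAt Q c k0 k1) {u : Cell} (hu : u ∈ Q) : u.1 ≤ c := by
  have : (c, k0) ∈ lastCol Q := by
    rw [h.lastCol_eq, mk_mem_seg]
    exact ⟨rfl, le_rfl, h.le⟩
  exact (mem_lastCol.1 this).2 u hu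

theorem mem_seg_of_mem (h : EndsAt Q c k0 k1) {u : Cell} (hu : u ∈ Q) (huc : u.1 = c) :
    u ∈ seg c k0 k1 := by
  rw [← h.lastCol_eq, mem_lastCol, huc]
  exact ⟨hu, fun v hv => h.le_of_mem hv⟩

theorem column_eq (h : EndsAt Q c k0 k1) : column Q c = seg c k0 k1 := by
  ext u
  rw [mem_column]
  exact ⟨fun hu => h.mem_seg_of_mem hu.1 hu.2, fun hu => ⟨h.seg_subset hu, (mem_seg.1 hu).1⟩⟩

theorem rightCol (h : EndsAt Q c k0 k1) : RightCol (SimplexDuplex.dropLast Q) (seg c k0 k1) c := by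
  refine rightCol_seg h.le fun u hu => ?_
  rw [SimplexDuplex.dropLast, h.lastCol_eq, Finset.mem_sdiff] at hu
  exact lt_of_le_of_ne (h.le_of_mem hu.1) fun huc => hu.2 (h.mem_seg_of_mem hu.1 huc)

theorem eq_union (h : EndsAt Q c k0 k1) : Q = SimplexDuplex.dropLast Q ∪ seg c k0 k1 := by
  rw [SimplexDuplex.dropLast, h.lastCol_eq, Finset.sdiff_union_of_subset h.seg_subset]

theorem conn (h : EndsAt Q c k0 k1) : Conn Q := h.inS.1.1.1

theorem goodCols (h : EndsAt Q c k0 k1) : GoodCols Q := (isSimplexDuplex_iff.1 h.inS.1).2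

/-- The last column, being simplex, is the last column of the simplex part as well. -/
theorem lastCol_simplexPart (h : EndsAt Q c k0 k1) :
    SimplexDuplex.lastCol (simplexPart Q) = seg c k0 k1 := by
  rw [h.eq_union, h.rightCol.simplexPart_of_isSimplex (isSimplex_seg h.le)]
  exact (h.rightCol.mono fun u hu => (mem_simplexPart.1 hu).1).lastCol

end EndsAt

theorem rightCol_ext2 {Q : Finset Cell} {c m0 m1 : ℤ} (hQ : ∀ u ∈ Q, u.1 ≤ c) (hm : m0 ≤ m1) :
    RightCol Q (seg (c + 1) m0 m1) (c + 1) :=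
  rightCol_seg hm fun u hu => Int.lt_add_one_iff.2 (hQ u hu)

theorem rightCol_duplex {Q : Finset Cell} {c : ℤ} {d : Tail} (hQ : ∀ u ∈ Q, u.1 ≤ c) (hd : d.Wf) :
    RightCol Q (d.duplex (c + 1)) (c + 1) :=
  ⟨fun u hu => Int.lt_add_one_iff.2 (hQ u hu), fun _ hu => (Tail.mem_duplex.1 hu).1,
    (hd.isDuplex _).nonempty⟩

theorem rightCol_ext3 {Q : Finset Cell} {c : ℤ} {d : Tail} (hQ : ∀ u ∈ Q, u.1 ≤ c) (hd : d.Wf) :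
    RightCol (Q ∪ d.duplex (c + 1)) (seg (c + 2) d.m0 d.m1) (c + 2) := by
  refine rightCol_seg hd.2.2.2 fun u hu => ?_
  rcases Finset.mem_union.1 hu with hu | hu
  · have := hQ u hu
    omega
  · have := (Tail.mem_duplex.1 hu).1
    omega

/-- If everything to the right of a connected column is cut off, what remains is connected: a
path that leaves through this column comes back through it. -/
theorem conn_of_conn_union {Q R : Finset Cell} {c : ℤ} (h : Conn (Q ∪ R))
    (hQ : ∀ u ∈ Q, u.1 ≤ c) (hR : ∀ u ∈ R, c < u.1) (hK : Conn (column Q c)) : Conn Q := by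
  obtain ⟨k, hk⟩ := hK.nonempty'
  refine conn_iff.2 ⟨⟨k, (mem_column.1 hk).1⟩, fun T hT u hu v hv hTu => ?_⟩
  have hKT : ∀ a ∈ column Q c, (T a ↔ T k) := fun a ha => by
    have hT' : ∀ u ∈ column Q c, ∀ v ∈ column Q c, cellGraph.Adj u v → T u → T v :=
      fun u hu v hv => hT u (mem_column.1 hu).1 v (mem_column.1 hv).1
    exact ⟨hK.cut T hT' ha hk, hK.cut T hT' hk ha⟩
  have hQ' : ∀ u ∈ Q ∪ R, u.1 ≤ c → u ∈ Q := fun u hu huc =>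
    (Finset.mem_union.1 hu).resolve_right fun h' => (hR u h').not_ge huc
  have := h.cut (fun z => (z.1 ≤ c → T z) ∧ (c < z.1 → T k)) (by
    rintro a ha b hb hab ⟨h1, h2⟩
    rw [adj_iff] at hab
    refine ⟨fun hbc => ?_, fun hbc => ?_⟩
    · by_cases hac : a.1 ≤ c
      · exact hT a (hQ' a ha hac) b (hQ' b hb hbc) (adj_iff.2 hab) (h1 hac)
      · exact (hKT b (mem_column.2 ⟨hQ' b hb hbc, by omega⟩)).2 (h2 (by omega))
    · by_cases hac : a.1 ≤ c
      · exact (hKT a (mem_column.2 ⟨hQ' a ha hac, by omega⟩)).1 (h1 hac)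
      · exact h2 (by omega)) (Finset.mem_union_left R hu) (Finset.mem_union_left R hv)
    ⟨fun _ => hTu, fun h' => absurd (hQ u hu) (by omega)⟩
  exact this.1 (hQ v hv)

/-- Consecutive columns of a connected set of cells have consecutive abscissas. -/
theorem exists_mem_pred_column {Q R : Finset Cell} {c : ℤ} (h : Conn (Q ∪ R))
    (hQ : ∀ u ∈ Q, u.1 < c) (hR : ∀ u ∈ R, c ≤ u.1) (hne : Q.Nonempty) (hne' : R.Nonempty) :
    ∃ u ∈ Q, u.1 = c - 1 := by
  by_contra! hno
  obtain ⟨a, ha⟩ := hne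
  obtain ⟨b, hb⟩ := hne'
  have := h.cut (fun z => z.1 < c) (by
    intro u hu v hv huv huc
    rw [adj_iff] at huv
    rcases Finset.mem_union.1 hu with hu | hu
    · have := hno u hu
      have := hQ u hu
      omega
    · have := hR u hu
      omega) (Finset.mem_union_left _ ha) (Finset.mem_union_right _ hb) (hQ a ha)
  exact absurd (hR b hb) (by omega)

theorem RightCol.eq_pred {Q C R : Finset Cell} {c c' : ℤ} (h : RightCol Q C c)
    (hP : Conn (Q ∪ C ∪ R)) (hQ : ∀ u ∈ Q ∪ C, u.1 < c') (hR : ∀ u ∈ R, c' ≤ u.1)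
    (hne : R.Nonempty) : c = c' - 1 := by
  obtain ⟨u, hu, huc⟩ := exists_mem_pred_column hP hQ hR (h.ne.mono Finset.subset_union_right) hne
  obtain ⟨v, hv⟩ := h.ne
  have h1 := hQ v (Finset.mem_union_right _ hv)
  have h2 := h.eq v hv
  rcases Finset.mem_union.1 hu with hu | hu
  · have := h.lt u hu
    omega
  · have := h.eq u hu
    omega

theorem conn_ext2_iff {Q : Finset Cell} {c k0 k1 m0 m1 : ℤ} (h : EndsAt Q c k0 k1)
    (hm : m0 ≤ m1) : Conn (ext2 Q c m0 m1) ↔ max k0 m0 ≤ min k1 m1 := by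
  have hK : ShareEdge (seg c k0 k1) (seg (c + 1) m0 m1) ↔ max k0 m0 ≤ min k1 m1 :=
    shareEdge_seg (Or.inl rfl)
  rw [← hK]
  constructor
  · intro hP
    by_contra hno
    have := hP.cut (fun z => z.1 ≤ c) (by
      intro u hu v hv huv huc
      rcases Finset.mem_union.1 hv with hv | hv
      · exact h.le_of_mem hv
      · rcases Finset.mem_union.1 hu with hu | hu
        · have h1 := (mem_seg.1 hv).1
          have h2 := adj_iff.1 huv
          exact absurd ⟨u, h.mem_seg_of_mem hu (by omega), v, hv, huv⟩ hno
        · have h1 := (mem_seg.1 hu).1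
          omega) (Finset.mem_union_left _ (h.seg_subset (mk_mem_seg.2 ⟨rfl, le_rfl, h.le⟩)))
        (Finset.mem_union_right _ (mk_mem_seg.2 ⟨rfl, le_rfl, hm⟩)) le_rfl
    simp only at this
    omega
  · intro hs
    exact h.conn.union (conn_seg hm) (hs.mono h.seg_subset Finset.Subset.rfl)

theorem mem_ext3 {Q : Finset Cell} {c : ℤ} {d : Tail} {u : Cell} : u ∈ ext3 Q c d ↔
    u ∈ Q ∨ u ∈ seg (c + 1) d.l0 d.l1 ∨ u ∈ seg (c + 1) d.u0 d.u1 ∨ u ∈ seg (c + 2) d.m0 d.m1 := by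
  simp only [ext3, Tail.duplex, Finset.mem_union, or_assoc]

theorem Tail.shareEdge_KL {d : Tail} {c k0 k1 : ℤ} :
    ShareEdge (seg (c + 1) d.l0 d.l1) (seg c k0 k1) ↔ d.KL k0 k1 := shareEdge_seg (Or.inr rfl)

theorem Tail.shareEdge_KU {d : Tail} {c k0 k1 : ℤ} :
    ShareEdge (seg (c + 1) d.u0 d.u1) (seg c k0 k1) ↔ d.KU k0 k1 := shareEdge_seg (Or.inr rfl)

theorem Tail.shareEdge_ML {d : Tail} {c : ℤ} :
    ShareEdge (seg (c + 2) d.m0 d.m1) (seg (c + 1) d.l0 d.l1) ↔ d.ML :=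
  shareEdge_seg (Or.inr (by ring))

theorem Tail.shareEdge_MU {d : Tail} {c : ℤ} :
    ShareEdge (seg (c + 2) d.m0 d.m1) (seg (c + 1) d.u0 d.u1) ↔ d.MU :=
  shareEdge_seg (Or.inr (by ring))

/-- Truth values on the four parts of `ext3 Q c d` that agree across each contact agree on all four
parts, provided that `ext3 Q c d` is connected. -/
theorem Conn.ext3_cut {Q : Finset Cell} {c k0 k1 : ℤ} {d : Tail} (h : EndsAt Q c k0 k1)
    (hd : d.Wf) (hP : Conn (ext3 Q c d)) (tK tL tU tM : Prop) (hKL : d.KL k0 k1 → (tK ↔ tL))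
    (hKU : d.KU k0 k1 → (tK ↔ tU)) (hML : d.ML → (tM ↔ tL)) (hMU : d.MU → (tM ↔ tU)) :
    (tK ↔ tL) ∧ (tK ↔ tU) ∧ (tK ↔ tM) := by
  obtain ⟨h1, h2, h3, h4⟩ := hd
  let T : Cell → Prop := fun z => (z.1 ≤ c ∧ tK) ∨ (z ∈ seg (c + 1) d.l0 d.l1 ∧ tL) ∨
    (z ∈ seg (c + 1) d.u0 d.u1 ∧ tU) ∨ (z ∈ seg (c + 2) d.m0 d.m1 ∧ tM)
  have hTQ : ∀ z ∈ Q, (T z ↔ tK) := fun z hz => by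
    have := h.le_of_mem hz
    simp only [T, mem_seg, this, show z.1 ≠ c + 1 by omega, show z.1 ≠ c + 2 by omega]
    simp
  have hTL : ∀ z ∈ seg (c + 1) d.l0 d.l1, (T z ↔ tL) := fun z hz => by
    simp only [T, hz]
    rw [mem_seg] at hz
    simp [mem_seg, show ¬ z.1 ≤ c by omega, show z.1 ≠ c + 2 by omega, show ¬ d.u0 ≤ z.2 by omega]
  have hTU : ∀ z ∈ seg (c + 1) d.u0 d.u1, (T z ↔ tU) := fun z hz => by
    simp only [T, hz]
    rw [mem_seg] at hz
    simp [mem_seg, show ¬ z.1 ≤ c by omega, show z.1 ≠ c + 2 by omega, show ¬ z.2 ≤ d.l1 by omega]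
  have hTM : ∀ z ∈ seg (c + 2) d.m0 d.m1, (T z ↔ tM) := fun z hz => by
    simp only [T, hz]
    rw [mem_seg] at hz
    simp [mem_seg, show ¬ z.1 ≤ c by omega, show z.1 ≠ c + 1 by omega]
  have eKL : ∀ u ∈ Q, ∀ v ∈ seg (c + 1) d.l0 d.l1, cellGraph.Adj u v → (T u ↔ T v) := by
    intro u hu v hv huv
    rw [hTQ u hu, hTL v hv]
    have h5 := mem_seg.1 hv
    have h6 := h.le_of_mem hu
    have h7 := adj_iff.1 huv
    exact hKL (Tail.shareEdge_KL.1 ⟨v, hv, u, h.mem_seg_of_mem hu (by omega), huv.symm⟩)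
  have eKU : ∀ u ∈ Q, ∀ v ∈ seg (c + 1) d.u0 d.u1, cellGraph.Adj u v → (T u ↔ T v) := by
    intro u hu v hv huv
    rw [hTQ u hu, hTU v hv]
    have h5 := mem_seg.1 hv
    have h6 := h.le_of_mem hu
    have h7 := adj_iff.1 huv
    exact hKU (Tail.shareEdge_KU.1 ⟨v, hv, u, h.mem_seg_of_mem hu (by omega), huv.symm⟩)
  have eML : ∀ u ∈ seg (c + 2) d.m0 d.m1, ∀ v ∈ seg (c + 1) d.l0 d.l1, cellGraph.Adj u v →
      (T u ↔ T v) := by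
    intro u hu v hv huv
    rw [hTM u hu, hTL v hv]
    exact hML (Tail.shareEdge_ML.1 ⟨u, hu, v, hv, huv⟩)
  have eMU : ∀ u ∈ seg (c + 2) d.m0 d.m1, ∀ v ∈ seg (c + 1) d.u0 d.u1, cellGraph.Adj u v →
      (T u ↔ T v) := by
    intro u hu v hv huv
    rw [hTM u hu, hTU v hv]
    exact hMU (Tail.shareEdge_MU.1 ⟨u, hu, v, hv, huv⟩)
  have hT : ∀ u ∈ ext3 Q c d, ∀ v ∈ ext3 Q c d, cellGraph.Adj u v → T u → T v := by
    intro u hu v hv huv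
    have h7 := adj_iff.1 huv
    rcases mem_ext3.1 hu with hu | hu | hu | hu <;> rcases mem_ext3.1 hv with hv | hv | hv | hv
    · rw [hTQ u hu, hTQ v hv]; exact id
    · exact (eKL u hu v hv huv).1
    · exact (eKU u hu v hv huv).1
    · have := h.le_of_mem hu; have := mem_seg.1 hv; omega
    · exact (eKL v hv u hu huv.symm).2
    · rw [hTL u hu, hTL v hv]; exact id
    · rw [mem_seg] at hu hv; omega
    · exact (eML v hv u hu huv.symm).2
    · exact (eKU v hv u hu huv.symm).2
    · rw [mem_seg] at hu hv; omega
    · rw [hTU u hu, hTU v hv]; exact id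
    · exact (eMU v hv u hu huv.symm).2
    · have := h.le_of_mem hv; have := mem_seg.1 hu; omega
    · exact (eML u hu v hv huv).1
    · exact (eMU u hu v hv huv).1
    · rw [hTM u hu, hTM v hv]; exact id
  have hk : (c, k0) ∈ Q := h.seg_subset (mk_mem_seg.2 ⟨rfl, le_rfl, h.le⟩)
  have hl : (c + 1, d.l0) ∈ seg (c + 1) d.l0 d.l1 := mk_mem_seg.2 ⟨rfl, le_rfl, h1⟩
  have hu : (c + 1, d.u0) ∈ seg (c + 1) d.u0 d.u1 := mk_mem_seg.2 ⟨rfl, le_rfl, h3⟩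
  have hm : (c + 2, d.m0) ∈ seg (c + 2) d.m0 d.m1 := mk_mem_seg.2 ⟨rfl, le_rfl, h4⟩
  have hk' : (c, k0) ∈ ext3 Q c d := mem_ext3.2 (Or.inl hk)
  have hl' : (c + 1, d.l0) ∈ ext3 Q c d := mem_ext3.2 (Or.inr (Or.inl hl))
  have hu' : (c + 1, d.u0) ∈ ext3 Q c d := mem_ext3.2 (Or.inr (Or.inr (Or.inl hu)))
  have hm' : (c + 2, d.m0) ∈ ext3 Q c d := mem_ext3.2 (Or.inr (Or.inr (Or.inr hm)))
  rw [← hTQ _ hk, ← hTL _ hl, ← hTU _ hu, ← hTM _ hm]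
  exact ⟨⟨hP.cut T hT hk' hl', hP.cut T hT hl' hk'⟩, ⟨hP.cut T hT hk' hu', hP.cut T hT hu' hk'⟩,
    ⟨hP.cut T hT hk' hm', hP.cut T hT hm' hk'⟩⟩

theorem conn_ext3_iff {Q : Finset Cell} {c k0 k1 : ℤ} {d : Tail} (h : EndsAt Q c k0 k1)
    (hd : d.Wf) : Conn (ext3 Q c d) ↔ d.Linked k0 k1 := by
  constructor
  · intro hP
    -- If two of the four contacts are missing, one of these six assignments cuts the set in two.
    have key := hP.ext3_cut h hd
    have e1 := key True False False False
    have e2 := key False True False False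
    have e3 := key False False True False
    have e4 := key False False False True
    have e5 := key True True False False
    have e6 := key True False True False
    simp only [iff_true, imp_false, iff_false, not_true_eq_false, and_false, and_true,
      imp_true_iff, forall_const] at e1 e2 e3 e4 e5 e6
    unfold Tail.Linked
    tauto
  · obtain ⟨h1, h2, h3, h4⟩ := hd
    have hL := conn_seg (x := c + 1) h1
    have hU := conn_seg (x := c + 1) h3
    have hM := conn_seg (x := c + 2) h4
    have hQ := h.conn
    have kl : d.KL k0 k1 → ShareEdge Q (seg (c + 1) d.l0 d.l1) := fun h' =>
      (Tail.shareEdge_KL.2 h').symm.mono h.seg_subset Finset.Subset.rfl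
    have ku : d.KU k0 k1 → ShareEdge Q (seg (c + 1) d.u0 d.u1) := fun h' =>
      (Tail.shareEdge_KU.2 h').symm.mono h.seg_subset Finset.Subset.rfl
    have ml : d.ML → ShareEdge (seg (c + 2) d.m0 d.m1) (seg (c + 1) d.l0 d.l1) :=
      Tail.shareEdge_ML.2
    have mu : d.MU → ShareEdge (seg (c + 2) d.m0 d.m1) (seg (c + 1) d.u0 d.u1) :=
      Tail.shareEdge_MU.2
    have lft : ∀ {X Y Z : Finset Cell}, ShareEdge X Z → ShareEdge (X ∪ Y) Z := fun hs =>
      hs.mono Finset.subset_union_left Finset.Subset.rfl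
    have rgt : ∀ {X Y Z : Finset Cell}, ShareEdge Y Z → ShareEdge (X ∪ Y) Z := fun hs =>
      hs.mono Finset.subset_union_right Finset.Subset.rfl
    have e1 : ext3 Q c d = Q ∪ seg (c + 1) d.l0 d.l1 ∪ seg (c + 1) d.u0 d.u1 ∪
        seg (c + 2) d.m0 d.m1 := by
      rw [ext3, Tail.duplex, ← Finset.union_assoc Q]
    have e2 : ext3 Q c d = Q ∪ seg (c + 1) d.l0 d.l1 ∪ seg (c + 2) d.m0 d.m1 ∪
        seg (c + 1) d.u0 d.u1 := by
      rw [e1, Finset.union_right_comm]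
    have e3 : ext3 Q c d = Q ∪ seg (c + 1) d.u0 d.u1 ∪ seg (c + 2) d.m0 d.m1 ∪
        seg (c + 1) d.l0 d.l1 := by
      rw [e1, Finset.union_right_comm Q, Finset.union_right_comm]
    rintro (⟨a, b, hab⟩ | ⟨a, b, e | e⟩)
    · rw [e1]
      have := (hQ.union hL (kl a)).union hU (lft (ku b))
      rcases hab with e | e
      · exact this.union hM (lft (rgt (ml e).symm))
      · exact this.union hM (rgt (mu e).symm)
    · rw [e2]
      exact ((hQ.union hL (kl e)).union hM (rgt (ml a).symm)).union hU (rgt (mu b))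
    · rw [e3]
      exact ((hQ.union hU (ku e)).union hM (rgt (mu b).symm)).union hL (rgt (ml a))

theorem conn_empty_ext3_iff {c : ℤ} {d : Tail} (hd : d.Wf) :
    Conn (ext3 ∅ c d) ↔ d.ML ∧ d.MU := by
  obtain ⟨h1, h2, h3, h4⟩ := hd
  have hm : (c + 2, d.m0) ∈ ext3 ∅ c d :=
    mem_ext3.2 (Or.inr (Or.inr (Or.inr (mk_mem_seg.2 ⟨rfl, le_rfl, h4⟩))))
  constructor
  · intro hP
    constructor
    · by_contra hno
      have hl := mk_mem_seg.2 ⟨(rfl : c + 1 = c + 1), le_rfl, h1⟩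
      have := hP.cut (fun z => z ∈ seg (c + 1) d.l0 d.l1) (by
        intro a ha b hb hab hal
        rcases mem_ext3.1 hb with hb | hb | hb | hb
        · exact absurd hb (Finset.notMem_empty b)
        · exact hb
        · rw [mem_seg] at hb hal
          rw [adj_iff] at hab
          omega
        · exact absurd (Tail.shareEdge_ML.1 ⟨b, hb, a, hal, hab.symm⟩) hno)
        (mem_ext3.2 (Or.inr (Or.inl hl))) hm hl
      rw [mk_mem_seg] at this
      omega
    · by_contra hno
      have hu := mk_mem_seg.2 ⟨(rfl : c + 1 = c + 1), le_rfl, h3⟩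
      have := hP.cut (fun z => z ∈ seg (c + 1) d.u0 d.u1) (by
        intro a ha b hb hab hal
        rcases mem_ext3.1 hb with hb | hb | hb | hb
        · exact absurd hb (Finset.notMem_empty b)
        · rw [mem_seg] at hb hal
          rw [adj_iff] at hab
          omega
        · exact hb
        · exact absurd (Tail.shareEdge_MU.1 ⟨b, hb, a, hal, hab.symm⟩) hno)
        (mem_ext3.2 (Or.inr (Or.inr (Or.inl hu)))) hm hu
      rw [mk_mem_seg] at this
      omega
  · rintro ⟨hl, hu⟩
    have e : ext3 ∅ c d =
        seg (c + 1) d.l0 d.l1 ∪ seg (c + 2) d.m0 d.m1 ∪ seg (c + 1) d.u0 d.u1 := by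
      rw [ext3, Tail.duplex, Finset.empty_union, Finset.union_right_comm]
    rw [e]
    exact ((conn_seg h1).union (conn_seg h4) (Tail.shareEdge_ML.2 hl).symm).union (conn_seg h3)
      ((Tail.shareEdge_MU.2 hu).mono Finset.subset_union_right Finset.Subset.rfl)

theorem EndsAt.not_isDuplex_column {Q : Finset Cell} {c k0 k1 : ℤ} (h : EndsAt Q c k0 k1) :
    ¬ IsDuplex (column Q c) := by
  rw [h.column_eq]
  exact (isSimplex_seg h.le).not_isDuplex

theorem inS_ext2_iff {Q : Finset Cell} {c k0 k1 m0 m1 : ℤ} (h : EndsAt Q c k0 k1)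
    (hm : m0 ≤ m1) : InS (ext2 Q c m0 m1) ↔ max k0 m0 ≤ min k1 m1 := by
  have hr := rightCol_ext2 (fun u hu => h.le_of_mem hu) hm
  rw [InS, isSimplexDuplex_iff, conn_ext2_iff h hm, ext2, hr.lastCol, hr.goodCols_iff]
  have := isSimplex_seg (x := c + 1) hm
  have h' := h.not_isDuplex_column
  rw [add_sub_cancel_right]
  have := h.goodCols
  tauto

theorem inS_ext3_iff {Q : Finset Cell} {c k0 k1 : ℤ} {d : Tail} (h : EndsAt Q c k0 k1)
    (hd : d.Wf) : InS (ext3 Q c d) ↔ d.Linked k0 k1 := by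
  have hr := rightCol_duplex (fun u hu => h.le_of_mem hu) hd
  have hr' := rightCol_ext3 (fun u hu => h.le_of_mem hu) hd
  rw [InS, isSimplexDuplex_iff, conn_ext3_iff h hd, ext3, hr'.lastCol, hr'.goodCols_iff,
    hr.goodCols_iff, add_sub_cancel_right]
  have h1 := isSimplex_seg (x := c + 2) hd.2.2.2
  have h2 := h1.not_isDuplex
  have h3 := h.not_isDuplex_column
  simp [h1, h2, h3, h.goodCols, hd.isDuplex (c + 1)]

/-- The four shapes of the elements of `S`: a single column, a duplex column followed by a simplex
one, or a smaller element of `S` with one simplex column, respectively with a duplex and a simplex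
column, attached to its right. -/
theorem InS.shape {P : Finset Cell} (h : InS P) :
    (∃ c m0 m1, m0 ≤ m1 ∧ P = seg c m0 m1) ∨
    (∃ c, ∃ d : Tail, d.Wf ∧ d.ML ∧ d.MU ∧ P = ext3 ∅ c d) ∨
    (∃ Q c k0 k1 m0 m1, EndsAt Q c k0 k1 ∧ m0 ≤ m1 ∧ max k0 m0 ≤ min k1 m1 ∧
      P = ext2 Q c m0 m1) ∨
    (∃ Q c k0 k1, ∃ d : Tail, EndsAt Q c k0 k1 ∧ d.Wf ∧ d.Linked k0 k1 ∧ P = ext3 Q c d) := by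
  obtain ⟨⟨hP, hcols⟩, hlast⟩ := (show InS P from h).imp_left isSimplexDuplex_iff.1
  obtain ⟨R, C, e, hR, rfl⟩ := exists_rightCol hP.nonempty'
  rw [hR.lastCol] at hlast
  obtain ⟨m0, m1, hm, rfl⟩ := hlast.exists_seg hR.eq
  rw [hR.goodCols_iff] at hcols
  obtain ⟨hRcols, -, -⟩ := hcols
  rcases R.eq_empty_or_nonempty with rfl | hRne
  · exact Or.inl ⟨e, m0, m1, hm, Finset.empty_union _⟩
  obtain ⟨Q, D, c, hQ, rfl⟩ := exists_rightCol hRne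
  obtain rfl : c = e - 1 := hQ.eq_pred hP hR.lt (fun u hu => (hR.eq u hu).ge) hR.ne
  rw [hQ.goodCols_iff] at hRcols
  have hRcols' := hRcols
  obtain ⟨hQcols, hD, hDD⟩ := hRcols
  rcases hD with hD | hD
  · -- the second-last column is simplex
    have hconn : Conn (Q ∪ D) := by
      refine conn_of_conn_union hP (fun u hu => Int.le_sub_one_of_lt (hR.lt u hu))
        (fun u hu => ?_) ?_
      · rw [hR.eq u hu]
        exact sub_one_lt e
      · rw [hQ.column_self]
        exact hD
    obtain ⟨k0, k1, hk, rfl⟩ := hD.exists_seg hQ.eq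
    have hE : EndsAt (Q ∪ seg (e - 1) k0 k1) (e - 1) k0 k1 := by
      refine ⟨⟨isSimplexDuplex_iff.2 ⟨hconn, hQ.goodCols_iff.2 hRcols'⟩, ?_⟩, hQ.lastCol, hk⟩
      rw [hQ.lastCol]
      exact hD
    have hext : Q ∪ seg (e - 1) k0 k1 ∪ seg e m0 m1 =
        ext2 (Q ∪ seg (e - 1) k0 k1) (e - 1) m0 m1 := by
      rw [ext2, sub_add_cancel]
    rw [hext] at h ⊢
    exact Or.inr (Or.inr (Or.inl ⟨_, _, k0, k1, m0, m1, hE, hm, (inS_ext2_iff hE hm).1 h, rfl⟩))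
  · -- the second-last column is duplex
    obtain ⟨L, U, hLU⟩ := hD
    obtain ⟨l0, l1, u0, u1, hl, hu, hlu, rfl, rfl⟩ := hLU.exists_seg hQ.eq
    obtain rfl := hLU.1
    have hd : Tail.Wf ⟨l0, l1, u0, u1, m0, m1⟩ := ⟨hl, hlu, hu, hm⟩
    have hext : ∀ X : Finset Cell, X ∪ (seg (e - 1) l0 l1 ∪ seg (e - 1) u0 u1) ∪ seg e m0 m1 =
        ext3 X (e - 1 - 1) ⟨l0, l1, u0, u1, m0, m1⟩ := by
      intro X
      rw [ext3, Tail.duplex, sub_add_cancel, show e - 1 - 1 + 2 = e by ring]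
    rcases Q.eq_empty_or_nonempty with rfl | hQne
    · rw [hext] at hP ⊢
      obtain ⟨h1, h2⟩ := (conn_empty_ext3_iff hd).1 hP
      exact Or.inr (Or.inl ⟨_, _, hd, h1, h2, rfl⟩)
    · obtain ⟨Q', K, c, hQ', rfl⟩ := exists_rightCol hQne
      have hP' := hP
      rw [Finset.union_assoc] at hP'
      have hright : ∀ u ∈ seg (e - 1) l0 l1 ∪ seg (e - 1) u0 u1 ∪ seg e m0 m1, e - 1 ≤ u.1 := by
        intro u hu
        rcases Finset.mem_union.1 hu with hu | hu
        · exact (hQ.eq u hu).ge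
        · rw [hR.eq u hu]
          exact (sub_one_lt e).le
      obtain rfl : c = e - 1 - 1 := hQ'.eq_pred hP' hQ.lt hright
        (hR.ne.mono Finset.subset_union_right)
      rw [hQ'.column_self] at hDD
      have hQcols' := hQcols
      rw [hQ'.goodCols_iff] at hQcols
      have hK : IsSimplex K := hQcols.2.1.resolve_right fun hK => hDD ⟨hK, _, _, hLU⟩
      have hconn : Conn (Q' ∪ K) := by
        refine conn_of_conn_union hP' (fun u hu => Int.le_sub_one_of_lt (hQ.lt u hu))
          (fun u hu => (sub_one_lt _).trans_le (hright u hu)) ?_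
        rw [hQ'.column_self]
        exact hK
      obtain ⟨k0, k1, hk, rfl⟩ := hK.exists_seg hQ'.eq
      rw [hext] at h ⊢
      have hE : EndsAt (Q' ∪ seg (e - 1 - 1) k0 k1) (e - 1 - 1) k0 k1 := by
        refine ⟨⟨isSimplexDuplex_iff.2 ⟨hconn, hQcols'⟩, ?_⟩, hQ'.lastCol, hk⟩
        rw [hQ'.lastCol]
        exact hK
      exact Or.inr (Or.inr (Or.inr ⟨_, _, k0, k1, _, hE, hd, (inS_ext3_iff hE hd).1 h, rfl⟩))

/-! ### The classes in terms of endpoints -/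

/-- The twelve classes, on the level of sets of cells. -/
def Cls : Label → Finset Cell → Prop
  | .alpha => InAlpha
  | .beta => InBeta
  | .gamma => InGamma
  | .delta => InDelta
  | .epsilon => InEpsilon
  | .zeta => InZeta
  | .eta => InEta
  | .theta => InTheta
  | .iota => InIota
  | .kappa => InKappa
  | .lambda => InLambda
  | .mu => InMu

theorem Scls_eq (i : Label) : Scls i = polySet (Cls i) := by cases i <;> rfl

theorem Cls.inRest {i : Label} {P : Finset Cell} (h : Cls i P) (hi : i ≠ .alpha) : InRest P := by
  cases i
  · exact absurd rfl hi
  all_goals exact h.1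

theorem Cls.inS {i : Label} {P : Finset Cell} (h : Cls i P) : InS P := by
  by_cases hi : i = .alpha
  · subst hi
    exact h.1
  · exact (h.inRest hi).1

theorem InAlpha.cls_iff {P : Finset Cell} (h : InAlpha P) (i : Label) :
    Cls i P ↔ i = .alpha := by
  constructor
  · intro hi
    by_contra hne
    exact (hi.inRest hne).2 h
  · rintro rfl
    exact h

theorem isBottom_seg {x a b : ℤ} (h : a ≤ b) {u : Cell} : IsBottom (seg x a b) u ↔ u = (x, a) := by
  obtain ⟨y, z⟩ := u
  rw [IsBottom, mk_mem_seg, Prod.mk.injEq]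
  constructor
  · rintro ⟨⟨h1, h2, h3⟩, h4⟩
    have := h4 (x, a) (mk_mem_seg.2 ⟨rfl, le_rfl, h⟩)
    simp only at this
    omega
  · rintro ⟨rfl, rfl⟩
    exact ⟨⟨rfl, le_rfl, h⟩, fun v hv => (mem_seg.1 hv).2.1⟩

theorem isTop_seg {x a b : ℤ} (h : a ≤ b) {u : Cell} : IsTop (seg x a b) u ↔ u = (x, b) := by
  obtain ⟨y, z⟩ := u
  rw [IsTop, mk_mem_seg, Prod.mk.injEq]
  constructor
  · rintro ⟨⟨h1, h2, h3⟩, h4⟩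
    have := h4 (x, b) (mk_mem_seg.2 ⟨rfl, h, le_rfl⟩)
    simp only at this
    omega
  · rintro ⟨rfl, rfl⟩
    exact ⟨⟨rfl, h, le_rfl⟩, fun v hv => (mem_seg.1 hv).2.2⟩

theorem inHole_seg {x l0 l1 u0 u1 y : ℤ} (hl : l0 ≤ l1) (hu : u0 ≤ u1) :
    InHole (seg x l0 l1) (seg x u0 u1) (x, y) ↔ l1 < y ∧ y < u0 := by
  constructor
  · rintro ⟨h1, h2⟩
    exact ⟨(h1 (x, l1) (mk_mem_seg.2 ⟨rfl, hl, le_rfl⟩)).2,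
      (h2 (x, u0) (mk_mem_seg.2 ⟨rfl, le_rfl, hu⟩)).2⟩
  · rintro ⟨h1, h2⟩
    refine ⟨fun u hu => ?_, fun u hu => ?_⟩ <;> rw [mem_seg] at hu
    · exact ⟨hu.1, hu.2.2.trans_lt h1⟩
    · exact ⟨hu.1, h2.trans_le hu.2.1⟩

/-- The class with label `i`, for polyominoes with simplex last two columns `[k0, k1]` and
`[m0, m1]`. The lower pivot cell is at the height `k0`. -/
def Cond2 (i : Label) (k0 k1 m0 m1 : ℤ) : Prop :=
  match i with
  | .beta => max k0 m0 ≤ min k1 m1 ∧ m0 ≤ k0 ∧ k0 ≤ m1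
  | .gamma => max k0 m0 ≤ min k1 m1 ∧ ¬ (m0 ≤ k0 ∧ k0 ≤ m1)
  | _ => False

/-- The class with label `i`, for polyominoes ending with a simplex column `[k0, k1]`, a duplex
column and a simplex column. The pivot cells are at the heights `k0` and `k1`, the inner pivot cells
at the heights `d.l1` and `d.u0`. -/
def Cond3 (i : Label) (k0 k1 : ℤ) (d : Tail) : Prop :=
  match i with
  | .alpha | .beta | .gamma => False
  | .delta => d.Linked k0 k1 ∧ ¬ d.KL k0 k1 ∧ d.u0 ≤ k0 ∧ k0 ≤ d.u1
  | .epsilon => d.Linked k0 k1 ∧ ¬ d.KL k0 k1 ∧ d.l1 < k0 ∧ k0 < d.u0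
  | .zeta => d.Linked k0 k1 ∧ ¬ d.KU k0 k1 ∧ d.l0 ≤ k1 ∧ k1 ≤ d.l1
  | .eta => d.Linked k0 k1 ∧ ¬ d.KU k0 k1 ∧ d.l1 < k1 ∧ k1 < d.u0
  | .theta => d.Linked k0 k1 ∧ (d.KL k0 k1 ∧ d.KU k0 k1) ∧ d.ML ∧ d.MU
  | .iota => d.Linked k0 k1 ∧ (d.KL k0 k1 ∧ d.KU k0 k1) ∧ (d.ML ∧ ¬ d.MU) ∧
      ¬ (d.m0 ≤ d.l1 ∧ d.l1 ≤ d.m1)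
  | .kappa => d.Linked k0 k1 ∧ (d.KL k0 k1 ∧ d.KU k0 k1) ∧ (d.ML ∧ ¬ d.MU) ∧
      d.m0 ≤ d.l1 ∧ d.l1 ≤ d.m1
  | .lambda => d.Linked k0 k1 ∧ (d.KL k0 k1 ∧ d.KU k0 k1) ∧ (d.MU ∧ ¬ d.ML) ∧
      ¬ (d.m0 ≤ d.u0 ∧ d.u0 ≤ d.m1)
  | .mu => d.Linked k0 k1 ∧ (d.KL k0 k1 ∧ d.KU k0 k1) ∧ (d.MU ∧ ¬ d.ML) ∧
      d.m0 ≤ d.u0 ∧ d.u0 ≤ d.m1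

section Ext2

variable {Q : Finset Cell} {c k0 k1 m0 m1 : ℤ} (h : EndsAt Q c k0 k1) (hm : m0 ≤ m1)
include h hm

theorem lastCol_ext2 : lastCol (ext2 Q c m0 m1) = seg (c + 1) m0 m1 :=
  (rightCol_ext2 (fun _ hu => h.le_of_mem hu) hm).lastCol

theorem dropLast_ext2 : dropLast (ext2 Q c m0 m1) = Q :=
  (rightCol_ext2 (fun _ hu => h.le_of_mem hu) hm).dropLast

theorem secondLastCol_ext2 : secondLastCol (ext2 Q c m0 m1) = seg c k0 k1 := by
  rw [secondLastCol, dropLast_ext2 h hm, h.lastCol_eq]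

theorem secondLastSimplex_ext2 : secondLastSimplex (ext2 Q c m0 m1) = seg c k0 k1 := by
  have hr := rightCol_ext2 (fun u hu => h.le_of_mem hu) hm
  rw [secondLastSimplex, ext2, hr.simplexPart_of_isSimplex (isSimplex_seg hm), secondLastCol,
    (hr.mono fun u hu => (mem_simplexPart.1 hu).1).dropLast, h.lastCol_simplexPart]

theorem column_ext2 : column (ext2 Q c m0 m1) c = seg c k0 k1 := by
  rw [ext2, (rightCol_ext2 (fun _ hu => h.le_of_mem hu) hm).column_of_ne (by omega), h.column_eq]

theorem inRest_ext2_iff : InRest (ext2 Q c m0 m1) ↔ max k0 m0 ≤ min k1 m1 := by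
  rw [InRest, inS_ext2_iff h hm, and_iff_left]
  intro ha
  have := ha.2 c (by rw [column_ext2 h hm]; exact isSimplex_seg h.le)
  rw [column_ext2 h hm, lastCol_ext2 h hm] at this
  have := (seg_inj h.le this).1
  omega

theorem isLowerPivot_ext2 {z : Cell} : IsLowerPivot (ext2 Q c m0 m1) z ↔ z = (c + 1, k0) := by
  simp only [IsLowerPivot, secondLastSimplex_ext2 h hm, isBottom_seg h.le, exists_eq_left,
    rightNbr]

theorem not_endsWith_ext2 {L U : Finset Cell} : ¬ EndsWith (ext2 Q c m0 m1) L U := by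
  rw [EndsWith, secondLastCol_ext2 h hm]
  exact fun hE => (isSimplex_seg h.le).not_isDuplex ⟨_, _, hE.1⟩

theorem cls_ext2_iff (i : Label) : Cls i (ext2 Q c m0 m1) ↔ Cond2 i k0 k1 m0 m1 := by
  have hno := fun L U => not_endsWith_ext2 h hm (L := L) (U := U)
  have hr := inRest_ext2_iff h hm
  cases i
  case alpha =>
    refine ⟨fun ha => ?_, False.elim⟩
    exact ((inRest_ext2_iff h hm).2 ((inS_ext2_iff h hm).1 ha.1)).2 ha
  case beta =>
    simp only [Cls, InBeta, hr, secondLastCol_ext2 h hm, isSimplex_seg h.le, true_and,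
      isLowerPivot_ext2 h hm, exists_eq_left, lastCol_ext2 h hm, mk_mem_seg, Cond2]
  case gamma =>
    simp only [Cls, InGamma, hr, secondLastCol_ext2 h hm, isSimplex_seg h.le, true_and,
      isLowerPivot_ext2 h hm, exists_eq_left, lastCol_ext2 h hm, mk_mem_seg, Cond2]
  all_goals
    refine ⟨?_, False.elim⟩
    rintro ⟨-, L, U, hE, -⟩
    exact hno L U hE

end Ext2

section Ext3

variable {Q : Finset Cell} {c k0 k1 : ℤ} {d : Tail} (h : EndsAt Q c k0 k1) (hd : d.Wf)
include h hd

theorem lastCol_ext3 : lastCol (ext3 Q c d) = seg (c + 2) d.m0 d.m1 :=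
  (rightCol_ext3 (fun _ hu => h.le_of_mem hu) hd).lastCol

theorem dropLast_ext3 : dropLast (ext3 Q c d) = Q ∪ d.duplex (c + 1) :=
  (rightCol_ext3 (fun _ hu => h.le_of_mem hu) hd).dropLast

theorem dropLast_dropLast_ext3 : dropLast (dropLast (ext3 Q c d)) = Q := by
  rw [dropLast_ext3 h hd, (rightCol_duplex (fun u hu => h.le_of_mem hu) hd).dropLast]

theorem secondLastCol_ext3 : secondLastCol (ext3 Q c d) = d.duplex (c + 1) := by
  rw [secondLastCol, dropLast_ext3 h hd, (rightCol_duplex (fun u hu => h.le_of_mem hu) hd).lastCol]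

theorem thirdLastCol_ext3 : thirdLastCol (ext3 Q c d) = seg c k0 k1 := by
  rw [thirdLastCol, dropLast_dropLast_ext3 h hd, h.lastCol_eq]

theorem secondLastSimplex_ext3 : secondLastSimplex (ext3 Q c d) = seg c k0 k1 := by
  have hr := rightCol_duplex (fun u hu => h.le_of_mem hu) hd
  have hr' := rightCol_ext3 (fun u hu => h.le_of_mem hu) hd
  rw [secondLastSimplex, ext3, hr'.simplexPart_of_isSimplex (isSimplex_seg hd.2.2.2),
    secondLastCol, (hr'.mono fun u hu => (mem_simplexPart.1 hu).1).dropLast,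
    hr.simplexPart_of_not_isSimplex fun hs => hs.not_isDuplex (hd.isDuplex _),
    h.lastCol_simplexPart]

theorem lastDuplex_ext3 : lastDuplex (ext3 Q c d) = d.duplex (c + 1) := by
  have hr := rightCol_duplex (fun u hu => h.le_of_mem hu) hd
  have hr' := rightCol_ext3 (fun u hu => h.le_of_mem hu) hd
  rw [lastDuplex, ext3, hr'.duplexPart_of_not_isDuplex (isSimplex_seg hd.2.2.2).not_isDuplex,
    hr.duplexPart_of_isDuplex (hd.isDuplex _),
    (hr.mono fun u hu => (mem_duplexPart.1 hu).1).lastCol]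

theorem column_ext3 : column (ext3 Q c d) c = seg c k0 k1 := by
  rw [ext3, (rightCol_ext3 (fun _ hu => h.le_of_mem hu) hd).column_of_ne (by omega),
    (rightCol_duplex (fun _ hu => h.le_of_mem hu) hd).column_of_ne (by omega), h.column_eq]

theorem inRest_ext3_iff : InRest (ext3 Q c d) ↔ d.Linked k0 k1 := by
  rw [InRest, inS_ext3_iff h hd, and_iff_left]
  intro ha
  have := ha.2 c (by rw [column_ext3 h hd]; exact isSimplex_seg h.le)
  rw [column_ext3 h hd, lastCol_ext3 h hd] at this
  have := (seg_inj h.le this).1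
  omega

theorem isLowerPivot_ext3 {z : Cell} : IsLowerPivot (ext3 Q c d) z ↔ z = (c + 1, k0) := by
  simp only [IsLowerPivot, secondLastSimplex_ext3 h hd, isBottom_seg h.le, exists_eq_left,
    rightNbr]

theorem isUpperPivot_ext3 {z : Cell} : IsUpperPivot (ext3 Q c d) z ↔ z = (c + 1, k1) := by
  simp only [IsUpperPivot, secondLastSimplex_ext3 h hd, isTop_seg h.le, exists_eq_left,
    rightNbr]

theorem isLowerInnerPivot_ext3 {z : Cell} :
    IsLowerInnerPivot (ext3 Q c d) z ↔ z = (c + 2, d.l1) := by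
  simp only [IsLowerInnerPivot, lastDuplex_ext3 h hd, Tail.duplex,
    isDuplexWith_seg_iff hd.1 hd.2.2.1 hd.2.1]
  constructor
  · rintro ⟨_, _, u, ⟨rfl, rfl⟩, hu, rfl⟩
    rw [(isTop_seg hd.1).1 hu, rightNbr, add_assoc]
    rfl
  · rintro rfl
    refine ⟨_, _, _, ⟨rfl, rfl⟩, (isTop_seg hd.1).2 rfl, ?_⟩
    rw [rightNbr, add_assoc]
    rfl

theorem isUpperInnerPivot_ext3 {z : Cell} :
    IsUpperInnerPivot (ext3 Q c d) z ↔ z = (c + 2, d.u0) := by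
  simp only [IsUpperInnerPivot, lastDuplex_ext3 h hd, Tail.duplex,
    isDuplexWith_seg_iff hd.1 hd.2.2.1 hd.2.1]
  constructor
  · rintro ⟨_, _, u, ⟨rfl, rfl⟩, hu, rfl⟩
    rw [(isBottom_seg hd.2.2.1).1 hu, rightNbr, add_assoc]
    rfl
  · rintro rfl
    refine ⟨_, _, _, ⟨rfl, rfl⟩, (isBottom_seg hd.2.2.1).2 rfl, ?_⟩
    rw [rightNbr, add_assoc]
    rfl

theorem exists_endsWith_ext3 {p : Finset Cell → Finset Cell → Prop} :
    (∃ L U, EndsWith (ext3 Q c d) L U ∧ p L U) ↔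
      p (seg (c + 1) d.l0 d.l1) (seg (c + 1) d.u0 d.u1) := by
  simp only [EndsWith, secondLastCol_ext3 h hd, thirdLastCol_ext3 h hd, Tail.duplex,
    isDuplexWith_seg_iff hd.1 hd.2.2.1 hd.2.1]
  constructor
  · rintro ⟨_, _, ⟨⟨rfl, rfl⟩, -⟩, hp⟩
    exact hp
  · exact fun hp => ⟨_, _, ⟨⟨rfl, rfl⟩, isSimplex_seg h.le⟩, hp⟩

theorem not_isSimplex_secondLastCol_ext3 : ¬ IsSimplex (secondLastCol (ext3 Q c d)) := by
  rw [secondLastCol_ext3 h hd]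
  exact fun hs => hs.not_isDuplex (hd.isDuplex _)

theorem cls_ext3_iff (i : Label) : Cls i (ext3 Q c d) ↔ Cond3 i k0 k1 d := by
  have hr := inRest_ext3_iff h hd
  cases i
  case alpha =>
    refine ⟨fun ha => ?_, False.elim⟩
    exact ((inRest_ext3_iff h hd).2 ((inS_ext3_iff h hd).1 ha.1)).2 ha
  case beta => exact ⟨fun hb => not_isSimplex_secondLastCol_ext3 h hd hb.2.1, False.elim⟩
  case gamma => exact ⟨fun hb => not_isSimplex_secondLastCol_ext3 h hd hb.2.1, False.elim⟩
  all_goals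
    simp only [Cls, InDelta, InEpsilon, InZeta, InEta, InTheta, InIota, InKappa, InLambda, InMu,
      exists_endsWith_ext3 h hd, hr, thirdLastCol_ext3 h hd, lastCol_ext3 h hd,
      Tail.shareEdge_KL, Tail.shareEdge_KU, Tail.shareEdge_ML, Tail.shareEdge_MU,
      isLowerPivot_ext3 h hd, isUpperPivot_ext3 h hd, isLowerInnerPivot_ext3 h hd,
      isUpperInnerPivot_ext3 h hd, exists_eq_left, mk_mem_seg, inHole_seg hd.1 hd.2.2.1,
      true_and, Cond3]

end Ext3

theorem rightCol_empty_seg {c m0 m1 : ℤ} (hm : m0 ≤ m1) : RightCol ∅ (seg c m0 m1) c :=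
  rightCol_seg hm fun u hu => absurd hu (Finset.notMem_empty u)

theorem inAlpha_seg {c m0 m1 : ℤ} (hm : m0 ≤ m1) : InAlpha (seg c m0 m1) := by
  have hr := rightCol_empty_seg (c := c) hm
  rw [← Finset.empty_union (seg c m0 m1)]
  refine ⟨⟨isSimplexDuplex_iff.2 ⟨?_, ?_⟩, ?_⟩, fun x hx => ?_⟩
  · rw [Finset.empty_union]
    exact conn_seg hm
  · refine hr.goodCols_iff.2 ⟨goodCols_empty, Or.inl (isSimplex_seg hm), fun hd => ?_⟩
    exact (isSimplex_seg hm).not_isDuplex hd.2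
  · rw [hr.lastCol]
    exact isSimplex_seg hm
  · by_cases hxc : x = c
    · rw [hxc, hr.column_self, hr.lastCol]
    · rw [hr.column_of_ne hxc] at hx
      exact absurd hx.nonempty (by simp [column])

theorem inAlpha_empty_ext3 {c : ℤ} {d : Tail} (hd : d.Wf) (hl : d.ML) (hu : d.MU) :
    InAlpha (ext3 ∅ c d) := by
  have hr := rightCol_duplex (Q := ∅) (c := c) (fun u hu => absurd hu (Finset.notMem_empty u)) hd
  have hr' := rightCol_ext3 (Q := ∅) (c := c) (fun u hu => absurd hu (Finset.notMem_empty u)) hd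
  have hM := isSimplex_seg (x := c + 2) hd.2.2.2
  have he : ∀ x, column ∅ x = ∅ := fun x => Finset.filter_empty _
  have hne : ¬ IsDuplex (∅ : Finset Cell) := fun h => Finset.not_nonempty_empty h.nonempty
  have hne' : ¬ IsSimplex (∅ : Finset Cell) := fun h => Finset.not_nonempty_empty h.nonempty
  refine ⟨⟨isSimplexDuplex_iff.2 ⟨(conn_empty_ext3_iff hd).2 ⟨hl, hu⟩, ?_⟩, ?_⟩, fun x hx => ?_⟩
  · rw [ext3, hr'.goodCols_iff, hr.goodCols_iff]
    simp [goodCols_empty, hd.isDuplex, hM, hM.not_isDuplex, he, hne]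
  · rw [ext3, hr'.lastCol]
    exact hM
  · by_cases hxc : x = c + 2
    · rw [hxc, ext3, hr'.column_self, hr'.lastCol]
    · rw [ext3, hr'.column_of_ne hxc] at hx
      by_cases hxc' : x = c + 1
      · rw [hxc', hr.column_self] at hx
        exact absurd (hd.isDuplex _) hx.not_isDuplex
      · rw [hr.column_of_ne hxc', he] at hx
        exact absurd hx hne'

/-! ### Normal forms up to translation -/

theorem isSimplex_translate_iff {c : Finset Cell} (v : Cell) :
    IsSimplex (translate v c) ↔ IsSimplex c := by
  refine ⟨fun h => ?_, conn_translate v⟩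
  have : IsSimplex (translate (-v) (translate v c)) := conn_translate (-v) h
  rwa [translate_translate, add_neg_cancel, translate_zero] at this

theorem isDuplex_translate_iff {c : Finset Cell} (v : Cell) :
    IsDuplex (translate v c) ↔ IsDuplex c := by
  refine ⟨fun h => ?_, isDuplex_translate v⟩
  have := isDuplex_translate (-v) h
  rwa [translate_translate, add_neg_cancel, translate_zero] at this

theorem InS.translate {P : Finset Cell} (h : InS P) (v : Cell) : InS (translate v P) := by
  obtain ⟨⟨hP, h1, h2⟩, hlast⟩ := (show InS P from h).imp_left isSimplexDuplex_iff.1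
  have hcol : ∀ x, column (SimplexDuplex.translate v P) x =
      SimplexDuplex.translate v (column P (x - v.1)) := fun x => by
    rw [← column_translate, sub_add_cancel]
  refine ⟨isSimplexDuplex_iff.2 ⟨conn_translate v hP, fun x hx => ?_, fun x => ?_⟩, ?_⟩
  · rw [hcol, isSimplex_translate_iff, isDuplex_translate_iff]
    refine h1 _ ?_
    rw [hcol] at hx
    exact Finset.map_nonempty.1 hx
  · rw [hcol, hcol, isDuplex_translate_iff, isDuplex_translate_iff, add_sub_right_comm]
    exact h2 _
  · rw [lastCol_translate, isSimplex_translate_iff]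
    exact hlast

theorem EndsAt.translate {Q : Finset Cell} {c k0 k1 : ℤ} (h : EndsAt Q c k0 k1) (v : Cell) :
    EndsAt (translate v Q) (c + v.1) (k0 + v.2) (k1 + v.2) :=
  ⟨h.inS.translate v, by rw [lastCol_translate, h.lastCol_eq, translate_seg],
    by have := h.le; omega⟩

theorem InS.exists_endsAt {P : Finset Cell} (h : InS P) : ∃ c k0 k1, EndsAt P c k0 k1 := by
  obtain ⟨u, hu⟩ := h.2.nonempty
  obtain ⟨k0, k1, hk, e⟩ := h.2.exists_seg (x := u.1) fun v hv =>
    le_antisymm ((mem_lastCol.1 hu).2 v (mem_lastCol.1 hv).1)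
      ((mem_lastCol.1 hv).2 u (mem_lastCol.1 hu).1)
  exact ⟨u.1, k0, k1, h, e, hk⟩

/-- Vertical translation by `y`. -/
def Tail.shift (d : Tail) (y : ℤ) : Tail :=
  ⟨d.l0 + y, d.l1 + y, d.u0 + y, d.u1 + y, d.m0 + y, d.m1 + y⟩

theorem Tail.Wf.shift {d : Tail} (h : d.Wf) (y : ℤ) : (d.shift y).Wf := by
  simp only [Tail.Wf, Tail.shift] at h ⊢
  omega

theorem translate_ext2 (v : Cell) (Q : Finset Cell) (c m0 m1 : ℤ) :
    translate v (ext2 Q c m0 m1) = ext2 (translate v Q) (c + v.1) (m0 + v.2) (m1 + v.2) := by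
  rw [ext2, ext2, translate_union, translate_seg, add_right_comm]

theorem translate_ext3 (v : Cell) (Q : Finset Cell) (c : ℤ) (d : Tail) :
    translate v (ext3 Q c d) = ext3 (translate v Q) (c + v.1) (d.shift v.2) := by
  rw [ext3, ext3, translate_union, translate_union, translate_seg, Tail.duplex, Tail.duplex,
    translate_union, translate_seg, translate_seg, add_right_comm, add_right_comm c 2]
  rfl

theorem Tail.KL_shift {d : Tail} {k0 k1 : ℤ} (y : ℤ) :
    (d.shift y).KL (k0 + y) (k1 + y) ↔ d.KL k0 k1 := by
  simp only [Tail.KL, Tail.shift]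
  omega

theorem Tail.KU_shift {d : Tail} {k0 k1 : ℤ} (y : ℤ) :
    (d.shift y).KU (k0 + y) (k1 + y) ↔ d.KU k0 k1 := by
  simp only [Tail.KU, Tail.shift]
  omega

theorem Tail.ML_shift {d : Tail} (y : ℤ) : (d.shift y).ML ↔ d.ML := by
  simp only [Tail.ML, Tail.shift]
  omega

theorem Tail.MU_shift {d : Tail} (y : ℤ) : (d.shift y).MU ↔ d.MU := by
  simp only [Tail.MU, Tail.shift]
  omega

theorem cond2_add_iff (i : Label) (k0 k1 m0 m1 y : ℤ) :
    Cond2 i (k0 + y) (k1 + y) (m0 + y) (m1 + y) ↔ Cond2 i k0 k1 m0 m1 := by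
  cases i <;> simp only [Cond2] <;> omega

theorem cond3_shift_iff (i : Label) (k0 k1 : ℤ) (d : Tail) (y : ℤ) :
    Cond3 i (k0 + y) (k1 + y) (d.shift y) ↔ Cond3 i k0 k1 d := by
  cases i <;> simp only [Cond3, Tail.Linked, Tail.KL_shift, Tail.KU_shift, Tail.ML_shift,
    Tail.MU_shift] <;> simp only [Tail.shift, add_le_add_iff_right, add_lt_add_iff_right]

/-- An element of a class other than `S_α` arises from a smaller element of `S` by attaching one
or two columns. -/
theorem Cls.shape {i : Label} (hi : i ≠ .alpha) {P : Finset Cell} (h : Cls i P) :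
    (∃ Q c k0 k1 m0 m1, EndsAt Q c k0 k1 ∧ m0 ≤ m1 ∧ Cond2 i k0 k1 m0 m1 ∧ P = ext2 Q c m0 m1) ∨
    (∃ Q c k0 k1, ∃ d : Tail, EndsAt Q c k0 k1 ∧ d.Wf ∧ Cond3 i k0 k1 d ∧ P = ext3 Q c d) := by
  rcases h.inS.shape with ⟨c, m0, m1, hm, rfl⟩ | ⟨c, d, hd, hl, hu, rfl⟩ |
    ⟨Q, c, k0, k1, m0, m1, hE, hm, -, rfl⟩ | ⟨Q, c, k0, k1, d, hE, hd, -, rfl⟩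
  · exact absurd (((inAlpha_seg hm).cls_iff i).1 h) hi
  · exact absurd (((inAlpha_empty_ext3 hd hl hu).cls_iff i).1 h) hi
  · exact Or.inl ⟨Q, c, k0, k1, m0, m1, hE, hm, (cls_ext2_iff hE hm i).1 h, rfl⟩
  · exact Or.inr ⟨Q, c, k0, k1, d, hE, hd, (cls_ext3_iff hE hd i).1 h, rfl⟩

theorem InAlpha.shape {P : Finset Cell} (h : InAlpha P) :
    (∃ c m0 m1, m0 ≤ m1 ∧ P = seg c m0 m1) ∨
    (∃ c, ∃ d : Tail, d.Wf ∧ d.ML ∧ d.MU ∧ P = ext3 ∅ c d) := by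
  rcases h.1.shape with h' | h' | ⟨Q, c, k0, k1, m0, m1, hE, hm, -, rfl⟩ |
    ⟨Q, c, k0, k1, d, hE, hd, -, rfl⟩
  · exact Or.inl h'
  · exact Or.inr h'
  · exact ((cls_ext2_iff hE hm .alpha).1 h).elim
  · exact ((cls_ext3_iff hE hd .alpha).1 h).elim

/-- The classes are invariant under translation, since the conditions on the endpoints are. -/
theorem Cls.translate {i : Label} {P : Finset Cell} (h : Cls i P) (v : Cell) :
    Cls i (translate v P) := by
  by_cases hi : i = .alpha
  · subst hi
    rcases InAlpha.shape h with ⟨c, m0, m1, hm, rfl⟩ | ⟨c, d, hd, hl, hu, rfl⟩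
    · rw [translate_seg]
      exact inAlpha_seg (by omega)
    · rw [translate_ext3]
      exact inAlpha_empty_ext3 (hd.shift _) ((Tail.ML_shift _).2 hl) ((Tail.MU_shift _).2 hu)
  · rcases h.shape hi with ⟨Q, c, k0, k1, m0, m1, hE, hm, hc, rfl⟩ |
      ⟨Q, c, k0, k1, d, hE, hd, hc, rfl⟩
    · rw [translate_ext2, cls_ext2_iff (hE.translate v) (by omega), cond2_add_iff]
      exact hc
    · rw [translate_ext3, cls_ext3_iff (hE.translate v) (hd.shift _), cond3_shift_iff]
      exact hc

theorem mk_eq_mk_iff {P P' : Finset Cell} {h : Conn P} {h' : Conn P'} :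
    Polyomino.mk P h = Polyomino.mk P' h' ↔ ∃ v, P' = translate v P :=
  Quotient.eq (r := figSetoid)

theorem mk_mem_Scls_iff {P : Finset Cell} {h : Conn P} {i : Label} :
    Polyomino.mk P h ∈ Scls i ↔ Cls i P := by
  rw [Scls_eq]
  constructor
  · rintro ⟨P', h', e, hc⟩
    obtain ⟨v, rfl⟩ := mk_eq_mk_iff.1 e.symm
    exact hc.translate v
  · exact fun hc => ⟨P, h, rfl, hc⟩

theorem mk_mem_S_iff {P : Finset Cell} {h : Conn P} : Polyomino.mk P h ∈ S ↔ InS P := by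
  constructor
  · rintro ⟨P', h', e, hc⟩
    obtain ⟨v, rfl⟩ := mk_eq_mk_iff.1 e.symm
    exact hc.translate v
  · exact fun hc => ⟨P, h, rfl, hc⟩

theorem exists_eq_mk (p : Polyomino) : ∃ P h, p = Polyomino.mk P h := by
  obtain ⟨P, h⟩ := p
  exact ⟨P, h, rfl⟩

/-! ### The partition -/

theorem Cond2.label_unique {i j : Label} {k0 k1 m0 m1 : ℤ} (hi : Cond2 i k0 k1 m0 m1)
    (hj : Cond2 j k0 k1 m0 m1) : i = j := by
  cases i <;> try exact hi.elim
  all_goals cases j <;> first | exact hj.elim | rfl | skip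
  · exact absurd hi.2 hj.2
  · exact absurd hj.2 hi.2

/-- If the lower component does not reach the preceding column, it lies below it. -/
theorem Tail.Linked.of_not_KL {d : Tail} {k0 k1 : ℤ} (hk : k0 ≤ k1) (hd : d.Wf)
    (h : d.Linked k0 k1) (hl : ¬ d.KL k0 k1) : d.KU k0 k1 ∧ d.l1 < k0 ∧ k0 ≤ d.u1 := by
  have hu : d.KU k0 k1 := by
    unfold Tail.Linked at h
    tauto
  refine ⟨hu, ?_⟩
  simp only [Tail.Wf, Tail.KL, Tail.KU] at *
  omega

/-- If the upper component does not reach the preceding column, it lies above it. -/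
theorem Tail.Linked.of_not_KU {d : Tail} {k0 k1 : ℤ} (hk : k0 ≤ k1) (hd : d.Wf)
    (h : d.Linked k0 k1) (hu : ¬ d.KU k0 k1) : d.KL k0 k1 ∧ k1 < d.u0 ∧ d.l0 ≤ k1 := by
  have hl : d.KL k0 k1 := by
    unfold Tail.Linked at h
    tauto
  refine ⟨hl, ?_⟩
  simp only [Tail.Wf, Tail.KL, Tail.KU] at *
  omega

theorem Cond3.label_unique {i j : Label} {k0 k1 : ℤ} {d : Tail} (hk : k0 ≤ k1) (hd : d.Wf)
    (hi : Cond3 i k0 k1 d) (hj : Cond3 j k0 k1 d) : i = j := by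
  have hl := fun h => Tail.Linked.of_not_KL (d := d) (k0 := k0) (k1 := k1) hk hd h
  have hu := fun h => Tail.Linked.of_not_KU (d := d) (k0 := k0) (k1 := k1) hk hd h
  cases i <;> try exact hi.elim
  all_goals cases j <;> first | exact hj.elim | rfl | skip
  all_goals
    exfalso
    simp only [Cond3] at hi hj
    first
    | tauto
    | omega

theorem exists_cond2 {k0 k1 m0 m1 : ℤ} (h : max k0 m0 ≤ min k1 m1) :
    ∃ i, Cond2 i k0 k1 m0 m1 := by
  by_cases h' : m0 ≤ k0 ∧ k0 ≤ m1
  · exact ⟨.beta, h, h'⟩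
  · exact ⟨.gamma, h, h'⟩

theorem exists_cond3 {k0 k1 : ℤ} {d : Tail} (hk : k0 ≤ k1) (hd : d.Wf) (h : d.Linked k0 k1) :
    ∃ i, Cond3 i k0 k1 d := by
  by_cases hl : d.KL k0 k1
  · by_cases hu : d.KU k0 k1
    · by_cases hml : d.ML
      · by_cases hmu : d.MU
        · exact ⟨.theta, h, ⟨hl, hu⟩, hml, hmu⟩
        · by_cases hp : d.m0 ≤ d.l1 ∧ d.l1 ≤ d.m1
          · exact ⟨.kappa, h, ⟨hl, hu⟩, ⟨hml, hmu⟩, hp⟩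
          · exact ⟨.iota, h, ⟨hl, hu⟩, ⟨hml, hmu⟩, hp⟩
      · have hmu : d.MU := by
          unfold Tail.Linked at h
          tauto
        by_cases hp : d.m0 ≤ d.u0 ∧ d.u0 ≤ d.m1
        · exact ⟨.mu, h, ⟨hl, hu⟩, ⟨hmu, hml⟩, hp⟩
        · exact ⟨.lambda, h, ⟨hl, hu⟩, ⟨hmu, hml⟩, hp⟩
    · obtain ⟨-, h1, h2⟩ := h.of_not_KU hk hd hu
      by_cases hp : k1 ≤ d.l1
      · exact ⟨.zeta, h, hu, h2, hp⟩
      · exact ⟨.eta, h, hu, not_le.1 hp, h1⟩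
  · obtain ⟨-, h1, h2⟩ := h.of_not_KL hk hd hl
    by_cases hp : d.u0 ≤ k0
    · exact ⟨.delta, h, hl, hp, h2⟩
    · exact ⟨.epsilon, h, hl, h1, not_le.1 hp⟩

theorem InS.exists_cls {P : Finset Cell} (h : InS P) : ∃ i, Cls i P := by
  rcases h.shape with ⟨c, m0, m1, hm, rfl⟩ | ⟨c, d, hd, hl, hu, rfl⟩ |
    ⟨Q, c, k0, k1, m0, m1, hE, hm, ht, rfl⟩ | ⟨Q, c, k0, k1, d, hE, hd, ht, rfl⟩
  · exact ⟨.alpha, inAlpha_seg hm⟩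
  · exact ⟨.alpha, inAlpha_empty_ext3 hd hl hu⟩
  · obtain ⟨i, hi⟩ := exists_cond2 ht
    exact ⟨i, (cls_ext2_iff hE hm i).2 hi⟩
  · obtain ⟨i, hi⟩ := exists_cond3 hE.le hd ht
    exact ⟨i, (cls_ext3_iff hE hd i).2 hi⟩

theorem Cls.label_unique {i j : Label} {P : Finset Cell} (hi : Cls i P) (hj : Cls j P) :
    i = j := by
  rcases hi.inS.shape with ⟨c, m0, m1, hm, rfl⟩ | ⟨c, d, hd, hl, hu, rfl⟩ |
    ⟨Q, c, k0, k1, m0, m1, hE, hm, -, rfl⟩ | ⟨Q, c, k0, k1, d, hE, hd, -, rfl⟩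
  · rw [((inAlpha_seg hm).cls_iff i).1 hi, ((inAlpha_seg hm).cls_iff j).1 hj]
  · have ha := inAlpha_empty_ext3 (c := c) hd hl hu
    rw [(ha.cls_iff i).1 hi, (ha.cls_iff j).1 hj]
  · rw [cls_ext2_iff hE hm] at hi hj
    exact hi.label_unique hj
  · rw [cls_ext3_iff hE hd] at hi hj
    exact hi.label_unique hE.le hd hj

theorem S_eq_iUnion : S = ⋃ i, Scls i := by
  ext p
  obtain ⟨P, h, rfl⟩ := exists_eq_mk p
  simp only [Set.mem_iUnion, mk_mem_Scls_iff, mk_mem_S_iff]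
  exact ⟨InS.exists_cls, fun ⟨i, hi⟩ => hi.inS⟩

theorem pairwise_disjoint_Scls : Pairwise fun i j => Disjoint (Scls i) (Scls j) := by
  intro i j hij
  rw [Set.disjoint_left]
  intro p hi hj
  obtain ⟨P, h, rfl⟩ := exists_eq_mk p
  rw [mk_mem_Scls_iff] at hi hj
  exact hij (hi.label_unique hj)

theorem endsAt_seg {x a b : ℤ} (h : a ≤ b) : EndsAt (seg x a b) x a b := by
  refine ⟨(inAlpha_seg h).1, ?_, h⟩
  have := (rightCol_empty_seg (c := x) h).lastCol
  rwa [Finset.empty_union] at this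

theorem Scls_nonempty (i : Label) : (Scls i).Nonempty := by
  suffices h : ∃ P, Cls i P by
    obtain ⟨P, h⟩ := h
    exact ⟨Polyomino.mk P h.inS.1.1.1, mk_mem_Scls_iff.2 h⟩
  -- All classes but the first are realized by attaching columns to a segment of three cells,
  -- which is the least height for which a hole can have neighbours on both sides.
  have hE : EndsAt (seg 0 0 2) 0 0 2 := endsAt_seg (by norm_num)
  have h2 : ∀ m : ℤ, m ≤ 2 → Cond2 i 0 2 m 2 → ∃ P, Cls i P := fun m hm hc =>
    ⟨_, (cls_ext2_iff hE hm i).2 hc⟩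
  have h3 : ∀ d : Tail, d.Wf → Cond3 i 0 2 d → ∃ P, Cls i P := fun d hd hc =>
    ⟨_, (cls_ext3_iff hE hd i).2 hc⟩
  cases i
  case alpha => exact ⟨_, inAlpha_seg (c := 0) (le_refl 0)⟩
  case beta => exact h2 0 (by norm_num) (by simp only [Cond2]; norm_num)
  case gamma => exact h2 1 (by norm_num) (by simp only [Cond2]; norm_num)
  case delta => refine h3 ⟨-2, -2, 0, 0, -2, 0⟩ ?_ ?_ <;>
    simp [Cond3, Tail.Wf, Tail.Linked, Tail.KL, Tail.KU, Tail.ML, Tail.MU]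
  case epsilon => refine h3 ⟨-1, -1, 1, 1, -1, 1⟩ ?_ ?_ <;>
    simp [Cond3, Tail.Wf, Tail.Linked, Tail.KL, Tail.KU, Tail.ML, Tail.MU]
  case zeta => refine h3 ⟨2, 2, 4, 4, 2, 4⟩ ?_ ?_ <;>
    simp [Cond3, Tail.Wf, Tail.Linked, Tail.KL, Tail.KU, Tail.ML, Tail.MU]
  case eta => refine h3 ⟨1, 1, 3, 3, 1, 3⟩ ?_ ?_ <;>
    simp [Cond3, Tail.Wf, Tail.Linked, Tail.KL, Tail.KU, Tail.ML, Tail.MU]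
  case theta => refine h3 ⟨0, 0, 2, 2, 0, 2⟩ ?_ ?_ <;>
    simp [Cond3, Tail.Wf, Tail.Linked, Tail.KL, Tail.KU, Tail.ML, Tail.MU]
  case iota => refine h3 ⟨-1, 0, 2, 2, -1, -1⟩ ?_ ?_ <;>
    simp [Cond3, Tail.Wf, Tail.Linked, Tail.KL, Tail.KU, Tail.ML, Tail.MU]
  case kappa => refine h3 ⟨0, 0, 2, 2, 0, 0⟩ ?_ ?_ <;>
    simp [Cond3, Tail.Wf, Tail.Linked, Tail.KL, Tail.KU, Tail.ML, Tail.MU]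
  case lambda => refine h3 ⟨0, 0, 2, 3, 3, 3⟩ ?_ ?_ <;>
    simp [Cond3, Tail.Wf, Tail.Linked, Tail.KL, Tail.KU, Tail.ML, Tail.MU]
  case mu => refine h3 ⟨0, 0, 2, 2, 2, 2⟩ ?_ ?_ <;>
    simp [Cond3, Tail.Wf, Tail.Linked, Tail.KL, Tail.KU, Tail.ML, Tail.MU]

/-! ### Parametrization of the classes -/

/-- The elements of `S` in normal position: the last column is in column `0` and starts at
height `0`. Every element of `S` has exactly one representative of this kind. -/
def Core : Type := {Q : Finset Cell // EndsAt Q 0 0 ((lastHeight Q : ℤ) - 1)}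

/-- The height of the last column. -/
def Core.height (Q : Core) : ℕ := lastHeight Q.1

theorem Core.endsAt (Q : Core) : EndsAt Q.1 0 0 ((Q.height : ℤ) - 1) := Q.2

theorem Core.height_pos (Q : Core) : 1 ≤ Q.height := by
  have := Q.endsAt.le
  omega

/-- The polyomino represented by an element of `S` in normal position. -/
def Core.poly (Q : Core) : Polyomino := Polyomino.mk Q.1 Q.endsAt.conn

/-- The possible last columns to be attached to a last column `[0, n - 1]` to obtain an element of
the class `i`. -/
def Tail2 (i : Label) (n : ℕ) : Type :=
  {m : ℤ × ℤ // m.1 ≤ m.2 ∧ Cond2 i 0 ((n : ℤ) - 1) m.1 m.2}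

/-- The possible last two columns to be attached to a last column `[0, n - 1]` to obtain an
element of the class `i`. -/
def Tail3 (i : Label) (n : ℕ) : Type := {d : Tail // d.Wf ∧ Cond3 i 0 ((n : ℤ) - 1) d}

theorem EndsAt.lastHeight_eq {Q : Finset Cell} {c k0 k1 : ℤ} (h : EndsAt Q c k0 k1) :
    (lastHeight Q : ℤ) = k1 + 1 - k0 := by
  rw [lastHeight, h.lastCol_eq, card_seg, Int.toNat_of_nonneg]
  have := h.le
  omega

theorem EndsAt.exists_core {Q : Finset Cell} {c k0 k1 : ℤ} (h : EndsAt Q c k0 k1) :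
    ∃ R : Core, R.1 = SimplexDuplex.translate (-c, -k0) Q ∧ (R.height : ℤ) - 1 = k1 - k0 := by
  have hE := h.translate (-c, -k0)
  have hh := hE.lastHeight_eq
  simp only [add_neg_cancel] at hE hh
  refine ⟨⟨SimplexDuplex.translate (-c, -k0) Q, ?_⟩, rfl, ?_⟩
  · rw [hh]
    convert hE using 1
    ring
  · change (lastHeight (SimplexDuplex.translate (-c, -k0) Q) : ℤ) - 1 = _
    rw [hh]
    ring

theorem Core.eq_of_translate {Q R : Core} {v : Cell} (h : R.1 = translate v Q.1) :
    v = 0 ∧ R = Q := by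
  have h1 := Q.endsAt.translate v
  rw [← h] at h1
  have h2 := R.endsAt.lastCol_eq.symm.trans h1.lastCol_eq
  obtain ⟨h3, h4, -⟩ := seg_inj R.endsAt.le h2
  have hv : v = 0 := by
    ext
    · simpa using h3.symm
    · simpa using h4.symm
  refine ⟨hv, Subtype.ext ?_⟩
  rw [h, hv, translate_zero]

theorem Core.poly_injective : Function.Injective Core.poly := by
  intro Q R h
  obtain ⟨v, hv⟩ := mk_eq_mk_iff.1 h
  exact (Core.eq_of_translate hv).2.symm

theorem Core.range_poly : Set.range Core.poly = S := by
  ext p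
  obtain ⟨P, h, rfl⟩ := exists_eq_mk p
  rw [mk_mem_S_iff]
  constructor
  · rintro ⟨Q, hQ⟩
    rw [Core.poly] at hQ
    rw [← mk_mem_S_iff (h := h), ← hQ, mk_mem_S_iff]
    exact Q.endsAt.inS
  · intro hP
    obtain ⟨c, k0, k1, hE⟩ := hP.exists_endsAt
    obtain ⟨R, hR, -⟩ := hE.exists_core
    refine ⟨R, (mk_eq_mk_iff.2 ⟨(-c, -k0), hR⟩).symm⟩

theorem ext2_inj {Q Q' : Finset Cell} {c c' m0 m1 m0' m1' : ℤ} (hQ : ∀ u ∈ Q, u.1 ≤ c)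
    (hQ' : ∀ u ∈ Q', u.1 ≤ c') (hm : m0 ≤ m1) (hm' : m0' ≤ m1')
    (e : ext2 Q c m0 m1 = ext2 Q' c' m0' m1') : c = c' ∧ Q = Q' ∧ m0 = m0' ∧ m1 = m1' := by
  have hr := rightCol_ext2 hQ hm
  have hr' := rightCol_ext2 hQ' hm'
  have h1 := hr.lastCol
  have h2 := hr.dropLast
  rw [← ext2, e, ext2] at h1 h2
  obtain ⟨h3, h4, h5⟩ := seg_inj hm (h1.symm.trans hr'.lastCol)
  exact ⟨add_right_cancel h3, h2.symm.trans hr'.dropLast, h4, h5⟩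

theorem ext3_inj {Q Q' : Finset Cell} {c c' : ℤ} {d d' : Tail} (hQ : ∀ u ∈ Q, u.1 ≤ c)
    (hQ' : ∀ u ∈ Q', u.1 ≤ c') (hd : d.Wf) (hd' : d'.Wf)
    (e : ext3 Q c d = ext3 Q' c' d') : c = c' ∧ Q = Q' ∧ d = d' := by
  have hr := rightCol_ext3 hQ hd
  have hr' := rightCol_ext3 hQ' hd'
  have hs := rightCol_duplex hQ hd
  have hs' := rightCol_duplex hQ' hd'
  have h1 := hr.lastCol
  have h2 := hr.dropLast
  rw [← ext3, e, ext3] at h1 h2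
  obtain ⟨h3, h4, h5⟩ := seg_inj hd.2.2.2 (h1.symm.trans hr'.lastCol)
  have h6 := h2.symm.trans hr'.dropLast
  have h7 := hs.lastCol
  have h8 := hs.dropLast
  rw [h6] at h7 h8
  obtain ⟨-, h9, h10, h11, h12⟩ := seg_union_inj hd.1 hd.2.2.1 hd.2.1 hd'.1 hd'.2.2.1 hd'.2.1
    (h7.symm.trans hs'.lastCol)
  exact ⟨add_right_cancel h3, h8.symm.trans hs'.dropLast, Tail.ext h9 h10 h11 h12 h4 h5⟩

theorem Core.cls_ext2 (Q : Core) {i : Label} (m : Tail2 i Q.height) :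
    Cls i (ext2 Q.1 0 m.1.1 m.1.2) :=
  (cls_ext2_iff Q.endsAt m.2.1 i).2 m.2.2

theorem Core.cls_ext3 (Q : Core) {i : Label} (d : Tail3 i Q.height) : Cls i (ext3 Q.1 0 d.1) :=
  (cls_ext3_iff Q.endsAt d.2.1 i).2 d.2.2

/-- Attaching a simplex column. -/
def poly2 (i : Label) (x : Σ Q : Core, Tail2 i Q.height) : Polyomino :=
  Polyomino.mk (ext2 x.1.1 0 x.2.1.1 x.2.1.2) (x.1.cls_ext2 x.2).inS.1.1.1

/-- Attaching a duplex and a simplex column. -/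
def poly3 (i : Label) (x : Σ Q : Core, Tail3 i Q.height) : Polyomino :=
  Polyomino.mk (ext3 x.1.1 0 x.2.1) (x.1.cls_ext3 x.2).inS.1.1.1

theorem translate_le {Q : Finset Cell} {c : ℤ} (h : ∀ u ∈ Q, u.1 ≤ c) (v : Cell) :
    ∀ u ∈ translate v Q, u.1 ≤ c + v.1 := by
  intro u hu
  have := h _ (mem_translate.1 hu)
  rw [Prod.fst_sub] at this
  omega

theorem poly2_injective (i : Label) : Function.Injective (poly2 i) := by
  rintro ⟨Q, m⟩ ⟨R, m'⟩ h
  obtain ⟨v, hv⟩ := mk_eq_mk_iff.1 h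
  simp only at hv
  rw [translate_ext2] at hv
  have hm := m.2.1
  obtain ⟨-, h2, h3, h4⟩ := ext2_inj (fun u hu => R.endsAt.le_of_mem hu)
    (translate_le (fun u hu => Q.endsAt.le_of_mem hu) v) m'.2.1 (by omega) hv
  obtain ⟨rfl, rfl⟩ := Core.eq_of_translate h2
  congr 1
  refine Subtype.ext (Prod.ext ?_ ?_)
  · simpa using h3.symm
  · simpa using h4.symm

theorem poly3_injective (i : Label) : Function.Injective (poly3 i) := by
  rintro ⟨Q, d⟩ ⟨R, d'⟩ h
  obtain ⟨v, hv⟩ := mk_eq_mk_iff.1 h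
  simp only at hv
  rw [translate_ext3] at hv
  obtain ⟨-, h2, h3⟩ := ext3_inj (fun u hu => R.endsAt.le_of_mem hu)
    (translate_le (fun u hu => Q.endsAt.le_of_mem hu) v) d'.2.1 (d.2.1.shift _) hv
  obtain ⟨rfl, rfl⟩ := Core.eq_of_translate h2
  congr 1
  refine Subtype.ext ?_
  rw [h3]
  simp [Tail.shift]

theorem range_poly2_union_range_poly3 {i : Label} (hi : i ≠ .alpha) :
    Set.range (poly2 i) ∪ Set.range (poly3 i) = Scls i := by
  ext p
  constructor
  · rintro (⟨x, rfl⟩ | ⟨x, rfl⟩)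
    · exact mk_mem_Scls_iff.2 (x.1.cls_ext2 x.2)
    · exact mk_mem_Scls_iff.2 (x.1.cls_ext3 x.2)
  · obtain ⟨P, h, rfl⟩ := exists_eq_mk p
    rw [mk_mem_Scls_iff]
    intro hP
    rcases hP.shape hi with ⟨Q, c, k0, k1, m0, m1, hE, hm, hc, rfl⟩ |
      ⟨Q, c, k0, k1, d, hE, hd, hc, rfl⟩
    · obtain ⟨R, hR, hh⟩ := hE.exists_core
      refine Or.inl ⟨⟨R, ⟨(m0 + -k0, m1 + -k0), by simpa using hm, ?_⟩⟩, ?_⟩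
      · rw [hh]
        rw [← cond2_add_iff i _ _ _ _ (-k0)] at hc
        simpa [sub_eq_add_neg] using hc
      · refine (mk_eq_mk_iff.2 ⟨(-c, -k0), ?_⟩).symm
        rw [translate_ext2, hR, show c + (-c, -k0).1 = 0 from add_neg_cancel c]
    · obtain ⟨R, hR, hh⟩ := hE.exists_core
      refine Or.inr ⟨⟨R, ⟨d.shift (-k0), hd.shift _, ?_⟩⟩, ?_⟩
      · rw [hh]
        rw [← cond3_shift_iff i _ _ _ (-k0)] at hc
        simpa [sub_eq_add_neg] using hc
      · refine (mk_eq_mk_iff.2 ⟨(-c, -k0), ?_⟩).symm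
        rw [translate_ext3, hR, show c + (-c, -k0).1 = 0 from add_neg_cancel c]

theorem range_poly2 {i : Label} (hi : i = .beta ∨ i = .gamma) :
    Set.range (poly2 i) = Scls i := by
  rw [← range_poly2_union_range_poly3 (by rintro rfl; simp at hi),
    Set.union_eq_self_of_subset_right]
  rintro _ ⟨x, rfl⟩
  have := x.2.2.2
  rcases hi with rfl | rfl <;> exact this.elim

theorem range_poly3 {i : Label} (h1 : i ≠ .alpha) (h2 : i ≠ .beta) (h3 : i ≠ .gamma) :
    Set.range (poly3 i) = Scls i := by
  rw [← range_poly2_union_range_poly3 h1, Set.union_eq_self_of_subset_left]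
  rintro _ ⟨x, rfl⟩
  have := x.2.2.2
  cases i <;> first | exact this.elim | contradiction

/-- A duplex column followed by a simplex column touching both components, in normal position: the
lower component ends at height `0`. -/
def DuplexStart : Type := {d : Tail // (d.Wf ∧ d.ML ∧ d.MU) ∧ d.l1 = 0}

/-- The elements of `S_α`: a segment of `n + 1` cells, or a duplex and a simplex column. -/
def polyAlpha : ℕ ⊕ DuplexStart → Polyomino
  | .inl n => Polyomino.mk (seg 0 0 n) (conn_seg (Int.natCast_nonneg n))
  | .inr d => Polyomino.mk (ext3 ∅ 0 d.1) ((conn_empty_ext3_iff d.2.1.1).2 d.2.1.2)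

theorem numDuplex_empty : numDuplex ∅ = 0 := by
  classical
  simp [numDuplex]

theorem numDuplex_seg {c m0 m1 : ℤ} (h : m0 ≤ m1) : numDuplex (seg c m0 m1) = 0 := by
  have := (rightCol_empty_seg (c := c) h).numDuplex_of_not_isDuplex (isSimplex_seg h).not_isDuplex
  rwa [Finset.empty_union, numDuplex_empty] at this

theorem numDuplex_ext2 {Q : Finset Cell} {c m0 m1 : ℤ} (hQ : ∀ u ∈ Q, u.1 ≤ c) (hm : m0 ≤ m1) :
    numDuplex (ext2 Q c m0 m1) = numDuplex Q :=
  (rightCol_ext2 hQ hm).numDuplex_of_not_isDuplex (isSimplex_seg hm).not_isDuplex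

theorem numDuplex_ext3 {Q : Finset Cell} {c : ℤ} {d : Tail} (hQ : ∀ u ∈ Q, u.1 ≤ c) (hd : d.Wf) :
    numDuplex (ext3 Q c d) = numDuplex Q + 1 := by
  rw [ext3, (rightCol_ext3 hQ hd).numDuplex_of_not_isDuplex (isSimplex_seg hd.2.2.2).not_isDuplex,
    (rightCol_duplex hQ hd).numDuplex_of_isDuplex (hd.isDuplex _)]

theorem card_ext2 {Q : Finset Cell} {c m0 m1 : ℤ} (hQ : ∀ u ∈ Q, u.1 ≤ c) (hm : m0 ≤ m1) :
    (ext2 Q c m0 m1).card = Q.card + (m1 + 1 - m0).toNat := by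
  rw [ext2, (rightCol_ext2 hQ hm).card, card_seg]

/-- The number of cells of the duplex column. -/
def Tail.duplexArea (d : Tail) : ℕ := (d.l1 + 1 - d.l0).toNat + (d.u1 + 1 - d.u0).toNat

/-- The height of the last column. -/
def Tail.height (d : Tail) : ℕ := (d.m1 + 1 - d.m0).toNat

theorem Tail.Wf.card_duplex {d : Tail} (hd : d.Wf) (c : ℤ) : (d.duplex c).card = d.duplexArea := by
  rw [Tail.duplex, Finset.card_union_of_disjoint, card_seg, card_seg, Tail.duplexArea]
  rw [Finset.disjoint_left]
  intro u hu hu'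
  have := hd.2.1
  rw [mem_seg] at hu hu'
  omega

theorem card_ext3 {Q : Finset Cell} {c : ℤ} {d : Tail} (hQ : ∀ u ∈ Q, u.1 ≤ c) (hd : d.Wf) :
    (ext3 Q c d).card = Q.card + d.duplexArea + d.height := by
  rw [ext3, (rightCol_ext3 hQ hd).card, (rightCol_duplex hQ hd).card, card_seg, hd.card_duplex,
    Tail.height]

theorem lastHeight_ext2 {Q : Finset Cell} {c m0 m1 : ℤ} (hQ : ∀ u ∈ Q, u.1 ≤ c) (hm : m0 ≤ m1) :
    lastHeight (ext2 Q c m0 m1) = (m1 + 1 - m0).toNat := by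
  rw [lastHeight, ext2, (rightCol_ext2 hQ hm).lastCol, card_seg]

theorem lastHeight_ext3 {Q : Finset Cell} {c : ℤ} {d : Tail} (hQ : ∀ u ∈ Q, u.1 ≤ c) (hd : d.Wf) :
    lastHeight (ext3 Q c d) = d.height := by
  rw [lastHeight, ext3, (rightCol_ext3 hQ hd).lastCol, card_seg, Tail.height]

theorem empty_le (c : ℤ) : ∀ u ∈ (∅ : Finset Cell), u.1 ≤ c :=
  fun u hu => absurd hu (Finset.notMem_empty u)

theorem translate_empty (v : Cell) : translate v ∅ = ∅ := Finset.map_empty _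

theorem polyAlpha_injective : Function.Injective polyAlpha := by
  have hmix : ∀ (n : ℕ) (d : DuplexStart), polyAlpha (.inl n) ≠ polyAlpha (.inr d) := by
    intro n d h
    obtain ⟨v, hv⟩ := mk_eq_mk_iff.1 h
    have h1 := numDuplex_ext3 (empty_le 0) d.2.1.1
    rw [hv, numDuplex_translate, numDuplex_seg (Int.natCast_nonneg n)] at h1
    omega
  rintro (n | d) (n' | d') h
  · obtain ⟨v, hv⟩ := mk_eq_mk_iff.1 h
    rw [translate_seg] at hv
    obtain ⟨-, h1, h2⟩ := seg_inj (Int.natCast_nonneg _) hv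
    exact congrArg _ (by omega)
  · exact absurd h (hmix n d')
  · exact absurd h.symm (hmix n' d)
  · obtain ⟨v, hv⟩ := mk_eq_mk_iff.1 h
    rw [translate_ext3, translate_empty] at hv
    obtain ⟨-, -, h2⟩ := ext3_inj (empty_le _) (empty_le _) d'.2.1.1 (d.2.1.1.shift _) hv
    have h3 := congrArg Tail.l1 h2
    have h4 := d.2.2
    have h5 := d'.2.2
    simp only [Tail.shift] at h3
    have h6 : v.2 = 0 := by omega
    refine congrArg _ (Subtype.ext ?_)
    rw [h2, h6]
    simp [Tail.shift]

theorem range_polyAlpha : Set.range polyAlpha = Scls .alpha := by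
  ext p
  constructor
  · rintro ⟨n | d, rfl⟩
    · exact mk_mem_Scls_iff.2 (inAlpha_seg (Int.natCast_nonneg n))
    · exact mk_mem_Scls_iff.2 (inAlpha_empty_ext3 d.2.1.1 d.2.1.2.1 d.2.1.2.2)
  · obtain ⟨P, h, rfl⟩ := exists_eq_mk p
    rw [mk_mem_Scls_iff]
    intro hP
    rcases InAlpha.shape hP with ⟨c, m0, m1, hm, rfl⟩ | ⟨c, d, hd, hl, hu, rfl⟩
    · refine ⟨.inl (m1 - m0).toNat, (mk_eq_mk_iff.2 ⟨(-c, -m0), ?_⟩).symm⟩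
      rw [translate_seg]
      congr 1 <;> simp only <;> omega
    · refine ⟨.inr ⟨d.shift (-d.l1), ⟨hd.shift _, (Tail.ML_shift _).2 hl, (Tail.MU_shift _).2 hu⟩,
        add_neg_cancel _⟩, (mk_eq_mk_iff.2 ⟨(-c, -d.l1), ?_⟩).symm⟩
      rw [translate_ext3, translate_empty, add_neg_cancel]

/-! ### Sums of power series -/

open scoped PowerSeries.WithPiTopology

/-- The coefficients are discrete, so that a family of power series is summable when each power of
`q` occurs in finitely many of its members only. -/
instance coeffTopology : TopologicalSpace (Polynomial (Polynomial ℚ)) := ⊥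

instance : DiscreteTopology (Polynomial (Polynomial ℚ)) := ⟨rfl⟩

theorem hasSum_ser_iff {ι : Type*} {f : ι → Ser} {F : Ser} :
    HasSum f F ↔ ∀ n, HasSum (fun i => PowerSeries.coeff n (f i)) (PowerSeries.coeff n F) :=
  PowerSeries.WithPiTopology.hasSum_iff_hasSum_coeff _

theorem finite_coeff_ne_zero_of_hasSum {ι : Type*} {f : ι → Ser} {F : Ser} (h : HasSum f F)
    (n : ℕ) : {i | PowerSeries.coeff n (f i) ≠ 0}.Finite :=
  (hasSum_ser_iff.1 h n).summable.hasFiniteSupport_of_discreteTopology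

theorem summable_of_finite_coeff_ne_zero {ι : Type*} {f : ι → Ser}
    (h : ∀ n, {i | PowerSeries.coeff n (f i) ≠ 0}.Finite) : Summable f := by
  refine (PowerSeries.WithPiTopology.summable_iff_summable_coeff _).2 fun n => ?_
  exact summable_of_hasFiniteSupport (h n)

/-- The Cauchy product of two summable families of power series is summable. -/
theorem hasSum_mul {ι κ : Type*} {f : ι → Ser} {g : κ → Ser} {F G : Ser} (hf : HasSum f F)
    (hg : HasSum g G) : HasSum (fun x : ι × κ => f x.1 * g x.2) (F * G) := by
  refine hf.mul hg (summable_of_finite_coeff_ne_zero fun n => ?_)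
  refine ((Finset.HasAntidiagonal.antidiagonal n).finite_toSet.biUnion fun a _ =>
    (finite_coeff_ne_zero_of_hasSum hf a.1).prod (finite_coeff_ne_zero_of_hasSum hg a.2)).subset ?_
  rintro ⟨i, j⟩ hij
  rw [Set.mem_ofPred_eq, PowerSeries.coeff_mul] at hij
  obtain ⟨a, ha, hne⟩ := Finset.exists_ne_zero_of_sum_ne_zero hij
  exact Set.mem_biUnion ha ⟨left_ne_zero_of_mul hne, right_ne_zero_of_mul hne⟩

theorem hasSum_geometric_ser {F : Ser} (hF : PowerSeries.constantCoeff F = 0) :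
    HasSum (fun n : ℕ => F ^ n) (Ring.inverse (1 - F)) := by
  have h1 := PowerSeries.WithPiTopology.summable_pow_of_constantCoeff_eq_zero hF
  have h2 := PowerSeries.WithPiTopology.one_sub_mul_tsum_pow_of_constantCoeff_eq_zero hF
  have h3 : IsUnit (1 - F) := by
    rw [PowerSeries.isUnit_iff_constantCoeff, map_sub, hF]
    simp
  have h4 : Ring.inverse (1 - F) = ∑' n : ℕ, F ^ n := by
    calc Ring.inverse (1 - F) = Ring.inverse (1 - F) * ((1 - F) * ∑' n : ℕ, F ^ n) := by
          rw [h2, mul_one]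
      _ = ∑' n : ℕ, F ^ n := by rw [← mul_assoc, Ring.inverse_mul_cancel _ h3, one_mul]
  rw [h4]
  exact h1.hasSum

theorem hasSum_q : HasSum (fun n : ℕ => q ^ n) (Ring.inverse (1 - q)) :=
  hasSum_geometric_ser (by simp [q])

theorem hasSum_qt : HasSum (fun n : ℕ => (q * t) ^ n) (Ring.inverse (1 - q * t)) :=
  hasSum_geometric_ser (by simp [q])

/-! ### Generating functions as sums -/

/-- The term of the generating functions that belongs to a polyomino. -/
def weight (p : Polyomino) : Ser := q ^ p.area * t ^ p.lastHeight * w ^ p.numDuplex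

theorem q_pow_mul_t_pow_mul_w_pow (n k d : ℕ) : q ^ n * t ^ k * w ^ d =
    PowerSeries.monomial n (Polynomial.monomial k (Polynomial.X ^ d)) := by
  rw [q, t, w, PowerSeries.X_pow_eq, ← map_pow, ← map_pow, ← map_pow,
    ← PowerSeries.monomial_zero_eq_C_apply, ← PowerSeries.monomial_zero_eq_C_apply,
    PowerSeries.monomial_mul_monomial, PowerSeries.monomial_mul_monomial,
    ← Polynomial.C_mul_X_pow_eq_monomial, one_mul, mul_comm (Polynomial.X ^ k)]
  rfl

theorem weight_eq_monomial (p : Polyomino) : weight p =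
    PowerSeries.monomial p.area (Polynomial.monomial p.lastHeight (Polynomial.X ^ p.numDuplex)) :=
  q_pow_mul_t_pow_mul_w_pow _ _ _

theorem coeff_weight (n : ℕ) (p : Polyomino) : PowerSeries.coeff n (weight p) =
    if n = p.area then Polynomial.monomial p.lastHeight (Polynomial.X ^ p.numDuplex) else 0 := by
  rw [weight_eq_monomial, PowerSeries.coeff_monomial]

theorem hasSum_genFun (C : Set Polyomino) : HasSum (C.indicator weight) (genFun C) := by
  classical
  refine hasSum_ser_iff.2 fun n => ?_
  have hfin : {p : Polyomino | p ∈ C ∧ p.area = n}.Finite := (finite_area n).subset fun p hp => hp.2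
  have hval : PowerSeries.coeff n (genFun C) =
      ∑ p ∈ hfin.toFinset, PowerSeries.coeff n (C.indicator weight p) := by
    rw [genFun, PowerSeries.coeff_mk, finsum_mem_eq_finite_toFinset_sum _ hfin]
    refine Finset.sum_congr rfl fun p hp => ?_
    obtain ⟨h1, h2⟩ := hfin.mem_toFinset.1 hp
    rw [Set.indicator_of_mem h1, coeff_weight, if_pos h2.symm, mul_comm,
      Polynomial.C_mul_X_pow_eq_monomial]
  rw [hval]
  refine hasSum_sum_of_ne_finset_zero fun p hp => ?_
  by_cases hC : p ∈ C
  · rw [Set.indicator_of_mem hC, coeff_weight, if_neg]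
    exact fun h => hp (hfin.mem_toFinset.2 ⟨hC, h.symm⟩)
  · rw [Set.indicator_of_notMem hC, map_zero]

/-- A parametrization of a set of polyominoes turns its generating function into a sum over the
parameters. -/
theorem hasSum_genFun_of_range {ι : Type*} {e : ι → Polyomino} (he : Function.Injective e)
    {C : Set Polyomino} (hC : Set.range e = C) : HasSum (fun x => weight (e x)) (genFun C) := by
  subst hC
  rw [← Function.comp_def, ← he.hasSum_range_iff]
  exact hasSum_subtype_iff_indicator.2 (hasSum_genFun _)

theorem A_eq_sum (f : Fin 12 → Label) (hf : Function.Bijective f) : A = ∑ j, Acls (f j) := by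
  have h1 : HasSum (fun p => ∑ j, (Scls (f j)).indicator weight p) (∑ j, Acls (f j)) :=
    hasSum_sum fun j _ => hasSum_genFun _
  refine (hasSum_genFun S).unique ?_
  convert h1 using 2 with p
  by_cases hp : p ∈ S
  · rw [Set.indicator_of_mem hp]
    rw [S_eq_iUnion, Set.mem_iUnion] at hp
    obtain ⟨i, hi⟩ := hp
    obtain ⟨j, rfl⟩ := hf.2 i
    rw [Finset.sum_eq_single j, Set.indicator_of_mem hi]
    · intro k _ hk
      refine Set.indicator_of_notMem (fun hk' => ?_) _
      exact Set.disjoint_left.1 (pairwise_disjoint_Scls fun e => hk (hf.1 e)) hk' hi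
    · exact fun h => absurd (Finset.mem_univ j) h
  · rw [Set.indicator_of_notMem hp, Finset.sum_eq_zero]
    refine fun j _ => Set.indicator_of_notMem (fun hj => hp ?_) _
    rw [S_eq_iUnion]
    exact Set.mem_iUnion.2 ⟨_, hj⟩

theorem A_eq : A = Acls .alpha + Acls .beta + Acls .gamma + Acls .delta + Acls .epsilon +
    Acls .zeta + Acls .eta + Acls .theta + Acls .iota + Acls .kappa + Acls .lambda + Acls .mu := by
  have := A_eq_sum ![.alpha, .beta, .gamma, .delta, .epsilon, .zeta, .eta, .theta, .iota, .kappa,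
    .lambda, .mu] ⟨by
      intro i j h
      fin_cases i <;> fin_cases j <;> first | rfl | (simp at h), by
      rintro (_ | _ | _ | _ | _ | _ | _ | _ | _ | _ | _ | _)
      exacts [⟨0, rfl⟩, ⟨1, rfl⟩, ⟨2, rfl⟩, ⟨3, rfl⟩, ⟨4, rfl⟩, ⟨5, rfl⟩, ⟨6, rfl⟩, ⟨7, rfl⟩,
        ⟨8, rfl⟩, ⟨9, rfl⟩, ⟨10, rfl⟩, ⟨11, rfl⟩]⟩
  rw [this]
  simp only [Fin.sum_univ_succ, Fin.sum_univ_zero]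
  simp [add_assoc]

/-! ### The specializations of `A` as sums over normal forms -/

/-- The contribution of all columns of an element of `S` to area and number of duplex columns. -/
def Core.base (Q : Core) : Ser := q ^ Q.1.card * w ^ numDuplex Q.1

theorem Core.weight_poly (Q : Core) : weight Q.poly =
    PowerSeries.monomial Q.1.card (Polynomial.monomial Q.height (Polynomial.X ^ numDuplex Q.1)) :=
  weight_eq_monomial _

theorem Core.base_eq (Q : Core) : Q.base =
    PowerSeries.monomial Q.1.card (Polynomial.C (Polynomial.X ^ numDuplex Q.1)) := by
  have := q_pow_mul_t_pow_mul_w_pow Q.1.card 0 (numDuplex Q.1)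
  rwa [pow_zero, mul_one] at this

theorem Core.hasSum_weight : HasSum (fun Q : Core => weight Q.poly) A :=
  hasSum_genFun_of_range Core.poly_injective Core.range_poly

/-- Additive maps of the coefficients may be applied termwise. -/
theorem hasSum_map_coeff {ι : Type*} {f g : ι → Ser} {F G : Ser} (h : HasSum f F)
    (φ : Polynomial (Polynomial ℚ) →+ Polynomial (Polynomial ℚ))
    (hg : ∀ i n, PowerSeries.coeff n (g i) = φ (PowerSeries.coeff n (f i)))
    (hG : ∀ n, PowerSeries.coeff n G = φ (PowerSeries.coeff n F)) : HasSum g G := by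
  refine hasSum_ser_iff.2 fun n => ?_
  have := (hasSum_ser_iff.1 h n).map φ continuous_of_discreteTopology
  rw [hG]
  convert this using 2 with i
  exact hg i n

theorem coeff_monomial_map (φ : Polynomial (Polynomial ℚ) →+ Polynomial (Polynomial ℚ)) (m n : ℕ)
    (a : Polynomial (Polynomial ℚ)) : PowerSeries.coeff n (PowerSeries.monomial m (φ a)) =
      φ (PowerSeries.coeff n (PowerSeries.monomial m a)) := by
  rw [PowerSeries.coeff_monomial, PowerSeries.coeff_monomial]
  split_ifs
  · rfl
  · rw [map_zero]

theorem Core.hasSum_of_map {G : Ser} {g : Core → Ser}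
    (φ : Polynomial (Polynomial ℚ) →+ Polynomial (Polynomial ℚ))
    (hG : ∀ n, PowerSeries.coeff n G = φ (PowerSeries.coeff n A))
    (hg : ∀ Q : Core, g Q = PowerSeries.monomial Q.1.card
      (φ (Polynomial.monomial Q.height (Polynomial.X ^ numDuplex Q.1)))) :
    HasSum g G := by
  refine hasSum_map_coeff Core.hasSum_weight φ (fun Q n => ?_) hG
  rw [hg, Q.weight_poly, coeff_monomial_map]

/-- `t ↦ 1`, on coefficients. -/
def evalOne : Polynomial (Polynomial ℚ) →+ Polynomial (Polynomial ℚ) :=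
  (Polynomial.C.comp (Polynomial.evalRingHom 1)).toAddMonoidHom

theorem evalOne_apply (p : Polynomial (Polynomial ℚ)) : evalOne p = Polynomial.C (p.eval 1) := rfl

theorem Core.hasSum_A₁ : HasSum Core.base (lift A₁) := by
  refine Core.hasSum_of_map evalOne (fun n => ?_) fun Q => ?_
  · rw [lift, A₁, atOne, PowerSeries.coeff_map, PowerSeries.coeff_map]
    rfl
  · rw [Q.base_eq, evalOne_apply, Polynomial.eval_monomial, one_pow, mul_one]

/-- `p ↦ ∂(p / t)/∂t`, on coefficients. -/
def derivDiv : Polynomial (Polynomial ℚ) →+ Polynomial (Polynomial ℚ) :=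
  Polynomial.derivative.toAddMonoidHom.comp Polynomial.divX_hom

theorem divX_monomial_succ (n : ℕ) (a : Polynomial ℚ) :
    Polynomial.divX (Polynomial.monomial (n + 1) a) = Polynomial.monomial n a := by
  ext1 k
  rw [Polynomial.coeff_divX, Polynomial.coeff_monomial, Polynomial.coeff_monomial]
  simp

theorem derivDiv_monomial_succ (n : ℕ) (a : Polynomial ℚ) :
    derivDiv (Polynomial.monomial (n + 1) a) = Polynomial.monomial (n - 1) (a * n) := by
  change Polynomial.derivative (Polynomial.divX _) = _
  rw [divX_monomial_succ, Polynomial.derivative_monomial]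

theorem monomial_C_mul (n : ℕ) (a : Polynomial ℚ) (k : ℕ) :
    PowerSeries.monomial n (Polynomial.C (a * k)) =
      PowerSeries.monomial n (Polynomial.C a) * (k : Ser) := by
  rw [map_mul, Polynomial.C_eq_natCast, ← nsmul_eq_mul', ← nsmul_eq_mul', map_nsmul]

theorem Core.hasSum_B₁ :
    HasSum (fun Q : Core => Q.base * ((Q.height - 1 : ℕ) : Ser)) (lift B₁) := by
  refine Core.hasSum_of_map (evalOne.comp derivDiv) (fun n => ?_) fun Q => ?_
  · rw [lift, B₁, atOne, PowerSeries.coeff_map, PowerSeries.coeff_map, derivT, PowerSeries.coeff_mk,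
      divT, PowerSeries.coeff_mk]
    rfl
  · obtain ⟨n, hn⟩ := Nat.exists_eq_add_of_le' Q.height_pos
    rw [Q.base_eq, AddMonoidHom.comp_apply, evalOne_apply, hn, derivDiv_monomial_succ,
      Polynomial.eval_monomial, one_pow, mul_one, monomial_C_mul, Nat.add_sub_cancel]

theorem Core.hasSum_C₁ :
    HasSum (fun Q : Core => Q.base * ((Q.height - 1).choose 2 : Ser)) (lift C₁) := by
  refine Core.hasSum_of_map (((1 / 2 : ℚ) • evalOne).comp
    (Polynomial.derivative.toAddMonoidHom.comp derivDiv)) (fun n => ?_) fun Q => ?_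
  · rw [lift, C₁, atOne, PowerSeries.coeff_map, PowerSeries.coeff_smul, PowerSeries.coeff_map,
      derivT, derivT, PowerSeries.coeff_mk, PowerSeries.coeff_mk, divT, PowerSeries.coeff_mk,
      ← Polynomial.smul_C]
    rfl
  · obtain ⟨n, hn⟩ := Nat.exists_eq_add_of_le' Q.height_pos
    have hc : ((n.choose 2 : ℕ) : Polynomial ℚ) =
        (1 / 2 : ℚ) • ((n : Polynomial ℚ) * ((n - 1 : ℕ) : Polynomial ℚ)) := by
      have h2 : n * (n - 1) = 2 * n.choose 2 := by
        rw [Nat.choose_two_right, Nat.mul_div_cancel' (Nat.even_mul_pred_self n).two_dvd]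
      rw [← Nat.cast_mul, h2, Nat.cast_mul, Polynomial.smul_eq_C_mul, ← mul_assoc,
        ← Polynomial.C_eq_natCast 2, ← Polynomial.C_mul]
      norm_num
    rw [Q.base_eq, hn, AddMonoidHom.comp_apply, AddMonoidHom.comp_apply, derivDiv_monomial_succ]
    change _ = PowerSeries.monomial _ ((1 / 2 : ℚ) • evalOne (Polynomial.derivative _))
    rw [Polynomial.derivative_monomial, evalOne_apply, Polynomial.eval_monomial, one_pow, mul_one,
      Polynomial.smul_C, mul_assoc, ← mul_smul_comm, ← hc, monomial_C_mul, Nat.add_sub_cancel]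

theorem Core.hasSum_substQT :
    HasSum (fun Q : Core => Q.base * (q * t) ^ Q.height) (substQT A) := by
  have h : ∀ Q : Core, Q.base * (q * t) ^ Q.height = substQT (weight Q.poly) := by
    intro Q
    rw [Q.weight_poly, substQT_monomial, ← q_pow_mul_t_pow_mul_w_pow, Core.base, pow_add]
    ring
  refine hasSum_ser_iff.2 fun N => ?_
  simp only [h]
  simp only [substQT, PowerSeries.coeff_mk]
  refine hasSum_sum fun k _ => ?_
  exact (hasSum_ser_iff.1 Core.hasSum_weight (N - k)).map
    ((Polynomial.monomial k).toAddMonoidHom.comp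
      (Polynomial.lcoeff (Polynomial ℚ) k).toAddMonoidHom)
    continuous_of_discreteTopology

/-! ### Reduction to sums over the attached columns -/

theorem weight_poly2 {i : Label} (x : Σ Q : Core, Tail2 i Q.height) : weight (poly2 i x) =
    x.1.base * (q * t) ^ (x.2.1.2 + 1 - x.2.1.1).toNat := by
  obtain ⟨Q, m⟩ := x
  have hQ := fun u hu => Q.endsAt.le_of_mem (u := u) hu
  change q ^ (ext2 Q.1 0 m.1.1 m.1.2).card * t ^ lastHeight (ext2 Q.1 0 m.1.1 m.1.2) *
    w ^ numDuplex (ext2 Q.1 0 m.1.1 m.1.2) = _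
  rw [card_ext2 hQ m.2.1, lastHeight_ext2 hQ m.2.1, numDuplex_ext2 hQ m.2.1, Core.base]
  ring

/-- The factor contributed by the last two columns, without the power of `w`. -/
def Tail.weight (d : Tail) : Ser := q ^ d.duplexArea * (q * t) ^ d.height

theorem weight_poly3 {i : Label} (x : Σ Q : Core, Tail3 i Q.height) : weight (poly3 i x) =
    x.1.base * (w * x.2.1.weight) := by
  obtain ⟨Q, d⟩ := x
  have hQ := fun u hu => Q.endsAt.le_of_mem (u := u) hu
  change q ^ (ext3 Q.1 0 d.1).card * t ^ lastHeight (ext3 Q.1 0 d.1) *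
    w ^ numDuplex (ext3 Q.1 0 d.1) = _
  rw [card_ext3 hQ d.2.1, lastHeight_ext3 hQ d.2.1, numDuplex_ext3 hQ d.2.1, Core.base, Tail.weight]
  ring

/-- A sum over `S` in which the term of each polyomino is multiplied by a function of the height of
the last column, for the functions that occur. -/
theorem Core.hasSum_combination (a b c e : Ser) : HasSum (fun Q : Core => Q.base *
    (a + b * ((Q.height - 1 : ℕ) : Ser) + c * ((Q.height - 1).choose 2 : Ser) +
      e * (q * t) ^ Q.height)) (a * lift A₁ + b * lift B₁ + c * lift C₁ + e * substQT A) := by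
  have := (((Core.hasSum_A₁.mul_left a).add (Core.hasSum_B₁.mul_left b)).add
    (Core.hasSum_C₁.mul_left c)).add (Core.hasSum_substQT.mul_left e)
  exact this.congr_fun fun Q => by ring

theorem Acls_eq_of_hasSum_tail2 {i : Label} (hi : i = .beta ∨ i = .gamma) {a b c e : Ser}
    (h : ∀ n : ℕ, 1 ≤ n → HasSum (fun m : Tail2 i n => (q * t) ^ (m.1.2 + 1 - m.1.1).toNat)
      (a + b * ((n - 1 : ℕ) : Ser) + c * ((n - 1).choose 2 : Ser) + e * (q * t) ^ n)) :
    Acls i = a * lift A₁ + b * lift B₁ + c * lift C₁ + e * substQT A := by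
  have h1 := hasSum_genFun_of_range (poly2_injective i) (range_poly2 hi)
  simp only [weight_poly2] at h1
  exact (h1.sigma fun Q => (h Q.height Q.height_pos).mul_left Q.base).unique
    (Core.hasSum_combination a b c e)

theorem Acls_eq_of_hasSum_tail3 {i : Label} (h1 : i ≠ .alpha) (h2 : i ≠ .beta) (h3 : i ≠ .gamma)
    {a b c e : Ser} (h : ∀ n : ℕ, 1 ≤ n → HasSum (fun d : Tail3 i n => d.1.weight)
      (a + b * ((n - 1 : ℕ) : Ser) + c * ((n - 1).choose 2 : Ser) + e * (q * t) ^ n)) :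
    Acls i = w * (a * lift A₁ + b * lift B₁ + c * lift C₁ + e * substQT A) := by
  have h1 := hasSum_genFun_of_range (poly3_injective i) (range_poly3 h1 h2 h3)
  simp only [weight_poly3] at h1
  refine (h1.sigma fun Q => ((h Q.height Q.height_pos).mul_left w).mul_left Q.base).unique ?_
  exact ((Core.hasSum_combination a b c e).mul_left w).congr_fun fun Q => by ring

/-! ### Sums over the attached columns -/

theorem Tail.linked_and_not_KL_iff {d : Tail} {k0 k1 : ℤ} :
    d.Linked k0 k1 ∧ ¬ d.KL k0 k1 ↔ ¬ d.KL k0 k1 ∧ d.KU k0 k1 ∧ d.ML ∧ d.MU := by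
  unfold Tail.Linked
  tauto

theorem cond3_delta_iff {n : ℕ} (hn : 1 ≤ n) {d : Tail} :
    d.Wf ∧ Cond3 .delta 0 ((n : ℤ) - 1) d ↔ d.l0 ≤ d.l1 ∧ d.l1 + 1 < d.u0 ∧ d.u0 ≤ 0 ∧ 0 ≤ d.u1 ∧
      d.m0 ≤ d.l1 ∧ d.u0 ≤ d.m1 := by
  rw [Cond3, ← and_assoc (a := d.Linked _ _), Tail.linked_and_not_KL_iff]
  simp only [Tail.Wf, Tail.KL, Tail.KU, Tail.ML, Tail.MU]
  omega

theorem cond3_epsilon_iff {n : ℕ} {d : Tail} :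
    d.Wf ∧ Cond3 .epsilon 0 ((n : ℤ) - 1) d ↔ d.l0 ≤ d.l1 ∧ d.l1 < 0 ∧ 0 < d.u0 ∧ d.u0 ≤ d.u1 ∧
      d.u0 < n ∧ d.m0 ≤ d.l1 ∧ d.u0 ≤ d.m1 := by
  rw [Cond3, ← and_assoc (a := d.Linked _ _), Tail.linked_and_not_KL_iff]
  simp only [Tail.Wf, Tail.KL, Tail.KU, Tail.ML, Tail.MU]
  omega

theorem cond3_theta_iff {n : ℕ} {d : Tail} :
    d.Wf ∧ Cond3 .theta 0 ((n : ℤ) - 1) d ↔ d.l0 ≤ d.l1 ∧ 0 ≤ d.l1 ∧ d.l1 + 1 < d.u0 ∧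
      d.u0 < n ∧ d.u0 ≤ d.u1 ∧ d.m0 ≤ d.l1 ∧ d.u0 ≤ d.m1 := by
  have : ∀ k0 k1, Cond3 .theta k0 k1 d ↔ (d.KL k0 k1 ∧ d.KU k0 k1) ∧ d.ML ∧ d.MU := by
    intro k0 k1
    simp only [Cond3, Tail.Linked]
    tauto
  rw [this]
  simp only [Tail.Wf, Tail.KL, Tail.KU, Tail.ML, Tail.MU]
  omega

theorem cond3_iota_iff {n : ℕ} {d : Tail} :
    d.Wf ∧ Cond3 .iota 0 ((n : ℤ) - 1) d ↔ d.l0 ≤ d.m1 ∧ 0 ≤ d.l1 ∧ d.l1 + 1 < d.u0 ∧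
      d.u0 < n ∧ d.u0 ≤ d.u1 ∧ d.m0 ≤ d.m1 ∧ d.m1 < d.l1 := by
  have : ∀ k0 k1, Cond3 .iota k0 k1 d ↔ (d.KL k0 k1 ∧ d.KU k0 k1) ∧ (d.ML ∧ ¬ d.MU) ∧
      ¬ (d.m0 ≤ d.l1 ∧ d.l1 ≤ d.m1) := by
    intro k0 k1
    simp only [Cond3, Tail.Linked]
    tauto
  rw [this]
  simp only [Tail.Wf, Tail.KL, Tail.KU, Tail.ML, Tail.MU]
  omega

theorem cond3_kappa_iff {n : ℕ} {d : Tail} :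
    d.Wf ∧ Cond3 .kappa 0 ((n : ℤ) - 1) d ↔ d.l0 ≤ d.l1 ∧ 0 ≤ d.l1 ∧ d.l1 + 1 < d.u0 ∧
      d.u0 < n ∧ d.u0 ≤ d.u1 ∧ d.m0 ≤ d.l1 ∧ d.l1 ≤ d.m1 ∧ d.m1 < d.u0 := by
  have : ∀ k0 k1, Cond3 .kappa k0 k1 d ↔ (d.KL k0 k1 ∧ d.KU k0 k1) ∧ (d.ML ∧ ¬ d.MU) ∧
      d.m0 ≤ d.l1 ∧ d.l1 ≤ d.m1 := by
    intro k0 k1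
    simp only [Cond3, Tail.Linked]
    tauto
  rw [this]
  simp only [Tail.Wf, Tail.KL, Tail.KU, Tail.ML, Tail.MU]
  omega

/-- A parametrization of the possible last two columns turns the sum over them into a sum over the
parameters. -/
theorem hasSum_tail3 {i : Label} {n : ℕ} {ι : Type*} (e : ι → Tail) (he : Function.Injective e)
    (hr : ∀ d : Tail, d.Wf ∧ Cond3 i 0 ((n : ℤ) - 1) d ↔ ∃ a, e a = d) {F : Ser}
    (h : HasSum (fun a => (e a).weight) F) : HasSum (fun d : Tail3 i n => d.1.weight) F := by
  have hb : Function.Bijective fun a => (⟨e a, (hr _).2 ⟨a, rfl⟩⟩ : Tail3 i n) := by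
    refine ⟨fun a b hab => he (congrArg Subtype.val hab), fun d => ?_⟩
    obtain ⟨a, ha⟩ := (hr d.1).1 d.2
    exact ⟨a, Subtype.ext ha⟩
  exact (Equiv.hasSum_iff (Equiv.ofBijective _ hb)).1 h

/-- The upside-down image of a tail attached to a column `[0, n - 1]`. -/
def Tail.flip (d : Tail) (n : ℕ) : Tail :=
  ⟨n - 1 - d.u1, n - 1 - d.u0, n - 1 - d.l1, n - 1 - d.l0, n - 1 - d.m1, n - 1 - d.m0⟩

theorem Tail.flip_flip (d : Tail) (n : ℕ) : (d.flip n).flip n = d := by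
  simp [Tail.flip]

theorem Tail.weight_flip (d : Tail) (n : ℕ) : (d.flip n).weight = d.weight := by
  have h1 : (d.flip n).duplexArea = d.duplexArea := by
    simp only [Tail.flip, Tail.duplexArea]
    omega
  have h2 : (d.flip n).height = d.height := by
    simp only [Tail.flip, Tail.height]
    omega
  rw [Tail.weight, Tail.weight, h1, h2]

theorem Tail.wf_flip {d : Tail} {n : ℕ} : (d.flip n).Wf ↔ d.Wf := by
  simp only [Tail.flip, Tail.Wf]
  omega

theorem Tail.KL_flip {d : Tail} {n : ℕ} : (d.flip n).KL 0 (n - 1) ↔ d.KU 0 (n - 1) := by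
  simp only [Tail.flip, Tail.KL, Tail.KU]
  omega

theorem Tail.KU_flip {d : Tail} {n : ℕ} : (d.flip n).KU 0 (n - 1) ↔ d.KL 0 (n - 1) := by
  simp only [Tail.flip, Tail.KL, Tail.KU]
  omega

theorem Tail.ML_flip {d : Tail} {n : ℕ} : (d.flip n).ML ↔ d.MU := by
  simp only [Tail.flip, Tail.ML, Tail.MU]
  omega

theorem Tail.MU_flip {d : Tail} {n : ℕ} : (d.flip n).MU ↔ d.ML := by
  simp only [Tail.flip, Tail.ML, Tail.MU]
  omega

theorem Tail.linked_flip {d : Tail} {n : ℕ} :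
    (d.flip n).Linked 0 (n - 1) ↔ d.Linked 0 (n - 1) := by
  simp only [Tail.Linked, Tail.KL_flip, Tail.KU_flip, Tail.ML_flip, Tail.MU_flip]
  tauto

theorem cond3_flip {i j : Label} (h : (i, j) = (.delta, .zeta) ∨ (i, j) = (.epsilon, .eta) ∨
    (i, j) = (.iota, .lambda) ∨ (i, j) = (.kappa, .mu)) (n : ℕ) (d : Tail) :
    Cond3 j 0 ((n : ℤ) - 1) (d.flip n) ↔ Cond3 i 0 ((n : ℤ) - 1) d := by
  simp only [Prod.mk.injEq] at h
  rcases h with ⟨rfl, rfl⟩ | ⟨rfl, rfl⟩ | ⟨rfl, rfl⟩ | ⟨rfl, rfl⟩ <;>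
  · simp only [Cond3, Tail.linked_flip, Tail.KL_flip, Tail.KU_flip, Tail.ML_flip, Tail.MU_flip]
    refine and_congr_right fun _ => and_congr (by first | exact and_comm | exact Iff.rfl) ?_
    try refine and_congr_right fun _ => ?_
    simp only [Tail.flip]
    omega

/-- Turning upside down interchanges the classes defined by interchanging lower and upper. -/
theorem hasSum_tail3_flip {i j : Label} (h : (i, j) = (.delta, .zeta) ∨ (i, j) = (.epsilon, .eta) ∨
    (i, j) = (.iota, .lambda) ∨ (i, j) = (.kappa, .mu)) {n : ℕ} {F : Ser}
    (hF : HasSum (fun d : Tail3 i n => d.1.weight) F) :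
    HasSum (fun d : Tail3 j n => d.1.weight) F := by
  let e : Tail3 j n ≃ Tail3 i n :=
    { toFun := fun d => ⟨d.1.flip n, Tail.wf_flip.2 d.2.1, by
        rw [← cond3_flip h, Tail.flip_flip]
        exact d.2.2⟩
      invFun := fun d => ⟨d.1.flip n, Tail.wf_flip.2 d.2.1, (cond3_flip h n d.1).2 d.2.2⟩
      left_inv := fun d => Subtype.ext (Tail.flip_flip _ _)
      right_inv := fun d => Subtype.ext (Tail.flip_flip _ _) }
  exact (e.hasSum_iff.2 hF).congr_fun fun d => (Tail.weight_flip d.1 n).symm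

/-- The series `1 / (1 - q)`. -/
def geomQ : Ser := Ring.inverse (1 - q)

/-- The series `1 / (1 - q t)`. -/
def geomQT : Ser := Ring.inverse (1 - q * t)

theorem geomQT_mul : geomQT * (1 - q * t) = 1 := Ring.inverse_mul_cancel _ isUnit_one_sub_qt

/-- The parameters: `h + 1` is the size of the hole, `b` and `b'` are the numbers of cells of the
upper component below and above the pivot cell, `a + 1` is the size of the lower component, and the
last column contains `i + 1` and `j + 1` cells below and above the hole. -/
theorem hasSum_delta {n : ℕ} (hn : 1 ≤ n) : HasSum (fun d : Tail3 .delta n => d.1.weight)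
    (q ^ 2 * (q * t) ^ 3 * (geomQ ^ 3 * geomQT ^ 3)) := by
  refine hasSum_tail3 (ι := ℕ × ℕ × ℕ × ℕ × ℕ × ℕ) (fun ⟨a, b, b', h, i, j⟩ =>
    ⟨-b - 2 - h - a, -b - 2 - h, -b, b', -b - 2 - h - i, -b + j⟩) ?_ (fun d => ?_) ?_
  · rintro ⟨a, b, b', h, i, j⟩ ⟨c, e, e', k, r, s⟩ heq
    simp only [Tail.mk.injEq] at heq
    simp only [Prod.mk.injEq]
    omega
  · rw [cond3_delta_iff hn]
    constructor
    · intro hd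
      refine ⟨((d.l1 - d.l0).toNat, (-d.u0).toNat, d.u1.toNat, (d.u0 - 2 - d.l1).toNat,
        (d.l1 - d.m0).toNat, (d.m1 - d.u0).toNat), ?_⟩
      ext <;> simp only <;> omega
    · rintro ⟨⟨a, b, b', h, i, j⟩, rfl⟩
      simp only
      omega
  · have := (hasSum_mul hasSum_q (hasSum_mul hasSum_q (hasSum_mul hasSum_q (hasSum_mul hasSum_qt
      (hasSum_mul hasSum_qt hasSum_qt))))).mul_left (q ^ 2 * (q * t) ^ 3)
    rw [show q ^ 2 * (q * t) ^ 3 * (geomQ ^ 3 * geomQT ^ 3) = q ^ 2 * (q * t) ^ 3 *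
      (geomQ * (geomQ * (geomQ * (geomQT * (geomQT * geomQT))))) by ring]
    refine this.congr_fun ?_
    rintro ⟨a, b, b', h, i, j⟩
    have h1 : Tail.duplexArea ⟨-b - 2 - h - a, -b - 2 - h, -b, b', -b - 2 - h - i, -b + j⟩ =
        2 + a + b + b' := by
      simp only [Tail.duplexArea]
      omega
    have h2 : Tail.height ⟨-b - 2 - h - a, -b - 2 - h, -b, b', -b - 2 - h - i, -b + j⟩ =
        3 + h + i + j := by
      simp only [Tail.height]
      omega
    rw [Tail.weight, h1, h2]
    simp only [pow_add]
    ring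

theorem sum_qt_pow (m : ℕ) : ∑ s : Fin m, (q * t) ^ (s : ℕ) = geomQT * (1 - (q * t) ^ m) := by
  rw [Fin.sum_univ_eq_sum_range fun s => (q * t) ^ s]
  have := geom_sum_mul_neg (q * t) m
  linear_combination geomQT * this - (∑ s ∈ Finset.range m, (q * t) ^ s) * geomQT_mul

theorem sum_qt_pow_sub (m : ℕ) :
    ∑ l : Fin m, (q * t) ^ (m - (l : ℕ)) = q * t * (geomQT * (1 - (q * t) ^ m)) := by
  rw [← sum_qt_pow, ← Equiv.sum_comp Fin.revPerm, Finset.mul_sum]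
  refine Finset.sum_congr rfl fun l _ => ?_
  rw [← pow_succ', Fin.revPerm_apply, Fin.val_rev]
  congr 1
  omega

/-- The sum over the holes `[l + 1, u]` in the interior of `[0, m]`, weighted by their size. -/
theorem sum_holes_pow (m : ℕ) : ∑ x : (Σ u : Fin m, Fin u), (q * t) ^ ((x.1 : ℕ) - (x.2 : ℕ)) =
    q * t * geomQT * (m - geomQT * (1 - (q * t) ^ m)) := by
  rw [Fintype.sum_sigma]
  simp only [sum_qt_pow_sub]
  rw [← sum_qt_pow, ← Finset.mul_sum, ← Finset.mul_sum, Finset.sum_sub_distrib]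
  simp [mul_assoc]

theorem card_holes (m : ℕ) : Fintype.card (Σ u : Fin m, Fin u) = m.choose 2 := by
  rw [Fintype.card_sigma]
  simp only [Fintype.card_fin]
  rw [Fin.sum_univ_eq_sum_range fun s => s, Finset.sum_range_id, Nat.choose_two_right]

/-- The parameters: the pivot cell has `h` cells of the hole below it and `s` above it, `a + 1` and
`b + 1` are the sizes of the components, and the last column contains `i + 1` and `j + 1` cells below
and above the hole. -/
theorem hasSum_epsilon {n : ℕ} (hn : 1 ≤ n) : HasSum (fun d : Tail3 .epsilon n => d.1.weight)
    (q ^ 2 * (q * t) ^ 2 * (geomQ ^ 2 * geomQT ^ 4) * (q * t - (q * t) ^ n)) := by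
  refine hasSum_tail3 (ι := ℕ × ℕ × ℕ × ℕ × ℕ × Fin (n - 1)) (fun ⟨a, b, h, i, j, s⟩ =>
    ⟨-1 - h - a, -1 - h, s + 1, s + 1 + b, -1 - h - i, s + 1 + j⟩) ?_ (fun d => ?_) ?_
  · rintro ⟨a, b, h, i, j, s⟩ ⟨a', b', h', i', j', s'⟩ heq
    simp only [Tail.mk.injEq] at heq
    simp only [Prod.mk.injEq, Fin.ext_iff]
    omega
  · rw [cond3_epsilon_iff]
    constructor
    · intro hd
      refine ⟨((d.l1 - d.l0).toNat, (d.u1 - d.u0).toNat, (-1 - d.l1).toNat, (d.l1 - d.m0).toNat,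
        (d.m1 - d.u0).toNat, ⟨(d.u0 - 1).toNat, by omega⟩), ?_⟩
      ext <;> simp only <;> omega
    · rintro ⟨⟨a, b, h, i, j, s⟩, rfl⟩
      simp only
      omega
  · have := (hasSum_mul hasSum_q (hasSum_mul hasSum_q (hasSum_mul hasSum_qt (hasSum_mul hasSum_qt
      (hasSum_mul hasSum_qt (hasSum_fintype fun s : Fin (n - 1) => (q * t) ^ (s : ℕ))))))).mul_left
        (q ^ 2 * (q * t) ^ 3)
    rw [sum_qt_pow] at this
    obtain ⟨m, rfl⟩ := Nat.exists_eq_add_of_le' hn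
    rw [show q ^ 2 * (q * t) ^ 2 * (geomQ ^ 2 * geomQT ^ 4) * (q * t - (q * t) ^ (m + 1)) =
      q ^ 2 * (q * t) ^ 3 * (geomQ * (geomQ * (geomQT * (geomQT * (geomQT *
        (geomQT * (1 - (q * t) ^ m))))))) by ring]
    refine this.congr_fun ?_
    rintro ⟨a, b, h, i, j, s⟩
    have h1 : Tail.duplexArea ⟨-1 - h - a, -1 - h, s + 1, s + 1 + b, -1 - h - i, s + 1 + j⟩ =
        2 + a + b := by
      simp only [Tail.duplexArea]
      omega
    have h2 : Tail.height ⟨-1 - h - a, -1 - h, s + 1, s + 1 + b, -1 - h - i, s + 1 + j⟩ =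
        3 + h + i + j + s := by
      simp only [Tail.height]
      omega
    rw [Tail.weight, h1, h2]
    simp only [pow_add]
    ring

/-- The parameters: `[l + 1, u]` is the hole, `a + 1` and `b + 1` are the sizes of the components,
and the last column contains `i + 1` and `j + 1` cells below and above the hole. -/
theorem hasSum_theta {n : ℕ} (hn : 1 ≤ n) : HasSum (fun d : Tail3 .theta n => d.1.weight)
    (q ^ 2 * (q * t) ^ 2 * (geomQ ^ 2 * geomQT ^ 4) *
      (q * t * (1 - q * t) * (n - 1 : ℕ) - (q * t - (q * t) ^ n))) := by
  refine hasSum_tail3 (ι := ℕ × ℕ × ℕ × ℕ × (Σ u : Fin (n - 1), Fin u)) (fun ⟨a, b, i, j, u, l⟩ =>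
    ⟨l - a, l, u + 1, u + 1 + b, l - i, u + 1 + j⟩) ?_ (fun d => ?_) ?_
  · rintro ⟨a, b, i, j, ⟨u, hu⟩, ⟨l, hl⟩⟩ ⟨a', b', i', j', ⟨u', hu'⟩, ⟨l', hl'⟩⟩ heq
    simp only [Tail.mk.injEq] at heq
    obtain rfl : u = u' := by omega
    obtain rfl : l = l' := by omega
    simp only [Prod.mk.injEq, and_true]
    omega
  · rw [cond3_theta_iff]
    constructor
    · intro hd
      refine ⟨((d.l1 - d.l0).toNat, (d.u1 - d.u0).toNat, (d.l1 - d.m0).toNat,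
        (d.m1 - d.u0).toNat, ⟨⟨(d.u0 - 1).toNat, by omega⟩, ⟨d.l1.toNat, by simp only; omega⟩⟩), ?_⟩
      ext <;> simp only <;> omega
    · rintro ⟨⟨a, b, i, j, ⟨u, hu⟩, ⟨l, hl⟩⟩, rfl⟩
      simp only at hl ⊢
      omega
  · have := (hasSum_mul hasSum_q (hasSum_mul hasSum_q (hasSum_mul hasSum_qt (hasSum_mul hasSum_qt
      (hasSum_fintype fun x : (Σ u : Fin (n - 1), Fin u) =>
        (q * t) ^ ((x.1 : ℕ) - (x.2 : ℕ))))))).mul_left (q ^ 2 * (q * t) ^ 2)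
    rw [sum_holes_pow] at this
    rw [show q ^ 2 * (q * t) ^ 2 * (geomQ ^ 2 * geomQT ^ 4) *
      (q * t * (1 - q * t) * (n - 1 : ℕ) - (q * t - (q * t) ^ n)) = q ^ 2 * (q * t) ^ 2 *
      (geomQ * (geomQ * (geomQT * (geomQT * (q * t * geomQT *
        ((n - 1 : ℕ) - geomQT * (1 - (q * t) ^ (n - 1)))))))) by
      rw [← mul_pow_sub_one (Nat.one_le_iff_ne_zero.1 hn) (q * t)]
      linear_combination q ^ 2 * (q * t) ^ 3 * geomQ ^ 2 * geomQT ^ 3 * (n - 1 : ℕ) * geomQT_mul]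
    refine this.congr_fun ?_
    rintro ⟨a, b, i, j, ⟨u, hu⟩, ⟨l, hl⟩⟩
    simp only at hl
    have h1 : Tail.duplexArea ⟨l - a, l, u + 1, u + 1 + b, l - i, u + 1 + j⟩ = 2 + a + b := by
      simp only [Tail.duplexArea]
      omega
    have h2 : Tail.height ⟨l - a, l, u + 1, u + 1 + b, l - i, u + 1 + j⟩ =
        2 + i + j + (u - l) := by
      simp only [Tail.height]
      omega
    simp only
    rw [Tail.weight, h1, h2]
    simp only [pow_add]
    ring

/-- The parameters: `[l + 1, u]` is the hole, `r + 1` and `a + 1` are the numbers of cells of the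
lower component above the top of the last column, respectively not above it, `b + 1` is the size of
the upper component and `i + 1` that of the last column. -/
theorem hasSum_iota (n : ℕ) : HasSum (fun d : Tail3 .iota n => d.1.weight)
    (q ^ 3 * (q * t) * (geomQ ^ 3 * geomQT) * (n - 1).choose 2) := by
  refine hasSum_tail3 (ι := ℕ × ℕ × ℕ × ℕ × (Σ u : Fin (n - 1), Fin u)) (fun ⟨a, r, b, i, u, l⟩ =>
    ⟨l - 1 - r - a, l, u + 1, u + 1 + b, l - 1 - r - i, l - 1 - r⟩) ?_ (fun d => ?_) ?_
  · rintro ⟨a, r, b, i, ⟨u, hu⟩, ⟨l, hl⟩⟩ ⟨a', r', b', i', ⟨u', hu'⟩, ⟨l', hl'⟩⟩ heq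
    simp only [Tail.mk.injEq] at heq
    obtain rfl : u = u' := by omega
    obtain rfl : l = l' := by omega
    simp only [Prod.mk.injEq, and_true]
    omega
  · rw [cond3_iota_iff]
    constructor
    · intro hd
      refine ⟨((d.m1 - d.l0).toNat, (d.l1 - 1 - d.m1).toNat, (d.u1 - d.u0).toNat,
        (d.m1 - d.m0).toNat, ⟨⟨(d.u0 - 1).toNat, by omega⟩, ⟨d.l1.toNat, by simp only; omega⟩⟩), ?_⟩
      ext <;> simp only <;> omega
    · rintro ⟨⟨a, r, b, i, ⟨u, hu⟩, ⟨l, hl⟩⟩, rfl⟩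
      simp only at hl ⊢
      omega
  · have := (hasSum_mul hasSum_q (hasSum_mul hasSum_q (hasSum_mul hasSum_q (hasSum_mul hasSum_qt
      (hasSum_fintype fun _ : (Σ u : Fin (n - 1), Fin u) => (1 : Ser)))))).mul_left
        (q ^ 3 * (q * t))
    rw [Finset.sum_const, Finset.card_univ, card_holes, nsmul_one] at this
    rw [show q ^ 3 * (q * t) * (geomQ ^ 3 * geomQT) * ((n - 1).choose 2 : Ser) =
      q ^ 3 * (q * t) * (geomQ * (geomQ * (geomQ * (geomQT * ((n - 1).choose 2 : Ser))))) by ring]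
    refine this.congr_fun ?_
    rintro ⟨a, r, b, i, ⟨u, hu⟩, ⟨l, hl⟩⟩
    simp only at hl
    have h1 : Tail.duplexArea ⟨l - 1 - r - a, l, u + 1, u + 1 + b, l - 1 - r - i, l - 1 - r⟩ =
        3 + a + r + b := by
      simp only [Tail.duplexArea]
      omega
    have h2 : Tail.height ⟨l - 1 - r - a, l, u + 1, u + 1 + b, l - 1 - r - i, l - 1 - r⟩ =
        1 + i := by
      simp only [Tail.height]
      omega
    simp only
    rw [Tail.weight, h1, h2]
    simp only [pow_add]
    ring

/-- The parameters: `[l + 1, u]` is the hole, `a + 1` and `b + 1` are the sizes of the components,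
and the last column extends `i` cells below and `j` cells above the inner pivot cell, where
`j ≤ u - l` because the upper component is not reached. -/
theorem hasSum_kappa {n : ℕ} (hn : 1 ≤ n) : HasSum (fun d : Tail3 .kappa n => d.1.weight)
    (q ^ 2 * (q * t) * (geomQ ^ 2 * geomQT ^ 2) * (n - 1).choose 2 -
      q ^ 2 * (q * t) ^ 2 * (geomQ ^ 2 * geomQT ^ 4) *
        (q * t * (1 - q * t) * (n - 1 : ℕ) - (q * t - (q * t) ^ n))) := by
  refine hasSum_tail3
    (ι := ℕ × ℕ × ℕ × (Σ x : (Σ u : Fin (n - 1), Fin u), Fin ((x.1 : ℕ) - x.2 + 1)))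
    (fun ⟨a, b, i, ⟨u, l⟩, j⟩ => ⟨l - a, l, u + 1, u + 1 + b, l - i, l + j⟩) ?_ (fun d => ?_) ?_
  · rintro ⟨a, b, i, ⟨⟨u, hu⟩, ⟨l, hl⟩⟩, ⟨j, hj⟩⟩ ⟨a', b', i', ⟨⟨u', hu'⟩, ⟨l', hl'⟩⟩, ⟨j', hj'⟩⟩
      heq
    simp only [Tail.mk.injEq] at heq
    obtain rfl : u = u' := by omega
    obtain rfl : l = l' := by omega
    obtain rfl : j = j' := by omega
    simp only [Prod.mk.injEq, and_true]
    omega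
  · rw [cond3_kappa_iff]
    constructor
    · intro hd
      refine ⟨((d.l1 - d.l0).toNat, (d.u1 - d.u0).toNat, (d.l1 - d.m0).toNat,
        ⟨⟨⟨(d.u0 - 1).toNat, by omega⟩, ⟨d.l1.toNat, by simp only; omega⟩⟩,
          ⟨(d.m1 - d.l1).toNat, by simp only; omega⟩⟩), ?_⟩
      ext <;> simp only <;> omega
    · rintro ⟨⟨a, b, i, ⟨⟨u, hu⟩, ⟨l, hl⟩⟩, ⟨j, hj⟩⟩, rfl⟩
      simp only at hl hj ⊢
      omega
  · have := (hasSum_mul hasSum_q (hasSum_mul hasSum_q (hasSum_mul hasSum_qt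
      (hasSum_fintype fun x : (Σ x : (Σ u : Fin (n - 1), Fin u), Fin ((x.1 : ℕ) - x.2 + 1)) =>
        (q * t) ^ (x.2 : ℕ))))).mul_left (q ^ 2 * (q * t))
    rw [Fintype.sum_sigma] at this
    simp only [sum_qt_pow, pow_succ (q * t)] at this
    rw [← Finset.mul_sum, Finset.sum_sub_distrib, ← Finset.sum_mul, sum_holes_pow, Finset.sum_const,
      Finset.card_univ, card_holes, nsmul_one] at this
    rw [show q ^ 2 * (q * t) * (geomQ ^ 2 * geomQT ^ 2) * ((n - 1).choose 2 : Ser) -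
      q ^ 2 * (q * t) ^ 2 * (geomQ ^ 2 * geomQT ^ 4) *
        (q * t * (1 - q * t) * (n - 1 : ℕ) - (q * t - (q * t) ^ n)) = q ^ 2 * (q * t) *
      (geomQ * (geomQ * (geomQT * (geomQT * ((n - 1).choose 2 - q * t * geomQT *
        ((n - 1 : ℕ) - geomQT * (1 - (q * t) ^ (n - 1))) * (q * t)))))) by
      rw [← mul_pow_sub_one (Nat.one_le_iff_ne_zero.1 hn) (q * t)]
      linear_combination -q ^ 2 * (q * t) ^ 3 * geomQ ^ 2 * geomQT ^ 3 * (n - 1 : ℕ) * geomQT_mul]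
    refine this.congr_fun ?_
    rintro ⟨a, b, i, ⟨⟨u, hu⟩, ⟨l, hl⟩⟩, ⟨j, hj⟩⟩
    simp only at hl hj
    have h1 : Tail.duplexArea ⟨l - a, l, u + 1, u + 1 + b, l - i, l + j⟩ = 2 + a + b := by
      simp only [Tail.duplexArea]
      omega
    have h2 : Tail.height ⟨l - a, l, u + 1, u + 1 + b, l - i, l + j⟩ = 1 + i + j := by
      simp only [Tail.height]
      omega
    simp only
    rw [Tail.weight, h1, h2]
    simp only [pow_add]
    ring

theorem hasSum_beta {n : ℕ} (hn : 1 ≤ n) :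
    HasSum (fun m : Tail2 .beta n => (q * t) ^ (m.1.2 + 1 - m.1.1).toNat)
      (q * t * geomQT ^ 2) := by
  let e : ℕ × ℕ ≃ Tail2 .beta n :=
    { toFun := fun x => ⟨(-x.1, x.2), by simp only [Cond2]; omega⟩
      invFun := fun m => ((-m.1.1).toNat, m.1.2.toNat)
      left_inv := fun x => by simp
      right_inv := fun m => by
        obtain ⟨⟨m0, m1⟩, h, hc⟩ := m
        simp only [Cond2] at hc
        refine Subtype.ext (Prod.ext ?_ ?_) <;> simp only <;> omega }
  rw [← e.hasSum_iff, show q * t * geomQT ^ 2 = q * t * (geomQT * geomQT) by ring]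
  refine ((hasSum_mul hasSum_qt hasSum_qt).mul_left (q * t)).congr_fun fun x => ?_
  have h : ((x.2 : ℤ) + 1 - -x.1).toNat = 1 + x.1 + x.2 := by omega
  change (q * t) ^ ((x.2 : ℤ) + 1 - -x.1).toNat = _
  rw [h]
  ring

theorem hasSum_gamma (n : ℕ) :
    HasSum (fun m : Tail2 .gamma n => (q * t) ^ (m.1.2 + 1 - m.1.1).toNat)
      (q * t * geomQT * (n - 1 : ℕ)) := by
  let e : ℕ × Fin (n - 1) ≃ Tail2 .gamma n :=
    { toFun := fun x => ⟨((x.2 : ℕ) + 1, (x.2 : ℕ) + 1 + x.1), by simp only [Cond2]; omega⟩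
      invFun := fun m => ((m.1.2 - m.1.1).toNat, ⟨(m.1.1 - 1).toNat, by
        obtain ⟨⟨m0, m1⟩, h, hc⟩ := m
        simp only [Cond2] at h hc ⊢
        omega⟩)
      left_inv := fun x => by
        refine Prod.ext ?_ (Fin.ext ?_) <;> simp
      right_inv := fun m => by
        obtain ⟨⟨m0, m1⟩, h, hc⟩ := m
        simp only [Cond2] at h hc
        refine Subtype.ext (Prod.ext ?_ ?_) <;> simp only <;> omega }
  have := (hasSum_mul hasSum_qt (hasSum_fintype fun _ : Fin (n - 1) => (1 : Ser))).mul_left (q * t)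
  rw [Finset.sum_const, Finset.card_univ, Fintype.card_fin, nsmul_one, ← mul_assoc] at this
  rw [← e.hasSum_iff]
  refine this.congr_fun fun x => ?_
  have h : (((x.2 : ℕ) : ℤ) + 1 + x.1 + 1 - ((x.2 : ℕ) + 1)).toNat = 1 + x.1 := by omega
  change (q * t) ^ (((x.2 : ℕ) : ℤ) + 1 + x.1 + 1 - ((x.2 : ℕ) + 1)).toNat = _
  rw [h]
  ring

theorem hasSum_duplexStart : HasSum (fun d : DuplexStart => d.1.weight)
    (q ^ 2 * (q * t) ^ 3 * (geomQ ^ 2 * geomQT ^ 3)) := by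
  let e : ℕ × ℕ × ℕ × ℕ × ℕ ≃ DuplexStart :=
    { toFun := fun ⟨a, b, h, i, j⟩ => ⟨⟨-a, 0, h + 2, h + 2 + b, -i, h + 2 + j⟩, by
        simp only [Tail.Wf, Tail.ML, Tail.MU, and_true]; omega⟩
      invFun := fun d => ((-d.1.l0).toNat, (d.1.u1 - d.1.u0).toNat, (d.1.u0 - 2).toNat,
        (-d.1.m0).toNat, (d.1.m1 - d.1.u0).toNat)
      left_inv := fun ⟨a, b, h, i, j⟩ => by
        simp only [Prod.mk.injEq]
        omega
      right_inv := fun d => by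
        obtain ⟨d, hd, hl⟩ := d
        simp only [Tail.Wf, Tail.ML, Tail.MU] at hd
        refine Subtype.ext ?_
        ext <;> simp only <;> omega }
  rw [← e.hasSum_iff, show q ^ 2 * (q * t) ^ 3 * (geomQ ^ 2 * geomQT ^ 3) = q ^ 2 * (q * t) ^ 3 *
    (geomQ * (geomQ * (geomQT * (geomQT * geomQT)))) by ring]
  refine ((hasSum_mul hasSum_q (hasSum_mul hasSum_q (hasSum_mul hasSum_qt (hasSum_mul hasSum_qt
    hasSum_qt)))).mul_left (q ^ 2 * (q * t) ^ 3)).congr_fun ?_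
  rintro ⟨a, b, h, i, j⟩
  have h1 : Tail.duplexArea ⟨-a, 0, h + 2, h + 2 + b, -i, h + 2 + j⟩ = 2 + a + b := by
    simp only [Tail.duplexArea]
    omega
  have h2 : Tail.height ⟨-a, 0, h + 2, h + 2 + b, -i, h + 2 + j⟩ = 3 + h + i + j := by
    simp only [Tail.height]
    omega
  change Tail.weight ⟨-a, 0, h + 2, h + 2 + b, -i, h + 2 + j⟩ = _
  rw [Tail.weight, h1, h2]
  simp only [pow_add]
  ring

/-! ### The generating functions of the classes -/

theorem Acls_alpha : Acls .alpha =
    q * t * geomQT + w * (q ^ 2 * (q * t) ^ 3 * (geomQ ^ 2 * geomQT ^ 3)) := by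
  have h := hasSum_genFun_of_range polyAlpha_injective range_polyAlpha
  refine h.unique (HasSum.sum ?_ ?_)
  · refine (hasSum_qt.mul_left (q * t)).congr_fun fun n => ?_
    change q ^ (seg 0 0 n).card * t ^ lastHeight (seg 0 0 n) * w ^ numDuplex (seg 0 0 n) = _
    have h1 := (endsAt_seg (x := 0) (Int.natCast_nonneg n)).lastHeight_eq
    have h2 : lastHeight (seg 0 0 n) = n + 1 := by omega
    have h3 : (seg 0 0 n).card = n + 1 := by
      rw [card_seg]
      omega
    rw [h2, h3, numDuplex_seg (Int.natCast_nonneg n)]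
    ring
  · refine (hasSum_duplexStart.mul_left w).congr_fun fun d => ?_
    change q ^ (ext3 ∅ 0 d.1).card * t ^ lastHeight (ext3 ∅ 0 d.1) *
      w ^ numDuplex (ext3 ∅ 0 d.1) = _
    rw [card_ext3 (empty_le 0) d.2.1.1, lastHeight_ext3 (empty_le 0) d.2.1.1,
      numDuplex_ext3 (empty_le 0) d.2.1.1, numDuplex_empty, Tail.weight, Finset.card_empty]
    ring

theorem Acls_beta : Acls .beta = q * t * geomQT ^ 2 * lift A₁ := by
  rw [Acls_eq_of_hasSum_tail2 (a := q * t * geomQT ^ 2) (b := 0) (c := 0) (e := 0) (Or.inl rfl)]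
  · ring
  · intro n hn
    convert hasSum_beta hn using 1
    ring

theorem Acls_gamma : Acls .gamma = q * t * geomQT * lift B₁ := by
  rw [Acls_eq_of_hasSum_tail2 (a := 0) (b := q * t * geomQT) (c := 0) (e := 0) (Or.inr rfl)]
  · ring
  · intro n _
    convert hasSum_gamma n using 1
    ring

theorem Acls_of_eq_delta {i : Label} (h1 : i ≠ .alpha) (h2 : i ≠ .beta) (h3 : i ≠ .gamma)
    (h : ∀ n, 1 ≤ n → HasSum (fun d : Tail3 i n => d.1.weight)
      (q ^ 2 * (q * t) ^ 3 * (geomQ ^ 3 * geomQT ^ 3))) :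
    Acls i = w * (q ^ 2 * (q * t) ^ 3 * (geomQ ^ 3 * geomQT ^ 3)) * lift A₁ := by
  rw [Acls_eq_of_hasSum_tail3 (a := q ^ 2 * (q * t) ^ 3 * (geomQ ^ 3 * geomQT ^ 3)) (b := 0)
    (c := 0) (e := 0) h1 h2 h3]
  · ring
  · intro n hn
    convert h n hn using 1
    ring

theorem Acls_of_eq_epsilon {i : Label} (h1 : i ≠ .alpha) (h2 : i ≠ .beta) (h3 : i ≠ .gamma)
    (h : ∀ n, 1 ≤ n → HasSum (fun d : Tail3 i n => d.1.weight)
      (q ^ 2 * (q * t) ^ 2 * (geomQ ^ 2 * geomQT ^ 4) * (q * t - (q * t) ^ n))) :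
    Acls i = w * (q ^ 2 * (q * t) ^ 2 * (geomQ ^ 2 * geomQT ^ 4)) *
      (q * t * lift A₁ - substQT A) := by
  rw [Acls_eq_of_hasSum_tail3 (a := q ^ 2 * (q * t) ^ 2 * (geomQ ^ 2 * geomQT ^ 4) * (q * t))
    (b := 0) (c := 0) (e := -(q ^ 2 * (q * t) ^ 2 * (geomQ ^ 2 * geomQT ^ 4))) h1 h2 h3]
  · ring
  · intro n hn
    convert h n hn using 1
    ring

theorem Acls_theta : Acls .theta = w * (q ^ 2 * (q * t) ^ 3 * (geomQ ^ 2 * geomQT ^ 3)) * lift B₁ -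
    w * (q ^ 2 * (q * t) ^ 2 * (geomQ ^ 2 * geomQT ^ 4)) * (q * t * lift A₁ - substQT A) := by
  rw [Acls_eq_of_hasSum_tail3 (a := -(q ^ 2 * (q * t) ^ 2 * (geomQ ^ 2 * geomQT ^ 4) * (q * t)))
    (b := q ^ 2 * (q * t) ^ 3 * (geomQ ^ 2 * geomQT ^ 3))
    (c := 0) (e := q ^ 2 * (q * t) ^ 2 * (geomQ ^ 2 * geomQT ^ 4)) (by simp) (by simp) (by simp)]
  · ring
  · intro n hn
    convert hasSum_theta hn using 1
    linear_combination -q ^ 2 * (q * t) ^ 3 * geomQ ^ 2 * geomQT ^ 3 * (n - 1 : ℕ) * geomQT_mul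

theorem Acls_of_eq_iota {i : Label} (h1 : i ≠ .alpha) (h2 : i ≠ .beta) (h3 : i ≠ .gamma)
    (h : ∀ n, 1 ≤ n → HasSum (fun d : Tail3 i n => d.1.weight)
      (q ^ 3 * (q * t) * (geomQ ^ 3 * geomQT) * (n - 1).choose 2)) :
    Acls i = w * (q ^ 3 * (q * t) * (geomQ ^ 3 * geomQT)) * lift C₁ := by
  rw [Acls_eq_of_hasSum_tail3 (a := 0) (b := 0) (c := q ^ 3 * (q * t) * (geomQ ^ 3 * geomQT))
    (e := 0) h1 h2 h3]
  · ring
  · intro n hn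
    convert h n hn using 1
    ring

theorem Acls_of_eq_kappa {i : Label} (h1 : i ≠ .alpha) (h2 : i ≠ .beta) (h3 : i ≠ .gamma)
    (h : ∀ n, 1 ≤ n → HasSum (fun d : Tail3 i n => d.1.weight)
      (q ^ 2 * (q * t) * (geomQ ^ 2 * geomQT ^ 2) * (n - 1).choose 2 -
        q ^ 2 * (q * t) ^ 2 * (geomQ ^ 2 * geomQT ^ 4) *
          (q * t * (1 - q * t) * (n - 1 : ℕ) - (q * t - (q * t) ^ n)))) :
    Acls i = w * (q ^ 2 * (q * t) * (geomQ ^ 2 * geomQT ^ 2)) * lift C₁ -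
      w * (q ^ 2 * (q * t) ^ 3 * (geomQ ^ 2 * geomQT ^ 3)) * lift B₁ +
      w * (q ^ 2 * (q * t) ^ 2 * (geomQ ^ 2 * geomQT ^ 4)) * (q * t * lift A₁ - substQT A) := by
  rw [Acls_eq_of_hasSum_tail3 (a := q ^ 2 * (q * t) ^ 2 * (geomQ ^ 2 * geomQT ^ 4) * (q * t))
    (b := -(q ^ 2 * (q * t) ^ 3 * (geomQ ^ 2 * geomQT ^ 3)))
    (c := q ^ 2 * (q * t) * (geomQ ^ 2 * geomQT ^ 2))
    (e := -(q ^ 2 * (q * t) ^ 2 * (geomQ ^ 2 * geomQT ^ 4))) h1 h2 h3]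
  · ring
  · intro n hn
    convert h n hn using 1
    linear_combination q ^ 2 * (q * t) ^ 3 * geomQ ^ 2 * geomQT ^ 3 * (n - 1 : ℕ) * geomQT_mul

theorem frac_one_sub_q (a : Ser) (m : ℕ) : a ⊘ (1 - q) ^ m = a * geomQ ^ m := by
  rw [frac, ← Ring.inverse_pow, geomQ]

theorem frac_one_sub_qt (a : Ser) (m : ℕ) : a ⊘ (1 - q * t) ^ m = a * geomQT ^ m := by
  rw [frac, ← Ring.inverse_pow, geomQT]

theorem frac_mul (a : Ser) (k m : ℕ) :
    a ⊘ ((1 - q) ^ k * (1 - q * t) ^ m) = a * (geomQ ^ k * geomQT ^ m) := by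
  rw [frac, Ring.mul_inverse_rev, ← Ring.inverse_pow, ← Ring.inverse_pow, geomQ, geomQT,
    mul_comm (Ring.inverse _ ^ m)]

end SimplexDuplex
end

open SimplexDuplex
theorem theorem1 :
    -- the twelve classes form a partition of `S`
    (S = (⋃ i, Scls i) ∧ Pairwise (fun i j => Disjoint (Scls i) (Scls j)) ∧
      ∀ i, (Scls i).Nonempty) ∧
    -- the generating functions of the classes
    (Acls .alpha = q * t ⊘ (1 - q * t)
      + q ^ 5 * t ^ 3 * w ⊘ ((1 - q) ^ 2 * (1 - q * t) ^ 3)) ∧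
    (Acls .beta = q * t ⊘ (1 - q * t) ^ 2 * lift A₁) ∧
    (Acls .gamma = q * t ⊘ (1 - q * t) * lift B₁) ∧
    (Acls .delta = q ^ 5 * t ^ 3 * w ⊘ ((1 - q) ^ 3 * (1 - q * t) ^ 3) * lift A₁) ∧
    (Acls .zeta = q ^ 5 * t ^ 3 * w ⊘ ((1 - q) ^ 3 * (1 - q * t) ^ 3) * lift A₁) ∧
    (Acls .epsilon = q ^ 5 * t ^ 3 * w ⊘ ((1 - q) ^ 2 * (1 - q * t) ^ 4) * lift A₁
      - q ^ 4 * t ^ 2 * w ⊘ ((1 - q) ^ 2 * (1 - q * t) ^ 4) * substQT A) ∧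
    (Acls .eta = q ^ 5 * t ^ 3 * w ⊘ ((1 - q) ^ 2 * (1 - q * t) ^ 4) * lift A₁
      - q ^ 4 * t ^ 2 * w ⊘ ((1 - q) ^ 2 * (1 - q * t) ^ 4) * substQT A) ∧
    (Acls .theta = q ^ 5 * t ^ 3 * w ⊘ ((1 - q) ^ 2 * (1 - q * t) ^ 3) * lift B₁
      - q ^ 5 * t ^ 3 * w ⊘ ((1 - q) ^ 2 * (1 - q * t) ^ 4) * lift A₁
      + q ^ 4 * t ^ 2 * w ⊘ ((1 - q) ^ 2 * (1 - q * t) ^ 4) * substQT A) ∧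
    (Acls .iota = q ^ 4 * t * w ⊘ ((1 - q) ^ 3 * (1 - q * t)) * lift C₁) ∧
    (Acls .lambda = q ^ 4 * t * w ⊘ ((1 - q) ^ 3 * (1 - q * t)) * lift C₁) ∧
    (Acls .kappa = q ^ 3 * t * w ⊘ ((1 - q) ^ 2 * (1 - q * t) ^ 2) * lift C₁
      - q ^ 5 * t ^ 3 * w ⊘ ((1 - q) ^ 2 * (1 - q * t) ^ 3) * lift B₁
      + q ^ 5 * t ^ 3 * w ⊘ ((1 - q) ^ 2 * (1 - q * t) ^ 4) * lift A₁
      - q ^ 4 * t ^ 2 * w ⊘ ((1 - q) ^ 2 * (1 - q * t) ^ 4) * substQT A) ∧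
    (Acls .mu = q ^ 3 * t * w ⊘ ((1 - q) ^ 2 * (1 - q * t) ^ 2) * lift C₁
      - q ^ 5 * t ^ 3 * w ⊘ ((1 - q) ^ 2 * (1 - q * t) ^ 3) * lift B₁
      + q ^ 5 * t ^ 3 * w ⊘ ((1 - q) ^ 2 * (1 - q * t) ^ 4) * lift A₁
      - q ^ 4 * t ^ 2 * w ⊘ ((1 - q) ^ 2 * (1 - q * t) ^ 4) * substQT A) ∧
    -- `A(t)` is the sum of the parts
    (A = Acls .alpha + Acls .beta + Acls .gamma + Acls .delta + Acls .epsilon + Acls .zeta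
      + Acls .eta + Acls .theta + Acls .iota + Acls .kappa + Acls .lambda + Acls .mu) ∧
    -- the resulting functional equation
    (A = q * t ⊘ (1 - q * t) * (1 + lift B₁ + 2 * q ^ 3 * w ⊘ (1 - q) ^ 3 * lift C₁)
      + q * t ⊘ (1 - q * t) ^ 2 * (lift A₁ + 2 * q ^ 2 * w ⊘ (1 - q) ^ 2 * lift C₁)
      + q ^ 5 * t ^ 3 * w ⊘ ((1 - q) ^ 2 * (1 - q * t) ^ 3)
          * (1 + 2 ⊘ (1 - q) * lift A₁ - lift B₁)
      + 3 * q ^ 5 * t ^ 3 * w ⊘ ((1 - q) ^ 2 * (1 - q * t) ^ 4) * lift A₁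
      - 3 * q ^ 4 * t ^ 2 * w ⊘ ((1 - q) ^ 2 * (1 - q * t) ^ 4) * substQT A) := by
  have f1 : ∀ a : Ser, a ⊘ (1 - q) = a * geomQ := fun a => rfl
  have f2 : ∀ a : Ser, a ⊘ (1 - q * t) = a * geomQT := fun a => rfl
  have f3 : ∀ (a : Ser) (k : ℕ), a ⊘ ((1 - q) ^ k * (1 - q * t)) = a * (geomQ ^ k * geomQT) := by
    intro a k
    simpa only [pow_one] using frac_mul a k 1
  have hdelta := Acls_of_eq_delta (i := .delta) (by simp) (by simp) (by simp) fun n => hasSum_delta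
  have hzeta := Acls_of_eq_delta (i := .zeta) (by simp) (by simp) (by simp)
    fun n hn => hasSum_tail3_flip (by simp) (hasSum_delta hn)
  have hepsilon := Acls_of_eq_epsilon (i := .epsilon) (by simp) (by simp) (by simp)
    fun n => hasSum_epsilon
  have heta := Acls_of_eq_epsilon (i := .eta) (by simp) (by simp) (by simp)
    fun n hn => hasSum_tail3_flip (by simp) (hasSum_epsilon hn)
  have hiota := Acls_of_eq_iota (i := .iota) (by simp) (by simp) (by simp)
    fun n _ => hasSum_iota n
  have hlambda := Acls_of_eq_iota (i := .lambda) (by simp) (by simp) (by simp)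
    fun n _ => hasSum_tail3_flip (by simp) (hasSum_iota n)
  have hkappa := Acls_of_eq_kappa (i := .kappa) (by simp) (by simp) (by simp)
    fun n => hasSum_kappa
  have hmu := Acls_of_eq_kappa (i := .mu) (by simp) (by simp) (by simp)
    fun n hn => hasSum_tail3_flip (by simp) (hasSum_kappa hn)
  simp only [f1, f2, f3, frac_mul, frac_one_sub_q, frac_one_sub_qt]
  refine ⟨⟨S_eq_iUnion, pairwise_disjoint_Scls, Scls_nonempty⟩, ?_, Acls_beta, Acls_gamma, ?_, ?_,
    ?_, ?_, ?_, ?_, ?_, ?_, ?_, A_eq, ?_⟩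
  · rw [Acls_alpha]; ring
  · rw [hdelta]; ring
  · rw [hzeta]; ring
  · rw [hepsilon]; ring
  · rw [heta]; ring
  · rw [Acls_theta]; ring
  · rw [hiota]; ring
  · rw [hlambda]; ring
  · rw [hkappa]; ring
  · rw [hmu]; ring
  · conv_lhs => rw [A_eq, Acls_alpha, Acls_beta, Acls_gamma, hdelta, hzeta, hepsilon, heta,
      Acls_theta, hiota, hlambda, hkappa, hmu]
    ring
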